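/- **Theorem.** Let $Y=(0,1)^3$, let $\mathbb S$ be the set of real symmetric $3\times 3$ matrices, and write $\langle f\rangle=\int_Y f\,dx$, $F:H=\sum_{m,n}F_{mn}H_{mn}$, $(\mathsf C:F)_{mn}=\sum_{p,q}\mathsf C_{mnpq}F_{pq}$ and $[\nabla^s v]_{mn}=\frac12(\partial_m v_n+\partial_n v_m)$. Let $H^1_\#$ be the closure of the smooth $Y$-periodic functions in the norm of $H^1(Y)$. Assume: * (A) $D_0,\dots,D_M\subset Y$ are pairwise disjoint open sets with Lipschitz boundary, $Y\subset\bigcup_l\overline{D_l}$, and $\mathsf C(x)=\Lambda_l$ is constant for $x\in D_l$. * (B) $[\Lambda_l]_{mnpq}=[\Lambda_l]_{nmpq}=[\Lambda_l]_{mnqp}=[\Lambda_l]_{pqmn}$, and there are $\Lambda',\Lambda''>0$ with $\Lambda' F:F\le F:\Lambda_l:F\le\Lambda'' F:F$ for all $F\in\mathbb S$ and all $l$. * (C) For $N\ge1$ and $I\in\mathcal I_N=\{0,\dots,N-1\}^3$ let $Y_I=\prod_{m}(\frac{I_m}{N},\frac{I_m+1}{N})$. If $Y_I\subset D_l$, then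 $\mathsf C_N^\star[I]=\Lambda_l$; if $Y_I$ is contained in no $D_l$, then $\mathsf C_N^\star[I]$ is an arbitrary element of $\{\Lambda_{l'}:Y_I\cap D_{l'}\ne\varnothing\}$. For $E\in\mathbb S$ let $u\in (H^1_\#)^3$, $\langle u\rangle=0$, solve $\langle\nabla^s v:\mathsf C:\nabla^s u\rangle=-\langle\nabla^s v:\mathsf C:E\rangle$ for all $v\in (H^1_\#)^3$, and define $\mathsf C^{\mathrm{eff}}$ by $\mathsf C^{\mathrm{eff}}:E=\langle \mathsf C:(\nabla^s u+E)\rangle$ for all $E\in\mathbb S$. Let the reference tensor $\mathsf C^{\mathrm{ref}}$ be constant, with the symmetries in (B), and strongly elliptic: $(a\otimes\xi):\mathsf C^{\mathrm{ref}}:(a\otimes\xi)>0$ for all $a,\xi\in\mathbb R^3\setminus\{0\}$. For $\xi\in\mathbb R^3\setminus\{0\}$ let $A(\xi)_{np}=\sum_{m,q}\xi_m\mathsf C^{\mathrm{ref}}_{mnpq}\xi_q$, and let $\widehat{\Gamma^0}[\xi]$ be the Fourier symbol of the Green operator of $\mathsf C^{\mathrm{ref}}$, $$\widehat{\Gamma^0}[\xi]_{mnpq}=\tfrac14\big(\xi_mA^{-1}_{np}\xi_q+\xi_nA^{-1}_{mp}\xi_q+\xi_mA^{-1}_{nq}\xi_p+\xi_nA^{-1}_{mq}\xi_p\big),\qquad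 A=A(\xi).$$ Let $\mathcal F_N=\{\xi\in\mathbb Z^3:-N/2\le\xi_m<N/2\}$, and for a function $f$ on $\mathcal I_N$ let $\widehat f[\xi]=N^{-3}\sum_{I\in\mathcal I_N}f[I]e^{-2\pi i\,\xi\cdot I/N}$. A solution of Moulinec–Suquet's scheme for $E\in\mathbb S$ is a field $\varepsilon_N^\star$ on $\mathcal I_N$ of complex symmetric matrices which is a fixed point of the scheme, that is, $$\widehat{\varepsilon_N^\star}[0]=E,\qquad \widehat{\varepsilon_N^\star}[\xi]=-\widehat{\Gamma^0}[\xi]:\widehat{\tau_N^\star}[\xi]\quad(\xi\in\mathcal F_N\setminus\{0\}),\qquad \tau_N^\star[I]=(\mathsf C_N^\star[I]-\mathsf C^{\mathrm{ref}}):\varepsilon_N^\star[I],$$ and $\mathsf C_N^{\mathrm{eff},B}$ is defined by $\mathsf C_N^{\mathrm{eff},B}:E=N^{-3}\sum_{I\in\mathcal I_N}\mathsf C_N^\star[I]:\varepsilon_N^\star[I]$ for all $E\in\mathbb S$. Then, for every $E\in\mathbb S$, $u$ exists and is unique (up to null sets), and $\varepsilon_N^\star$ exists and is unique for every $N\ge1$.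 The tensors $\mathsf C^{\mathrm{eff}}$ (real) and $\mathsf C_N^{\mathrm{eff},B}$ (complex), taken with the symmetries $T_{mnpq}=T_{nmpq}=T_{mnqp}$, are well defined and uniquely determined by the formulas above, and $$\mathsf C_N^{\mathrm{eff},B}\longrightarrow\mathsf C^{\mathrm{eff}}\qquad(N\to\infty).$$ -/

import Mathlib

open Filter Topology MeasureTheory
open scoped Matrix ENNReal NNReal ContDiff

namespace MS

/-- Physical space `ℝ³` (the dimension is `d = 3` throughout). -/
abbrev Space := EuclideanSpace ℝ (Fin 3)

/-- Second-order tensors. -/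
abbrev Mat (𝕜 : Type) := Matrix (Fin 3) (Fin 3) 𝕜

/-- Fourth-order tensors, with entries `T m n p q`. -/
abbrev Tensor (𝕜 : Type) := Fin 3 → Fin 3 → Fin 3 → Fin 3 → 𝕜

/-- Double contraction `T : F` of a fourth-order with a second-order tensor. -/
def ddot {𝕜 : Type} [CommRing 𝕜] (T : Tensor 𝕜) (F : Mat 𝕜) : Mat 𝕜 :=
  Matrix.of fun m n => ∑ p, ∑ q, T m n p q * F p q

/-- Double contraction `F : H` of two second-order tensors. -/
def frob {𝕜 : Type} [CommRing 𝕜] (F H : Mat 𝕜) : 𝕜 := ∑ m, ∑ n, F m n * H m n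

/-- A real fourth-order tensor, regarded as a complex one. -/
def Tensor.toComplex (T : Tensor ℝ) : Tensor ℂ := fun m n p q => (T m n p q : ℂ)

/-- A real second-order tensor, regarded as a complex one. -/
def Mat.toComplex (F : Mat ℝ) : Mat ℂ := Matrix.of fun m n => (F m n : ℂ)

/-- The symmetries of a stiffness tensor:
`T m n p q = T n m p q = T m n q p = T p q m n`. -/
def IsStiffnessSymm (T : Tensor ℝ) : Prop :=
  ∀ m n p q, T m n p q = T n m p q ∧ T m n p q = T m n q p ∧ T m n p q = T p q m n

/-- Symmetry in each of the two index pairs. A fourth-order tensor with these symmetries is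
determined by its action on symmetric matrices. -/
def IsMinorSymm {𝕜 : Type} (T : Tensor 𝕜) : Prop :=
  ∀ m n p q, T m n p q = T n m p q ∧ T m n p q = T m n q p

/-! ### Geometry and material -/

/-- The representative volume element `Y = (0,1)³`. -/
def cell : Set Space := {x | ∀ m, 0 < x m ∧ x m < 1}

/-- The open voxel `Y_I`, the product of the intervals `(I m / N, (I m + 1) / N)`. -/
def voxel (N : ℕ) (I : Fin 3 → Fin N) : Set Space :=
  {x | ∀ m, ((I m : ℕ) : ℝ) / N < x m ∧ x m < (((I m : ℕ) : ℝ) + 1) / N}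

/-- An open set with Lipschitz boundary: near each of its boundary points it is the strict
epigraph, in the direction of some unit vector `ν`, of a Lipschitz function `γ` on the hyperplane
orthogonal to `ν`. (`γ` is evaluated only at the orthogonal projections `x - ⟪ν, x⟫ ν` to that
hyperplane.) -/
def IsLipschitzOpen (D : Set Space) : Prop :=
  IsOpen D ∧ ∀ x₀ ∈ frontier D, ∃ (r : ℝ) (ν : Space) (K : ℝ≥0) (γ : Space → ℝ),
    0 < r ∧ ‖ν‖ = 1 ∧ LipschitzWith K γ ∧
      ∀ x ∈ Metric.ball x₀ r, x ∈ D ↔ γ (x - (inner ℝ ν x) • ν) < inner ℝ ν x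

/-- `Y` consists of the pairwise disjoint Lipschitz subdomains `D 0, …, D M` (together with their
interfaces), and `C` takes the constant value `Λ l` in `D l`. -/
structure AssumptionA {M : ℕ} (D : Fin (M + 1) → Set Space) (Λ : Fin (M + 1) → Tensor ℝ)
    (C : Space → Tensor ℝ) : Prop where
  lipschitz : ∀ l, IsLipschitzOpen (D l)
  subset : ∀ l, D l ⊆ cell
  disjoint : ∀ l l', l ≠ l' → Disjoint (D l) (D l')
  cover : cell ⊆ ⋃ l, closure (D l)
  const : ∀ l, ∀ x ∈ D l, C x = Λ l

/-- Symmetry and uniform coercivity and boundedness of the constant tensors `Λ l`. -/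
structure AssumptionB {M : ℕ} (Λ : Fin (M + 1) → Tensor ℝ) : Prop where
  symm : ∀ l, IsStiffnessSymm (Λ l)
  coercive : ∃ a b : ℝ, 0 < a ∧ 0 < b ∧ ∀ F : Mat ℝ, F.IsSymm → ∀ l,
    a * frob F F ≤ frob F (ddot (Λ l) F) ∧ frob F (ddot (Λ l) F) ≤ b * frob F F

/-- The voxel data `CN` at resolution `N`: a voxel inside one subdomain carries the tensor of that
subdomain, any other voxel carries the tensor of some subdomain that it meets. -/
structure AssumptionC {M : ℕ} (D : Fin (M + 1) → Set Space) (Λ : Fin (M + 1) → Tensor ℝ)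
    (N : ℕ) (CN : (Fin 3 → Fin N) → Tensor ℝ) : Prop where
  inside : ∀ I l, voxel N I ⊆ D l → CN I = Λ l
  mixed : ∀ I, (∀ l, ¬ voxel N I ⊆ D l) → ∃ l, (voxel N I ∩ D l).Nonempty ∧ CN I = Λ l

/-! ### The periodic cell problem and the effective tensor -/

/-- Lebesgue measure on `Y`; its total mass is one, so that averages over `Y` are integrals. -/
noncomputable def cellMeasure : Measure Space := volume.restrict cell

/-- The partial derivative in the `m`-th coordinate direction. -/
noncomputable def partialDeriv (m : Fin 3) (φ : Space → ℝ) (x : Space) : ℝ :=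
  fderiv ℝ φ x (EuclideanSpace.single m 1)

/-- Smooth `Y`-periodic functions. -/
def IsSmoothPeriodic (φ : Space → ℝ) : Prop :=
  ContDiff ℝ ∞ φ ∧ ∀ x m, φ (x + EuclideanSpace.single m 1) = φ x

/-- `f` belongs to the periodic Sobolev space, the closure of the smooth `Y`-periodic functions in
the `H¹(Y)` norm, and `g 0, g 1, g 2` are its partial derivatives. -/
def MemH1Per (f : Space → ℝ) (g : Fin 3 → Space → ℝ) : Prop :=
  MemLp f 2 cellMeasure ∧ (∀ m, MemLp (g m) 2 cellMeasure) ∧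
    ∃ φ : ℕ → Space → ℝ, (∀ k, IsSmoothPeriodic (φ k)) ∧
      Tendsto (fun k => eLpNorm (fun x => φ k x - f x) 2 cellMeasure) atTop (𝓝 0) ∧
      ∀ m, Tendsto (fun k => eLpNorm (fun x => partialDeriv m (φ k) x - g m x) 2 cellMeasure)
        atTop (𝓝 0)

/-- `u` is a vector field with components in the periodic Sobolev space, and `G` is its gradient,
`G x m n = ∂ₘ uₙ (x)`. -/
def MemH1PerVec (u : Space → Fin 3 → ℝ) (G : Space → Mat ℝ) : Prop :=
  ∀ n, MemH1Per (fun x => u x n) (fun m x => G x m n)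

/-- Symmetric part of a matrix; applied to the gradient of `u` it is the strain of `u`. -/
noncomputable def symPart (F : Mat ℝ) : Mat ℝ := Matrix.of fun m n => (F m n + F n m) / 2

/-- `u`, with gradient `G`, is a solution of the periodic cell problem for the stiffness `C` and
the macroscopic strain `E`. -/
structure IsCellSolution (C : Space → Tensor ℝ) (E : Mat ℝ) (u : Space → Fin 3 → ℝ)
    (G : Space → Mat ℝ) : Prop where
  mem : MemH1PerVec u G
  mean_zero : ∀ n, ∫ x, u x n ∂cellMeasure = 0
  weak_form : ∀ v H, MemH1PerVec v H →
    ∫ x, frob (symPart (H x)) (ddot (C x) (symPart (G x))) ∂cellMeasure =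
      -∫ x, frob (symPart (H x)) (ddot (C x) E) ∂cellMeasure

/-- `T` is the effective stiffness tensor of `C`: for every symmetric `E`,
`T : E = ⟨C : (∇ˢ u + E)⟩`, where `u` solves the cell problem for `E`. -/
def IsEffectiveTensor (C : Space → Tensor ℝ) (T : Tensor ℝ) : Prop :=
  IsMinorSymm T ∧ ∀ E : Mat ℝ, E.IsSymm → ∃ u G, IsCellSolution C E u G ∧
    ∀ m n, ddot T E m n = ∫ x, ddot (C x) (symPart (G x) + E) m n ∂cellMeasure

/-! ### The Moulinec–Suquet scheme -/

/-- The frequency set: integer vectors with `-N/2 ≤ ξ m < N/2`. -/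
def freq (N : ℕ) : Set (Fin 3 → ℤ) := {ξ | ∀ m, -(N : ℤ) ≤ 2 * ξ m ∧ 2 * ξ m < (N : ℤ)}

/-- The discrete Fourier coefficient of `f` at `ξ`, normalised such that
`f I = ∑ ξ ∈ freq N, dft f ξ * exp (2 π i ξ · I / N)`. -/
noncomputable def dft {N : ℕ} (f : (Fin 3 → Fin N) → ℂ) (ξ : Fin 3 → ℤ) : ℂ :=
  ((N : ℂ) ^ 3)⁻¹ * ∑ I : Fin 3 → Fin N, f I *
    Complex.exp (-(2 * Real.pi * Complex.I * (∑ m, (ξ m : ℂ) * ((I m : ℕ) : ℂ)) / N))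

/-- The entrywise discrete Fourier coefficient of a matrix field. -/
noncomputable def dftMat {N : ℕ} (F : (Fin 3 → Fin N) → Mat ℂ) (ξ : Fin 3 → ℤ) : Mat ℂ :=
  Matrix.of fun m n => dft (fun I => F I m n) ξ

/-- The reference medium: a constant stiffness tensor for which the equations of elasticity are
coercive (strong ellipticity). Every stiffness tensor that is positive definite on symmetric
matrices is of this kind, and an isotropic one with Lamé coefficients `lam`, `mu` is exactly if
`0 < mu` and `0 < lam + 2 * mu`. -/
def IsReferenceMedium (Cref : Tensor ℝ) : Prop :=
  IsStiffnessSymm Cref ∧ ∀ a ξ : Fin 3 → ℝ, a ≠ 0 → ξ ≠ 0 →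
    0 < frob (Matrix.vecMulVec a ξ) (ddot Cref (Matrix.vecMulVec a ξ))

/-- The acoustic tensor `ξ · Cref · ξ`. -/
def acoustic (Cref : Tensor ℝ) (ξ : Fin 3 → ℝ) : Mat ℝ :=
  Matrix.of fun n p => ∑ m, ∑ q, ξ m * Cref m n p q * ξ q

/-- The Fourier symbol of the Green operator `Γ⁰ = ∇ˢ G⁰` of the reference medium. Contracted with
a symmetric `F` it is the symmetrised product of `ξ` with the vector `(ξ · Cref · ξ)⁻¹ (F ξ)`. -/
noncomputable def green (Cref : Tensor ℝ) (ξ : Fin 3 → ℝ) : Tensor ℝ := fun m n p q =>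
  (ξ m * (acoustic Cref ξ)⁻¹ n p * ξ q + ξ n * (acoustic Cref ξ)⁻¹ m p * ξ q +
    ξ m * (acoustic Cref ξ)⁻¹ n q * ξ p + ξ n * (acoustic Cref ξ)⁻¹ m q * ξ p) / 4

/-- The polarisation `τ[I] = (CN[I] - Cref) : ε[I]`. -/
def polarisation {N : ℕ} (Cref : Tensor ℝ) (CN : (Fin 3 → Fin N) → Tensor ℝ)
    (ε : (Fin 3 → Fin N) → Mat ℂ) (I : Fin 3 → Fin N) : Mat ℂ :=
  ddot (Tensor.toComplex (CN I - Cref)) (ε I)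

/-- `ε` is a discrete strain field computed by the scheme, i.e. a fixed point of its iteration.
It may be complex, since for even `N` the frequency set is not symmetric about `0`. -/
structure IsMSSolution {N : ℕ} (Cref : Tensor ℝ) (CN : (Fin 3 → Fin N) → Tensor ℝ) (E : Mat ℝ)
    (ε : (Fin 3 → Fin N) → Mat ℂ) : Prop where
  symm : ∀ I, (ε I).IsSymm
  zero_freq : dftMat ε 0 = E.toComplex
  nonzero_freq : ∀ ξ ∈ freq N, ξ ≠ 0 →
    dftMat ε ξ = -ddot (green Cref fun m => (ξ m : ℝ)).toComplex
      (dftMat (polarisation Cref CN ε) ξ)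

/-- `T` is the effective tensor obtained by the scheme at resolution `N`: for every symmetric `E`,
`T : E` is the average of `CN[I] : ε[I]` over all voxels, where `ε` is computed from `E`. -/
def IsMSEffectiveTensor {N : ℕ} (Cref : Tensor ℝ) (CN : (Fin 3 → Fin N) → Tensor ℝ)
    (T : Tensor ℂ) : Prop :=
  IsMinorSymm T ∧ ∀ E : Mat ℝ, E.IsSymm → ∃ ε, IsMSSolution Cref CN E ε ∧
    ddot T E.toComplex = ((N : ℂ) ^ 3)⁻¹ • ∑ I, ddot (CN I).toComplex (ε I)

end MS

/-! The proof is a Galerkin-type argument: stability of the scheme uniformly in `N`, and consistency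
tested on truncated Fourier series of the exact solution. No regularity of that solution is needed,
and no rate results.

Stability. A fixed point of the scheme has two properties in which the reference medium no longer
occurs (`IsMSSolution.compatible_equilibrated`): at nonzero frequencies its strain is a symmetrised
product with `ξ`, and its stress is annihilated by `ξ`. By discrete Parseval, compatible fields of
mean zero are orthogonal to equilibrated symmetric fields (`compatible_orthogonal`). Together with
the coercivity of the material this gives `energy_estimate`, whose constant does not depend on `N`.
It yields uniqueness, hence existence by finite dimensionality.

Consistency. On the cell, the periodic Sobolev space is described by Fourier coefficients
(`memH1Per_iff`). Parseval then gives Korn's inequality, and Lax–Milgram solves the cell problem.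
The exact strain is compatible and the exact stress is divergence free, coefficient by coefficient.
Truncate both to a finite set `s` of frequencies and sample them on the grid. If `s` lies in the
frequency set there is no aliasing, so the samples are a compatible field `e` of mean `E` and an
equilibrated field `S` whose mean is exactly the mean stress. The energy estimate bounds the
difference between the discrete strain and `e` by the residual `CN : e - S` (`stress_error_le`).

Limit. For fixed `s`, the grid norm of the residual tends to the `L²` norm of `C : e - S` on the
cell (`tendsto_gridNsq`): the interfaces are null sets, and a voxel around any other point
eventually lies in one subdomain. That `L²` norm tends to zero as `s` grows, because the untruncated
fields satisfy the material law (`tendsto_residual`). Choosing `s` first and `N` afterwards gives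
convergence of the mean stress for each symmetric `E`, and hence of every tensor entry. -/

namespace MS

/-! ### Fourier modes and the discrete Fourier transform -/

/-- The Fourier mode `exp (2 π i ξ · x)`. -/
noncomputable def mode (ξ : Fin 3 → ℤ) (x : Space) : ℂ :=
  Complex.exp (2 * Real.pi * Complex.I * ∑ m, (ξ m : ℂ) * (x m : ℂ))

/-- The grid point `I / N`. -/
noncomputable def gridPt (N : ℕ) (I : Fin 3 → Fin N) : Space :=
  WithLp.toLp 2 fun m => ((I m : ℕ) : ℝ) / N

/-- The frequency set as a finite set. -/
noncomputable def freqFinset (N : ℕ) : Finset (Fin 3 → ℤ) :=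
  Fintype.piFinset fun _ => Finset.Ico (-((N / 2 : ℕ) : ℤ)) (-((N / 2 : ℕ) : ℤ) + N)

/-- With integer division, the interval of length `N` starting at `-(N / 2)` is the right one for
both parities of `N`. -/
lemma mem_freqFinset {N : ℕ} {ξ : Fin 3 → ℤ} : ξ ∈ freqFinset N ↔ ξ ∈ freq N := by
  simp only [freqFinset, Fintype.mem_piFinset, Finset.mem_Ico, freq, Set.mem_ofPred_eq]
  refine forall_congr' fun m => ?_
  omega

lemma mode_add (ξ η : Fin 3 → ℤ) (x : Space) : mode (ξ + η) x = mode ξ x * mode η x := by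
  simp only [mode, ← Complex.exp_add, ← mul_add, ← Finset.sum_add_distrib]
  congr 2
  refine Finset.sum_congr rfl fun m _ => ?_
  push_cast [Pi.add_apply]
  ring

@[simp]
lemma mode_zero (x : Space) : mode 0 x = 1 := by simp [mode]

lemma norm_mode (ξ : Fin 3 → ℤ) (x : Space) : ‖mode ξ x‖ = 1 := by
  have : (2 * Real.pi * Complex.I * ∑ m, (ξ m : ℂ) * (x m : ℂ)) =
      ((2 * Real.pi * ∑ m, (ξ m : ℝ) * x m : ℝ) : ℂ) * Complex.I := by
    push_cast; ring
  rw [mode, this, Complex.norm_exp_ofReal_mul_I]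

lemma star_mode (ξ : Fin 3 → ℤ) (x : Space) : star (mode ξ x) = mode (-ξ) x := by
  rw [mode, mode, Complex.star_def, ← Complex.exp_conj]
  congr 1
  simp [map_mul, map_sum, Complex.conj_ofReal, Complex.conj_ofNat]

lemma mode_eq_prod (ξ : Fin 3 → ℤ) (x : Space) :
    mode ξ x = ∏ m, Complex.exp (2 * Real.pi * Complex.I * ((ξ m : ℂ) * (x m : ℂ))) := by
  rw [mode, Finset.mul_sum, Complex.exp_sum]

lemma dft_eq {N : ℕ} (f : (Fin 3 → Fin N) → ℂ) (ξ : Fin 3 → ℤ) :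
    dft f ξ = ((N : ℂ) ^ 3)⁻¹ * ∑ I, f I * mode (-ξ) (gridPt N I) := by
  rw [dft]
  congr 1
  refine Finset.sum_congr rfl fun I _ => ?_
  congr 1
  rw [mode]
  congr 1
  simp only [gridPt, Pi.neg_apply, Int.cast_neg, Complex.ofReal_div, Complex.ofReal_natCast,
    neg_mul, Finset.sum_neg_distrib, mul_neg, mul_div_assoc, Finset.sum_div]

/-- Geometric sums over a full period of a root of unity. -/
lemma sum_zpow_period {N : ℕ} {z : ℂ} (hz : z ^ N = 1) (hz1 : z ≠ 1) (a : ℤ) :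
    ∑ k ∈ Finset.Ico a (a + N), z ^ k = 0 := by
  rcases Nat.eq_zero_or_pos N with rfl | hN
  · simp
  have hz0 : z ≠ 0 := by
    rintro rfl
    simp [hN.ne'] at hz
  have : Finset.Ico a (a + N) = (Finset.range N).image fun n : ℕ => a + n := by
    ext k
    simp only [Finset.mem_Ico, Finset.mem_image, Finset.mem_range]
    constructor
    · intro h
      exact ⟨(k - a).toNat, by omega, by omega⟩
    · rintro ⟨n, hn, rfl⟩
      omega
  rw [this, Finset.sum_image fun x _ y _ h => by simpa using h]
  simp only [zpow_add₀ hz0, zpow_natCast, ← Finset.mul_sum]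
  rw [geom_sum_eq hz1, hz]
  simp

lemma exp_eq_one_iff_dvd {N : ℕ} (hN : 1 ≤ N) (k : ℤ) :
    Complex.exp (2 * Real.pi * Complex.I * ((k : ℂ) / N)) = 1 ↔ (N : ℤ) ∣ k := by
  have hN' : (N : ℂ) ≠ 0 := by exact_mod_cast (by omega : N ≠ 0)
  rw [Complex.exp_eq_one_iff]
  have h2 : (2 * Real.pi * Complex.I : ℂ) ≠ 0 := Complex.two_pi_I_ne_zero
  constructor
  · rintro ⟨n, hn⟩
    refine ⟨n, ?_⟩
    rw [mul_comm (n : ℂ)] at hn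
    have := mul_left_cancel₀ h2 hn
    rw [div_eq_iff hN'] at this
    have h3 : k = n * N := by exact_mod_cast this
    rw [h3, mul_comm]
  · rintro ⟨n, rfl⟩
    refine ⟨n, ?_⟩
    push_cast
    field_simp

lemma exp_pow_period {N : ℕ} (hN : 1 ≤ N) (k : ℤ) :
    Complex.exp (2 * Real.pi * Complex.I * ((k : ℂ) / N)) ^ N = 1 := by
  have hN' : (N : ℂ) ≠ 0 := by exact_mod_cast (by omega : N ≠ 0)
  rw [← Complex.exp_nat_mul, Complex.exp_eq_one_iff]
  exact ⟨k, by field_simp⟩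

/-- Orthogonality of the modes on the frequency set. -/
lemma sum_freq_mode {N : ℕ} (hN : 1 ≤ N) (I J : Fin 3 → Fin N) :
    ∑ ξ ∈ freqFinset N, mode ξ (gridPt N I) * mode (-ξ) (gridPt N J) =
      if I = J then (N : ℂ) ^ 3 else 0 := by
  have h1 : ∀ ξ : Fin 3 → ℤ, mode ξ (gridPt N I) * mode (-ξ) (gridPt N J) =
      ∏ m, Complex.exp (2 * Real.pi * Complex.I *
        ((((I m : ℕ) : ℤ) - ((J m : ℕ) : ℤ) : ℤ) / N)) ^ (ξ m) := by
    intro ξ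
    rw [mode_eq_prod, mode_eq_prod, ← Finset.prod_mul_distrib]
    refine Finset.prod_congr rfl fun m _ => ?_
    rw [← Complex.exp_add, ← Complex.exp_int_mul]
    congr 1
    simp only [gridPt, Pi.neg_apply]
    push_cast
    ring
  simp only [h1]
  -- The frequency set is a cube, so the sum factors into three geometric sums over a full period. A
  -- factor with `I m ≠ J m` vanishes.
  rw [freqFinset, ← Finset.prod_univ_sum]
  split_ifs with h
  · subst h
    simp
  · obtain ⟨m, hm⟩ := Function.ne_iff.mp h
    refine Finset.prod_eq_zero (Finset.mem_univ m) ?_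
    refine sum_zpow_period (exp_pow_period hN _) ?_ _
    rw [Ne, exp_eq_one_iff_dvd hN]
    intro hd
    apply hm
    have hI := (I m).isLt
    have hJ := (J m).isLt
    have := Int.eq_zero_of_abs_lt_dvd hd (by rw [abs_lt]; constructor <;> omega)
    apply Fin.ext
    omega

/-- Orthogonality of the modes on the grid. -/
lemma sum_grid_mode {N : ℕ} (hN : 1 ≤ N) {ξ η : Fin 3 → ℤ} (hξ : ξ ∈ freq N) (hη : η ∈ freq N) :
    ∑ I : Fin 3 → Fin N, mode ξ (gridPt N I) * mode (-η) (gridPt N I) =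
      if ξ = η then (N : ℂ) ^ 3 else 0 := by
  have h1 : ∀ I : Fin 3 → Fin N, mode ξ (gridPt N I) * mode (-η) (gridPt N I) =
      ∏ m, Complex.exp (2 * Real.pi * Complex.I * ((ξ m - η m : ℤ) / N)) ^ (I m : ℕ) := by
    intro I
    rw [mode_eq_prod, mode_eq_prod, ← Finset.prod_mul_distrib]
    refine Finset.prod_congr rfl fun m _ => ?_
    rw [← Complex.exp_add, ← Complex.exp_nat_mul]
    congr 1
    simp only [gridPt, Pi.neg_apply]
    push_cast
    ring
  simp only [h1]
  have h2 := Finset.prod_univ_sum (fun _ : Fin 3 => (Finset.univ : Finset (Fin N)))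
    (fun m k => Complex.exp (2 * Real.pi * Complex.I * ((ξ m - η m : ℤ) / N)) ^ (k : ℕ))
  rw [Fintype.piFinset_univ] at h2
  rw [← h2]
  split_ifs with h
  · subst h
    simp
  · obtain ⟨m, hm⟩ := Function.ne_iff.mp h
    refine Finset.prod_eq_zero (Finset.mem_univ m) ?_
    rw [Fin.sum_univ_eq_sum_range (fun k =>
      Complex.exp (2 * Real.pi * Complex.I * ((ξ m - η m : ℤ) / N)) ^ k), geom_sum_eq,
      exp_pow_period hN]
    · simp
    · rw [Ne, exp_eq_one_iff_dvd hN]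
      intro hd
      apply hm
      -- Each frequency component ranges over a half-open interval of length `N`, so two of them
      -- differ by less than `N`. Including both ends `±N/2` would break this.
      have h1 := hξ m
      have h2 := hη m
      have := Int.eq_zero_of_abs_lt_dvd hd (by rw [abs_lt]; constructor <;> omega)
      omega

/-- The inversion formula for the discrete Fourier transform. -/
lemma dft_inversion {N : ℕ} (hN : 1 ≤ N) (f : (Fin 3 → Fin N) → ℂ) (I : Fin 3 → Fin N) :
    f I = ∑ ξ ∈ freqFinset N, dft f ξ * mode ξ (gridPt N I) := by
  have hN' : (N : ℂ) ≠ 0 := by exact_mod_cast (by omega : N ≠ 0)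
  simp only [dft_eq, Finset.mul_sum, Finset.sum_mul]
  rw [Finset.sum_comm]
  have : ∀ J, ∑ ξ ∈ freqFinset N,
      ((N : ℂ) ^ 3)⁻¹ * (f J * mode (-ξ) (gridPt N J)) * mode ξ (gridPt N I) =
      ((N : ℂ) ^ 3)⁻¹ * f J * if I = J then (N : ℂ) ^ 3 else 0 := by
    intro J
    rw [← sum_freq_mode hN, Finset.mul_sum]
    exact Finset.sum_congr rfl fun ξ _ => by ring
  simp only [this]
  simp only [mul_ite, mul_zero, Finset.sum_ite_eq, Finset.mem_univ, if_true]
  field_simp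

/-- Parseval's identity for the discrete Fourier transform. -/
lemma dft_parseval {N : ℕ} (hN : 1 ≤ N) (f g : (Fin 3 → Fin N) → ℂ) :
    ((N : ℂ) ^ 3)⁻¹ * ∑ I, star (f I) * g I =
      ∑ ξ ∈ freqFinset N, star (dft f ξ) * dft g ξ := by
  have h1 : ∀ ξ, star (dft f ξ) = ((N : ℂ) ^ 3)⁻¹ * ∑ I, star (f I) * mode ξ (gridPt N I) := by
    intro ξ
    simp [dft_eq, ← star_mode]
  calc ((N : ℂ) ^ 3)⁻¹ * ∑ I, star (f I) * g I
      = ((N : ℂ) ^ 3)⁻¹ * ∑ I, ∑ ξ ∈ freqFinset N,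
          star (f I) * mode ξ (gridPt N I) * dft g ξ := by
        congr 1
        refine Finset.sum_congr rfl fun I _ => ?_
        conv_lhs => rw [dft_inversion hN g I]
        rw [Finset.mul_sum]
        exact Finset.sum_congr rfl fun ξ _ => by ring
    _ = _ := by
        rw [Finset.sum_comm, Finset.mul_sum]
        refine Finset.sum_congr rfl fun ξ _ => ?_
        rw [h1, ← Finset.sum_mul, mul_assoc]

/-- The trigonometric polynomial with coefficients `c`. -/
noncomputable def trig (s : Finset (Fin 3 → ℤ)) (c : (Fin 3 → ℤ) → ℂ) (x : Space) : ℂ :=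
  ∑ ξ ∈ s, c ξ * mode ξ x

/-- The discrete Fourier coefficients of a sampled trigonometric polynomial. -/
lemma dft_trig {N : ℕ} (hN : 1 ≤ N) (s : Finset (Fin 3 → ℤ)) (hs : ∀ ξ ∈ s, ξ ∈ freq N)
    (c : (Fin 3 → ℤ) → ℂ) {η : Fin 3 → ℤ} (hη : η ∈ freq N) :
    dft (fun I => trig s c (gridPt N I)) η = if η ∈ s then c η else 0 := by
  have hN' : (N : ℂ) ≠ 0 := by exact_mod_cast (by omega : N ≠ 0)
  simp only [dft_eq, trig, Finset.sum_mul]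
  rw [Finset.sum_comm]
  have : ∀ ξ ∈ s, ∑ I : Fin 3 → Fin N, c ξ * mode ξ (gridPt N I) * mode (-η) (gridPt N I) =
      if ξ = η then c ξ * (N : ℂ) ^ 3 else 0 := by
    intro ξ hξ
    simp only [mul_assoc]
    rw [← Finset.mul_sum, sum_grid_mode hN (hs ξ hξ) hη]
    split_ifs <;> simp
  rw [Finset.sum_congr rfl this, Finset.sum_ite_eq']
  split_ifs
  · field_simp
  · simp

lemma dft_add {N : ℕ} (f g : (Fin 3 → Fin N) → ℂ) (ξ : Fin 3 → ℤ) :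
    dft (fun I => f I + g I) ξ = dft f ξ + dft g ξ := by
  simp only [dft_eq, add_mul, Finset.sum_add_distrib, mul_add]

lemma dft_sub {N : ℕ} (f g : (Fin 3 → Fin N) → ℂ) (ξ : Fin 3 → ℤ) :
    dft (fun I => f I - g I) ξ = dft f ξ - dft g ξ := by
  simp only [dft_eq, sub_mul, Finset.sum_sub_distrib, mul_sub]

lemma dft_const_mul {N : ℕ} (c : ℂ) (f : (Fin 3 → Fin N) → ℂ) (ξ : Fin 3 → ℤ) :
    dft (fun I => c * f I) ξ = c * dft f ξ := by
  simp only [dft_eq, Finset.mul_sum]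
  exact Finset.sum_congr rfl fun I _ => by ring

lemma dft_sum {N : ℕ} {ι : Type*} (s : Finset ι) (f : ι → (Fin 3 → Fin N) → ℂ)
    (ξ : Fin 3 → ℤ) :
    dft (fun I => ∑ i ∈ s, f i I) ξ = ∑ i ∈ s, dft (f i) ξ := by
  classical
  induction s using Finset.induction_on with
  | empty => simp [dft]
  | insert a s ha ih => simp only [Finset.sum_insert ha, dft_add, ih]

lemma dft_zero_freq {N : ℕ} (f : (Fin 3 → Fin N) → ℂ) :
    dft f 0 = ((N : ℂ) ^ 3)⁻¹ * ∑ I, f I := by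
  simp [dft_eq]

lemma zero_mem_freq {N : ℕ} (hN : 1 ≤ N) : (0 : Fin 3 → ℤ) ∈ freq N := by
  intro m
  simp
  omega

/-- A fixed trigonometric polynomial is resolved without aliasing on all sufficiently fine grids. -/
lemma eventually_subset_freq (s : Finset (Fin 3 → ℤ)) :
    ∀ᶠ N : ℕ in atTop, ∀ ξ ∈ s, ξ ∈ freq N := by
  rw [Filter.eventually_all_finset]
  intro ξ _
  have : ∀ m, ∀ᶠ N : ℕ in atTop, -(N : ℤ) ≤ 2 * ξ m ∧ 2 * ξ m < (N : ℤ) := by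
    intro m
    filter_upwards [eventually_gt_atTop (2 * (ξ m).natAbs)] with N hN
    omega
  exact (Filter.eventually_all.mpr this)

/-! ### Tensor algebra -/

section Algebra

variable {𝕜 : Type} [CommRing 𝕜]

lemma ddot_apply (T : Tensor 𝕜) (F : Mat 𝕜) (m n : Fin 3) :
    ddot T F m n = ∑ p, ∑ q, T m n p q * F p q := rfl

lemma ddot_add (T : Tensor 𝕜) (F H : Mat 𝕜) : ddot T (F + H) = ddot T F + ddot T H := by
  ext m n
  simp only [ddot_apply, Matrix.add_apply, mul_add, Finset.sum_add_distrib]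

lemma ddot_sub (T : Tensor 𝕜) (F H : Mat 𝕜) : ddot T (F - H) = ddot T F - ddot T H := by
  ext m n
  simp only [ddot_apply, Matrix.sub_apply, mul_sub, Finset.sum_sub_distrib]

lemma ddot_smul (T : Tensor 𝕜) (c : 𝕜) (F : Mat 𝕜) : ddot T (c • F) = c • ddot T F := by
  ext m n
  simp only [ddot_apply, Matrix.smul_apply, smul_eq_mul, Finset.mul_sum]
  exact Finset.sum_congr rfl fun p _ => Finset.sum_congr rfl fun q _ => by ring

lemma ddot_isSymm {T : Tensor 𝕜} (hT : ∀ m n p q, T m n p q = T n m p q) (F : Mat 𝕜) :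
    (ddot T F).IsSymm := by
  ext m n
  simp only [Matrix.transpose_apply, ddot_apply]
  exact Finset.sum_congr rfl fun p _ => Finset.sum_congr rfl fun q _ => by rw [hT]

end Algebra

lemma Tensor.toComplex_apply (T : Tensor ℝ) (m n p q : Fin 3) :
    T.toComplex m n p q = (T m n p q : ℂ) := rfl

lemma Mat.toComplex_apply (F : Mat ℝ) (m n : Fin 3) : F.toComplex m n = (F m n : ℂ) := rfl

lemma ddot_toComplex_re (T : Tensor ℝ) (F : Mat ℂ) (m n : Fin 3) :
    (ddot T.toComplex F m n).re = ddot T (F.map Complex.re) m n := by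
  simp [ddot_apply, Tensor.toComplex_apply, Complex.mul_re]

lemma ddot_toComplex_im (T : Tensor ℝ) (F : Mat ℂ) (m n : Fin 3) :
    (ddot T.toComplex F m n).im = ddot T (F.map Complex.im) m n := by
  simp [ddot_apply, Tensor.toComplex_apply, Complex.mul_im]

lemma ddot_toComplex (T : Tensor ℝ) (F : Mat ℝ) :
    ddot T.toComplex F.toComplex = (ddot T F).toComplex := by
  ext m n
  simp [ddot_apply, Tensor.toComplex_apply, Mat.toComplex_apply]

/-- The squared Frobenius norm. -/
noncomputable def nsq (F : Mat ℂ) : ℝ := ∑ m, ∑ n, ‖F m n‖ ^ 2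

lemma nsq_nonneg (F : Mat ℂ) : 0 ≤ nsq F :=
  Finset.sum_nonneg fun _ _ => Finset.sum_nonneg fun _ _ => by positivity

lemma nsq_add_le (F H : Mat ℂ) : nsq (F + H) ≤ 2 * nsq F + 2 * nsq H := by
  simp only [nsq, Finset.mul_sum, ← Finset.sum_add_distrib]
  refine Finset.sum_le_sum fun m _ => Finset.sum_le_sum fun n _ => ?_
  have := norm_add_le (F m n) (H m n)
  have h0 := norm_nonneg (F m n + H m n)
  simp only [Matrix.add_apply]
  nlinarith [sq_nonneg (‖F m n‖ - ‖H m n‖)]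

lemma norm_sq_le_nsq (F : Mat ℂ) (m n : Fin 3) : ‖F m n‖ ^ 2 ≤ nsq F := by
  refine le_trans ?_ (Finset.single_le_sum (f := fun m => ∑ n, ‖F m n‖ ^ 2)
    (fun _ _ => Finset.sum_nonneg fun _ _ => by positivity) (Finset.mem_univ m))
  exact Finset.single_le_sum (f := fun n => ‖F m n‖ ^ 2) (fun _ _ => by positivity)
    (Finset.mem_univ n)

lemma nsq_eq_zero {F : Mat ℂ} (h : nsq F ≤ 0) : F = 0 := by
  ext m n
  have := norm_sq_le_nsq F m n
  have h2 : ‖F m n‖ ^ 2 = 0 := le_antisymm (this.trans h) (by positivity)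
  simpa using h2

/-- The squared Frobenius norm of a fourth-order tensor. -/
noncomputable def Tensor.nsq (T : Tensor ℝ) : ℝ := ∑ m, ∑ n, ∑ p, ∑ q, T m n p q ^ 2

lemma Tensor.nsq_nonneg (T : Tensor ℝ) : 0 ≤ T.nsq :=
  Finset.sum_nonneg fun _ _ => Finset.sum_nonneg fun _ _ => Finset.sum_nonneg fun _ _ =>
    Finset.sum_nonneg fun _ _ => by positivity

/-- Cauchy–Schwarz over the index pair `(p, q)`, separately for each output entry. -/
lemma nsq_ddot_le (T : Tensor ℝ) (F : Mat ℂ) :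
    MS.nsq (ddot T.toComplex F) ≤ T.nsq * MS.nsq F := by
  rw [MS.nsq, Tensor.nsq, Finset.sum_mul]
  refine Finset.sum_le_sum fun m _ => ?_
  rw [Finset.sum_mul]
  refine Finset.sum_le_sum fun n _ => ?_
  rw [ddot_apply, MS.nsq]
  simp only [← Fintype.sum_prod_type']
  calc ‖∑ x : Fin 3 × Fin 3, T.toComplex m n x.1 x.2 * F x.1 x.2‖ ^ 2
      ≤ (∑ x : Fin 3 × Fin 3, |T m n x.1 x.2| * ‖F x.1 x.2‖) ^ 2 := by
        gcongr
        refine (norm_sum_le _ _).trans (le_of_eq ?_)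
        simp [Tensor.toComplex_apply]
    _ ≤ _ := by
        refine (Finset.sum_mul_sq_le_sq_mul_sq _ _ _).trans (le_of_eq ?_)
        simp

/-- Coercivity on real symmetric matrices extends to complex symmetric matrices. -/
lemma coercive_complex {T : Tensor ℝ} {a : ℝ}
    (hT : ∀ F : Mat ℝ, F.IsSymm → a * frob F F ≤ frob F (ddot T F)) {F : Mat ℂ} (hF : F.IsSymm) :
    a * nsq F ≤ (∑ m, ∑ n, star (F m n) * ddot T.toComplex F m n).re := by
  have h1 := hT (F.map Complex.re) (hF.map _)
  have h2 := hT (F.map Complex.im) (hF.map _)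
  have h3 : nsq F = frob (F.map Complex.re) (F.map Complex.re) +
      frob (F.map Complex.im) (F.map Complex.im) := by
    simp only [nsq, frob, Matrix.map_apply, ← Finset.sum_add_distrib, Complex.sq_norm,
      Complex.normSq_apply]
  -- Since `T` is real, the mixed products of real and imaginary parts are purely imaginary and drop
  -- out.
  have h4 : (∑ m, ∑ n, star (F m n) * ddot T.toComplex F m n).re =
      frob (F.map Complex.re) (ddot T (F.map Complex.re)) +
      frob (F.map Complex.im) (ddot T (F.map Complex.im)) := by
    simp only [frob, Complex.re_sum, Complex.mul_re, ddot_toComplex_re, ddot_toComplex_im,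
      Complex.star_def, Complex.conj_re, Complex.conj_im, ← Finset.sum_add_distrib,
      Matrix.map_apply]
    refine Finset.sum_congr rfl fun m _ => Finset.sum_congr rfl fun n _ => by ring
  rw [h3, h4]
  linarith

/-- The symmetrised tensor product `(ξ ⊗ a + a ⊗ ξ) / 2`. -/
noncomputable def symTens (ξ a : Fin 3 → ℂ) : Mat ℂ :=
  Matrix.of fun m n => (ξ m * a n + ξ n * a m) / 2

/-! ### Tensors determined by their action on symmetric matrices -/

/-- The symmetric matrix `(e p ⊗ e q + e q ⊗ e p) / 2`. -/
noncomputable def symBasis (p q : Fin 3) : Mat ℝ := symPart (Matrix.single p q 1)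

lemma symPart_isSymm (F : Mat ℝ) : (symPart F).IsSymm := by
  ext m n
  simp [symPart, add_comm]

lemma symPart_of_isSymm {F : Mat ℝ} (hF : F.IsSymm) : symPart F = F := by
  ext m n
  simp [symPart, hF.apply m n]

lemma symBasis_isSymm (p q : Fin 3) : (symBasis p q).IsSymm := symPart_isSymm _

section TensorExt

variable {𝕜 : Type} [RCLike 𝕜]

/-- Contraction with `symBasis p q` averages the entries at `(p, q)` and `(q, p)`, which agree by
minor symmetry. -/
lemma entry_eq_ddot {T : Tensor 𝕜} (hT : IsMinorSymm T) (m n p q : Fin 3) :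
    T m n p q = ddot T ((symBasis p q).map (algebraMap ℝ 𝕜)) m n := by
  have h : ∀ p' q', ((symBasis p q).map (algebraMap ℝ 𝕜)) p' q' =
      ((if p = p' ∧ q = q' then 1 else 0) + (if p = q' ∧ q = p' then 1 else 0)) / 2 := by
    intro p' q'
    simp only [symBasis, symPart, Matrix.map_apply, Matrix.of_apply, Matrix.single_apply]
    split_ifs <;> simp <;> exact map_ofNat (algebraMap ℝ 𝕜) 2
  simp only [ddot_apply, h, mul_div_assoc', mul_add, mul_ite, mul_one, mul_zero, ite_and,
    ← Finset.sum_div, Finset.sum_add_distrib]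
  simp only [Finset.sum_ite_irrel, Finset.sum_const_zero, Finset.sum_ite_eq, Finset.mem_univ,
    if_true]
  rw [← (hT m n p q).2]
  ring

lemma tensor_ext {T T' : Tensor 𝕜} (hT : IsMinorSymm T) (hT' : IsMinorSymm T')
    (h : ∀ E : Mat ℝ, E.IsSymm → ddot T (E.map (algebraMap ℝ 𝕜)) =
      ddot T' (E.map (algebraMap ℝ 𝕜))) : T = T' := by
  funext m n p q
  rw [entry_eq_ddot hT, entry_eq_ddot hT', h _ (symBasis_isSymm p q)]

/-- A linear map with values in the symmetric matrices is represented, on symmetric matrices, by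
a tensor with the minor symmetries. -/
lemma exists_tensor (R : Mat ℝ →ₗ[ℝ] Mat 𝕜) (hR : ∀ E, (R E).IsSymm) :
    ∃ T : Tensor 𝕜, IsMinorSymm T ∧
      ∀ E : Mat ℝ, E.IsSymm → ddot T (E.map (algebraMap ℝ 𝕜)) = R E := by
  refine ⟨fun m n p q => R (symBasis p q) m n, fun m n p q => ⟨?_, ?_⟩, fun E hE => ?_⟩
  · exact (hR _).apply _ _
  · have : symBasis p q = symBasis q p := by
      ext i j
      simp only [symBasis, symPart, Matrix.of_apply, Matrix.single_apply]
      rw [add_comm]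
      simp only [and_comm]
    simp only [this]
  · have h : E = ∑ p, ∑ q, E p q • symBasis p q := by
      ext i j
      simp only [Matrix.sum_apply, Matrix.smul_apply, symBasis, symPart, Matrix.of_apply,
        Matrix.single_apply, smul_eq_mul]
      have := hE.apply i j
      fin_cases i <;> fin_cases j <;> simp [Fin.sum_univ_three] at this ⊢ <;> linarith
    conv_rhs => rw [h]
    ext m n
    simp only [map_sum, map_smul, Matrix.sum_apply, Matrix.smul_apply, ddot_apply,
      Matrix.map_apply]
    refine Finset.sum_congr rfl fun p _ => Finset.sum_congr rfl fun q _ => ?_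
    rw [Algebra.smul_def, mul_comm]

end TensorExt

/-! ### The Green operator of the reference medium -/

/-- A nonzero kernel vector `v` of the acoustic tensor would make the energy of `v ⊗ ξ` vanish,
against strong ellipticity. -/
lemma acoustic_det_ne_zero {Cref : Tensor ℝ} (href : IsReferenceMedium Cref) {ξ : Fin 3 → ℝ}
    (hξ : ξ ≠ 0) : (acoustic Cref ξ).det ≠ 0 := by
  intro h
  obtain ⟨v, hv, hv0⟩ := Matrix.exists_mulVec_eq_zero_iff.mpr h
  have hpos := href.2 v ξ hv hξ
  have hz : frob (Matrix.vecMulVec v ξ) (ddot Cref (Matrix.vecMulVec v ξ)) =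
      ∑ n, v n * (acoustic Cref ξ *ᵥ v) n := by
    have hs : ∀ m n p q, Cref m n p q = Cref n m p q := fun m n p q => (href.1 m n p q).1
    simp only [frob, ddot_apply, Matrix.vecMulVec_apply, Matrix.mulVec, dotProduct, acoustic,
      Matrix.of_apply, Finset.mul_sum, Finset.sum_mul]
    refine Finset.sum_congr rfl fun m _ => ?_
    rw [Finset.sum_comm]
    refine Finset.sum_congr rfl fun p _ => Finset.sum_congr rfl fun n _ =>
      Finset.sum_congr rfl fun q _ => ?_
    rw [hs]
    ring
  rw [hz, hv0] at hpos
  simp at hpos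

/-- The Green operator maps a symmetric matrix to a symmetrised product with `ξ`. -/
lemma ddot_green (Cref : Tensor ℝ) (ξ : Fin 3 → ℝ) {F : Mat ℂ} (hF : F.IsSymm) :
    ddot (green Cref ξ).toComplex F = symTens (fun m => (ξ m : ℂ))
      (((acoustic Cref ξ)⁻¹.map Complex.ofReal) *ᵥ (F *ᵥ fun m => (ξ m : ℂ))) := by
  have h10 := hF.apply 1 0
  have h20 := hF.apply 2 0
  have h21 := hF.apply 2 1
  ext m n
  simp only [ddot_apply, green, Tensor.toComplex_apply, symTens, Matrix.of_apply, Matrix.mulVec,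
    dotProduct, Matrix.map_apply]
  generalize (acoustic Cref ξ)⁻¹ = B
  push_cast
  simp only [Fin.sum_univ_three]
  rw [h10, h20, h21]
  ring

/-- By minor symmetry of `Cref`, both halves of the symmetrised product contribute the same amount,
and the divergence is the acoustic tensor applied to `a`. -/
lemma ddot_symTens_mul {Cref : Tensor ℝ} (hC : IsStiffnessSymm Cref) (ξ : Fin 3 → ℝ)
    (a : Fin 3 → ℂ) (n : Fin 3) :
    ∑ m, (ξ m : ℂ) * ddot Cref.toComplex (symTens (fun m => (ξ m : ℂ)) a) m n =
      (((acoustic Cref ξ).map Complex.ofReal) *ᵥ a) n := by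
  have hs : ∀ m n p q, Cref m n p q = Cref m n q p := fun m n p q => (hC m n p q).2.1
  simp only [ddot_apply, Tensor.toComplex_apply, symTens, Matrix.of_apply, Matrix.mulVec,
    dotProduct, acoustic, Matrix.map_apply]
  push_cast
  simp only [Finset.sum_mul, Finset.mul_sum]
  have key : ∀ m, ∑ p, ∑ q, (ξ m : ℂ) * ((Cref m n p q : ℂ) * ((ξ p * a q + ξ q * a p) / 2)) =
      ∑ p, ∑ q, (ξ m : ℂ) * (Cref m n p q : ℂ) * ξ q * a p := by
    intro m
    have e1 : ∑ p, ∑ q, (ξ m : ℂ) * (Cref m n p q : ℂ) * ξ p * a q =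
        ∑ p, ∑ q, (ξ m : ℂ) * (Cref m n p q : ℂ) * ξ q * a p := by
      rw [Finset.sum_comm]
      exact Finset.sum_congr rfl fun p _ => Finset.sum_congr rfl fun q _ => by rw [hs]
    have e2 : ∑ p, ∑ q, (ξ m : ℂ) * ((Cref m n p q : ℂ) * ((ξ p * a q + ξ q * a p) / 2)) =
        (∑ p, ∑ q, (ξ m : ℂ) * (Cref m n p q : ℂ) * ξ p * a q +
          ∑ p, ∑ q, (ξ m : ℂ) * (Cref m n p q : ℂ) * ξ q * a p) / 2 := by
      simp only [← Finset.sum_add_distrib, Finset.sum_div]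
      exact Finset.sum_congr rfl fun p _ => Finset.sum_congr rfl fun q _ => by ring
    rw [e2, e1]
    ring
  simp only [key]
  rw [Finset.sum_comm]

/-- A strain computed from the polarisation `S - Cref : F` by the Green operator is compatible, and
the stress `S` is in equilibrium. -/
lemma green_equilibrium {Cref : Tensor ℝ} (href : IsReferenceMedium Cref) {ξ : Fin 3 → ℝ}
    (hξ : ξ ≠ 0) {F S : Mat ℂ} (hS : S.IsSymm)
    (h : F = -ddot (green Cref ξ).toComplex (S - ddot Cref.toComplex F)) :
    (∃ a, F = symTens (fun m => (ξ m : ℂ)) a) ∧ ∀ n, ∑ m, (ξ m : ℂ) * S m n = 0 := by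
  set P : Mat ℂ := S - ddot Cref.toComplex F with hP
  have hPs : P.IsSymm := hS.sub (ddot_isSymm (fun m n p q => by
    simp only [Tensor.toComplex_apply]; rw [(href.1 m n p q).1]) F)
  rw [ddot_green Cref ξ hPs] at h
  set b := ((acoustic Cref ξ)⁻¹.map Complex.ofReal) *ᵥ (P *ᵥ fun m => (ξ m : ℂ)) with hb
  have hF : F = symTens (fun m => (ξ m : ℂ)) (-b) := by
    rw [h]
    ext m n
    simp only [symTens, Matrix.neg_apply, Matrix.of_apply, Pi.neg_apply]
    ring
  refine ⟨⟨-b, hF⟩, fun n => ?_⟩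
  have h1 : S = P + ddot Cref.toComplex F := by rw [hP]; abel
  have h2 : ∑ m, (ξ m : ℂ) * P m n = (P *ᵥ fun m => (ξ m : ℂ)) n := by
    simp only [Matrix.mulVec, dotProduct]
    exact Finset.sum_congr rfl fun m _ => by rw [hPs.apply, mul_comm]
  have h3 : ((acoustic Cref ξ).map Complex.ofReal) *ᵥ b = P *ᵥ fun m => (ξ m : ℂ) := by
    rw [hb, Matrix.mulVec_mulVec]
    have : ((acoustic Cref ξ).map Complex.ofReal) * ((acoustic Cref ξ)⁻¹.map Complex.ofReal) =
        (1 : Mat ℂ) := by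
      have e := Matrix.map_mul (L := acoustic Cref ξ) (M := (acoustic Cref ξ)⁻¹)
        (f := Complex.ofRealHom)
      rw [Matrix.mul_nonsing_inv _ (isUnit_iff_ne_zero.mpr (acoustic_det_ne_zero href hξ))] at e
      rw [Matrix.map_one _ (map_zero _) (map_one _)] at e
      exact e.symm
    rw [this, Matrix.one_mulVec]
  -- The divergence of `S` is that of `P` plus that of `Cref : F`. The former is `P ξ`; the latter
  -- is minus the acoustic tensor applied to `b`, which by `h3` is `-P ξ`.
  rw [h1]
  simp only [Matrix.add_apply, mul_add, Finset.sum_add_distrib]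
  rw [h2]
  conv_lhs => rw [hF]
  rw [ddot_symTens_mul href.1, Matrix.mulVec_neg, h3]
  simp

/-! ### Solvability of the discrete scheme -/

section Scheme

variable {N : ℕ}

/-- The squared norm of a matrix field on the grid, normalised by the number of voxels. -/
noncomputable def gridNsq (F : (Fin 3 → Fin N) → Mat ℂ) : ℝ := ((N : ℝ) ^ 3)⁻¹ * ∑ I, nsq (F I)

lemma dftMat_apply (F : (Fin 3 → Fin N) → Mat ℂ) (ξ : Fin 3 → ℤ) (m n : Fin 3) :
    dftMat F ξ m n = dft (fun I => F I m n) ξ := rfl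

lemma dftMat_add (F H : (Fin 3 → Fin N) → Mat ℂ) (ξ : Fin 3 → ℤ) :
    dftMat (F + H) ξ = dftMat F ξ + dftMat H ξ := by
  ext m n
  exact dft_add _ _ ξ

lemma dftMat_sub (F H : (Fin 3 → Fin N) → Mat ℂ) (ξ : Fin 3 → ℤ) :
    dftMat (F - H) ξ = dftMat F ξ - dftMat H ξ := by
  ext m n
  exact dft_sub _ _ ξ

lemma dftMat_smul (c : ℂ) (F : (Fin 3 → Fin N) → Mat ℂ) (ξ : Fin 3 → ℤ) :
    dftMat (c • F) ξ = c • dftMat F ξ := by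
  ext m n
  exact dft_const_mul c _ ξ

lemma dftMat_isSymm {F : (Fin 3 → Fin N) → Mat ℂ} (hF : ∀ I, (F I).IsSymm) (ξ : Fin 3 → ℤ) :
    (dftMat F ξ).IsSymm := by
  ext m n
  simp only [Matrix.transpose_apply, dftMat_apply]
  congr 1
  funext I
  exact (hF I).apply m n

lemma dftMat_ddot (T : Tensor ℂ) (F : (Fin 3 → Fin N) → Mat ℂ) (ξ : Fin 3 → ℤ) :
    dftMat (fun I => ddot T (F I)) ξ = ddot T (dftMat F ξ) := by
  ext m n
  simp only [dftMat_apply, ddot_apply, dft_sum, dft_const_mul]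

lemma polarisation_eq (Cref : Tensor ℝ) (CN : (Fin 3 → Fin N) → Tensor ℝ)
    (ε : (Fin 3 → Fin N) → Mat ℂ) :
    polarisation Cref CN ε =
      (fun I => ddot (CN I).toComplex (ε I)) - fun I => ddot Cref.toComplex (ε I) := by
  funext I
  ext m n
  simp [polarisation, ddot_apply, Tensor.toComplex_apply, sub_mul]

lemma polarisation_add (Cref : Tensor ℝ) (CN : (Fin 3 → Fin N) → Tensor ℝ)
    (ε ε' : (Fin 3 → Fin N) → Mat ℂ) :
    polarisation Cref CN (ε + ε') = polarisation Cref CN ε + polarisation Cref CN ε' :=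
  funext fun I => ddot_add _ (ε I) (ε' I)

lemma polarisation_sub (Cref : Tensor ℝ) (CN : (Fin 3 → Fin N) → Tensor ℝ)
    (ε ε' : (Fin 3 → Fin N) → Mat ℂ) :
    polarisation Cref CN (ε - ε') = polarisation Cref CN ε - polarisation Cref CN ε' :=
  funext fun I => ddot_sub _ (ε I) (ε' I)

lemma polarisation_smul (Cref : Tensor ℝ) (CN : (Fin 3 → Fin N) → Tensor ℝ) (c : ℂ)
    (ε : (Fin 3 → Fin N) → Mat ℂ) :
    polarisation Cref CN (c • ε) = c • polarisation Cref CN ε :=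
  funext fun I => ddot_smul _ c (ε I)

/-- A field whose nonzero frequencies are symmetrised gradients. -/
def IsCompatible (ε : (Fin 3 → Fin N) → Mat ℂ) : Prop :=
  ∀ ξ ∈ freq N, ξ ≠ 0 → ∃ a, dftMat ε ξ = symTens (fun m => (ξ m : ℂ)) a

/-- A field whose nonzero frequencies are divergence free. -/
def IsEquilibrated (S : (Fin 3 → Fin N) → Mat ℂ) : Prop :=
  ∀ ξ ∈ freq N, ξ ≠ 0 → ∀ n, ∑ m, (ξ m : ℂ) * dftMat S ξ m n = 0

lemma symTens_sub (ξ a b : Fin 3 → ℂ) : symTens ξ a - symTens ξ b = symTens ξ (a - b) := by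
  ext m n
  simp only [symTens, Matrix.sub_apply, Matrix.of_apply, Pi.sub_apply]
  ring

lemma IsCompatible.sub {ε ε' : (Fin 3 → Fin N) → Mat ℂ} (h : IsCompatible ε)
    (h' : IsCompatible ε') : IsCompatible (ε - ε') := by
  intro ξ hξ hξ0
  obtain ⟨a, ha⟩ := h ξ hξ hξ0
  obtain ⟨b, hb⟩ := h' ξ hξ hξ0
  exact ⟨a - b, by rw [dftMat_sub, ha, hb, symTens_sub]⟩

lemma IsEquilibrated.sub {S S' : (Fin 3 → Fin N) → Mat ℂ} (h : IsEquilibrated S)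
    (h' : IsEquilibrated S') : IsEquilibrated (S - S') := by
  intro ξ hξ hξ0 n
  simp only [dftMat_sub, Matrix.sub_apply, mul_sub, Finset.sum_sub_distrib, h ξ hξ hξ0 n,
    h' ξ hξ hξ0 n, sub_zero]

/-- Compatible fields of mean zero are orthogonal to equilibrated fields. -/
lemma compatible_orthogonal (hN : 1 ≤ N) {d S : (Fin 3 → Fin N) → Mat ℂ} (hd : IsCompatible d)
    (hd0 : dftMat d 0 = 0) (hS : IsEquilibrated S) (hSs : ∀ I, (S I).IsSymm) :
    ∑ I, ∑ m, ∑ n, star (d I m n) * S I m n = 0 := by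
  have hN' : ((N : ℂ) ^ 3)⁻¹ ≠ 0 := by
    have : (N : ℂ) ≠ 0 := by exact_mod_cast (by omega : N ≠ 0)
    positivity
  refine (mul_eq_zero.mp ?_).resolve_left hN'
  have h1 : ((N : ℂ) ^ 3)⁻¹ * ∑ I, ∑ m, ∑ n, star (d I m n) * S I m n =
      ∑ m, ∑ n, ∑ ξ ∈ freqFinset N, star (dftMat d ξ m n) * dftMat S ξ m n := by
    simp only [dftMat_apply, ← dft_parseval hN, ← Finset.mul_sum]
    congr 1
    rw [Finset.sum_comm]
    exact Finset.sum_congr rfl fun m _ => Finset.sum_comm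
  have h2 : ∑ m, ∑ n, ∑ ξ ∈ freqFinset N, star (dftMat d ξ m n) * dftMat S ξ m n =
      ∑ ξ ∈ freqFinset N, ∑ m, ∑ n, star (dftMat d ξ m n) * dftMat S ξ m n := by
    symm
    rw [Finset.sum_comm]
    exact Finset.sum_congr rfl fun m _ => Finset.sum_comm
  rw [h1, h2]
  refine Finset.sum_eq_zero fun ξ hξ => ?_
  by_cases hξ0 : ξ = 0
  · simp [hξ0, hd0]
  obtain ⟨a, ha⟩ := hd ξ (mem_freqFinset.mp hξ) hξ0
  have he := hS ξ (mem_freqFinset.mp hξ) hξ0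
  have hs := dftMat_isSymm hSs ξ
  rw [ha]
  -- Against a symmetric matrix, each half of the symmetrised product pairs `a` with the divergence,
  -- which vanishes. The frequency is real, so conjugation acts on `a` only.
  have e1 : ∑ m, ∑ n, star (symTens (fun m => (ξ m : ℂ)) a m n) * dftMat S ξ m n =
      (∑ n, star (a n) * ∑ m, (ξ m : ℂ) * dftMat S ξ m n +
        ∑ n, star (a n) * ∑ m, (ξ m : ℂ) * dftMat S ξ m n) / 2 := by
    have e2 : ∑ n, star (a n) * ∑ m, (ξ m : ℂ) * dftMat S ξ m n =
        ∑ m, ∑ n, star (a n) * (ξ m : ℂ) * dftMat S ξ m n := by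
      rw [Finset.sum_comm]
      simp only [Finset.mul_sum, mul_assoc]
    have e3 : ∑ n, star (a n) * ∑ m, (ξ m : ℂ) * dftMat S ξ m n =
        ∑ m, ∑ n, star (a m) * (ξ n : ℂ) * dftMat S ξ m n := by
      simp only [Finset.mul_sum, mul_assoc]
      exact Finset.sum_congr rfl fun m _ => Finset.sum_congr rfl fun n _ => by rw [hs.apply]
    conv_rhs => rw [e2]
    conv_rhs => enter [1, 2]; rw [← e2, e3]
    simp only [← Finset.sum_add_distrib, Finset.sum_div]
    refine Finset.sum_congr rfl fun m _ => Finset.sum_congr rfl fun n _ => ?_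
    simp [symTens]
    ring
  rw [e1]
  simp [he]

variable {Cref : Tensor ℝ} {CN : (Fin 3 → Fin N) → Tensor ℝ}

lemma intCast_ne_zero {ξ : Fin 3 → ℤ} (hξ : ξ ≠ 0) : (fun m => (ξ m : ℝ)) ≠ 0 := by
  obtain ⟨m, hm⟩ := Function.ne_iff.mp hξ
  exact Function.ne_iff.mpr ⟨m, by simpa using hm⟩

lemma stress_isSymm (hCN : ∀ I, IsStiffnessSymm (CN I)) (ε : (Fin 3 → Fin N) → Mat ℂ)
    (I : Fin 3 → Fin N) : (ddot (CN I).toComplex (ε I)).IsSymm :=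
  ddot_isSymm (fun m n p q => by
    simp only [Tensor.toComplex_apply]; rw [(hCN I m n p q).1]) _

/-- A solution of the scheme is compatible and its stress is in equilibrium. -/
lemma IsMSSolution.compatible_equilibrated (href : IsReferenceMedium Cref)
    (hCN : ∀ I, IsStiffnessSymm (CN I)) {E : Mat ℝ} {ε : (Fin 3 → Fin N) → Mat ℂ}
    (h : IsMSSolution Cref CN E ε) :
    IsCompatible ε ∧ IsEquilibrated fun I => ddot (CN I).toComplex (ε I) := by
  have key : ∀ ξ ∈ freq N, ξ ≠ 0 → (∃ a, dftMat ε ξ = symTens (fun m => (ξ m : ℂ)) a) ∧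
      ∀ n, ∑ m, (ξ m : ℂ) * dftMat (fun I => ddot (CN I).toComplex (ε I)) ξ m n = 0 := by
    intro ξ hξ hξ0
    have h1 := h.nonzero_freq ξ hξ hξ0
    rw [polarisation_eq, dftMat_sub, dftMat_ddot] at h1
    have := green_equilibrium href (intCast_ne_zero hξ0)
      (dftMat_isSymm (stress_isSymm hCN ε) ξ) h1
    simpa using this
  exact ⟨fun ξ hξ hξ0 => (key ξ hξ hξ0).1, fun ξ hξ hξ0 => (key ξ hξ hξ0).2⟩

/-- The energy estimate: if `CN : d + r` is in equilibrium for a compatible `d` of mean zero, then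
`d` is bounded by `r`. -/
lemma energy_estimate (hN : 1 ≤ N) {a : ℝ} (ha : 0 < a)
    (hco : ∀ I, ∀ F : Mat ℝ, F.IsSymm → a * frob F F ≤ frob F (ddot (CN I) F))
    {d r : (Fin 3 → Fin N) → Mat ℂ} (hd : IsCompatible d) (hd0 : dftMat d 0 = 0)
    (hds : ∀ I, (d I).IsSymm)
    (hr : IsEquilibrated fun I => ddot (CN I).toComplex (d I) + r I)
    (hrs : ∀ I, (ddot (CN I).toComplex (d I) + r I).IsSymm) :
    a ^ 2 * gridNsq d ≤ gridNsq r := by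
  have h0 := compatible_orthogonal hN hd hd0 hr hrs
  have h1 : ∀ I, a * nsq (d I) ≤ (∑ m, ∑ n, star (d I m n) * ddot (CN I).toComplex (d I) m n).re :=
    fun I => coercive_complex (hco I) (hds I)
  -- Young's inequality weighted by `a`: half of the coercive term is spent on absorbing `d`. After
  -- summation over the grid the product of `d` with the equilibrated field disappears by `h0`.
  have h2 : ∀ I, -(∑ m, ∑ n, star (d I m n) * r I m n).re ≤
      a / 2 * nsq (d I) + 1 / (2 * a) * nsq (r I) := by
    intro I
    simp only [nsq, Complex.re_sum, ← Finset.sum_neg_distrib, Finset.mul_sum,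
      ← Finset.sum_add_distrib]
    refine Finset.sum_le_sum fun m _ => Finset.sum_le_sum fun n _ => ?_
    have e1 : -(star (d I m n) * r I m n).re ≤ ‖d I m n‖ * ‖r I m n‖ := by
      refine (neg_le_abs _).trans ((Complex.abs_re_le_norm _).trans (le_of_eq ?_))
      rw [norm_mul, norm_star]
    have e2 : ‖d I m n‖ * ‖r I m n‖ ≤
        a / 2 * ‖d I m n‖ ^ 2 + 1 / (2 * a) * ‖r I m n‖ ^ 2 := by
      have : a / 2 * ‖d I m n‖ ^ 2 + 1 / (2 * a) * ‖r I m n‖ ^ 2 - ‖d I m n‖ * ‖r I m n‖ =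
          1 / (2 * a) * (a * ‖d I m n‖ - ‖r I m n‖) ^ 2 := by
        field_simp
        ring
      have h3 : 0 ≤ 1 / (2 * a) * (a * ‖d I m n‖ - ‖r I m n‖) ^ 2 := by positivity
      linarith
    exact e1.trans e2
  have h3 : ∀ I, a * nsq (d I) ≤ (∑ m, ∑ n, star (d I m n) *
      (ddot (CN I).toComplex (d I) + r I) m n).re +
      (a / 2 * nsq (d I) + 1 / (2 * a) * nsq (r I)) := by
    intro I
    refine (h1 I).trans ?_
    have := h2 I
    simp only [Matrix.add_apply, mul_add, Finset.sum_add_distrib, Complex.add_re]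
    linarith
  have h4 := Finset.sum_le_sum fun I (_ : I ∈ Finset.univ) => h3 I
  rw [Finset.sum_add_distrib, ← Complex.re_sum, h0, Complex.zero_re, zero_add,
    Finset.sum_add_distrib, ← Finset.mul_sum, ← Finset.mul_sum, ← Finset.mul_sum] at h4
  have h5 : a ^ 2 * ∑ I, nsq (d I) ≤ ∑ I, nsq (r I) := by
    have e := mul_le_mul_of_nonneg_left h4 (by positivity : 0 ≤ 2 * a)
    have e2 : 2 * a * (a / 2 * ∑ I, nsq (d I) + 1 / (2 * a) * ∑ I, nsq (r I)) =
        a ^ 2 * ∑ I, nsq (d I) + ∑ I, nsq (r I) := by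
      field_simp
    rw [e2] at e
    linarith
  have hN3 : 0 ≤ ((N : ℝ) ^ 3)⁻¹ := by positivity
  simp only [gridNsq]
  nlinarith [mul_le_mul_of_nonneg_left h5 hN3]

lemma eq_zero_of_gridNsq (hN : 1 ≤ N) {d : (Fin 3 → Fin N) → Mat ℂ} (h : gridNsq d ≤ 0) :
    d = 0 := by
  have hN3 : 0 < ((N : ℝ) ^ 3)⁻¹ := by positivity
  have h1 : ∑ I, nsq (d I) ≤ 0 := by
    by_contra hc
    exact absurd h (not_le.mpr (mul_pos hN3 (not_le.mp hc)))
  funext I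
  exact nsq_eq_zero ((Finset.single_le_sum (fun I _ => nsq_nonneg (d I))
    (Finset.mem_univ I)).trans h1)

/-- For zero macroscopic strain the solution itself is admissible as `d` in `energy_estimate`, with
`r = 0`. -/
lemma IsMSSolution.eq_zero (hN : 1 ≤ N) (href : IsReferenceMedium Cref)
    (hCN : ∀ I, IsStiffnessSymm (CN I)) {a : ℝ} (ha : 0 < a)
    (hco : ∀ I, ∀ F : Mat ℝ, F.IsSymm → a * frob F F ≤ frob F (ddot (CN I) F))
    {ε : (Fin 3 → Fin N) → Mat ℂ} (h : IsMSSolution Cref CN 0 ε) : ε = 0 := by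
  obtain ⟨h1, h2⟩ := h.compatible_equilibrated href hCN
  have h0 : dftMat ε 0 = 0 := by
    rw [h.zero_freq]
    ext m n
    simp [Mat.toComplex_apply]
  have := energy_estimate hN ha hco (r := 0) h1 h0 h.symm (by simpa using h2)
    (by simpa using stress_isSymm hCN ε)
  refine eq_zero_of_gridNsq hN ?_
  have h3 : gridNsq (0 : (Fin 3 → Fin N) → Mat ℂ) = 0 := by simp [gridNsq, nsq]
  rw [h3] at this
  by_contra hc
  exact absurd this (not_le.mpr (mul_pos (by positivity) (not_le.mp hc)))

lemma IsMSSolution.sub {E E' : Mat ℝ} {ε ε' : (Fin 3 → Fin N) → Mat ℂ}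
    (h : IsMSSolution Cref CN E ε) (h' : IsMSSolution Cref CN E' ε') :
    IsMSSolution Cref CN (E - E') (ε - ε') where
  symm I := (h.symm I).sub (h'.symm I)
  zero_freq := by
    rw [dftMat_sub, h.zero_freq, h'.zero_freq]
    ext m n
    simp [Mat.toComplex_apply]
  nonzero_freq ξ hξ hξ0 := by
    rw [dftMat_sub, polarisation_sub, dftMat_sub, ddot_sub, h.nonzero_freq ξ hξ hξ0,
      h'.nonzero_freq ξ hξ hξ0]
    abel

lemma IsMSSolution.add {E E' : Mat ℝ} {ε ε' : (Fin 3 → Fin N) → Mat ℂ}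
    (h : IsMSSolution Cref CN E ε) (h' : IsMSSolution Cref CN E' ε') :
    IsMSSolution Cref CN (E + E') (ε + ε') where
  symm I := (h.symm I).add (h'.symm I)
  zero_freq := by
    rw [dftMat_add, h.zero_freq, h'.zero_freq]
    ext m n
    simp [Mat.toComplex_apply]
  nonzero_freq ξ hξ hξ0 := by
    rw [dftMat_add, polarisation_add, dftMat_add, ddot_add, h.nonzero_freq ξ hξ hξ0,
      h'.nonzero_freq ξ hξ hξ0]
    abel

lemma IsMSSolution.smul {E : Mat ℝ} {ε : (Fin 3 → Fin N) → Mat ℂ}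
    (h : IsMSSolution Cref CN E ε) (c : ℝ) :
    IsMSSolution Cref CN (c • E) ((c : ℂ) • ε) where
  symm I := (h.symm I).smul (c : ℂ)
  zero_freq := by
    rw [dftMat_smul, h.zero_freq]
    ext m n
    simp [Mat.toComplex_apply]
  nonzero_freq ξ hξ hξ0 := by
    rw [dftMat_smul, polarisation_smul, dftMat_smul, ddot_smul, h.nonzero_freq ξ hξ hξ0,
      smul_neg]

lemma IsMSSolution.unique (hN : 1 ≤ N) (href : IsReferenceMedium Cref)
    (hCN : ∀ I, IsStiffnessSymm (CN I)) {a : ℝ} (ha : 0 < a)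
    (hco : ∀ I, ∀ F : Mat ℝ, F.IsSymm → a * frob F F ≤ frob F (ddot (CN I) F))
    {E : Mat ℝ} {ε ε' : (Fin 3 → Fin N) → Mat ℂ} (h : IsMSSolution Cref CN E ε)
    (h' : IsMSSolution Cref CN E ε') : ε = ε' := by
  have := h.sub h'
  rw [sub_self] at this
  exact sub_eq_zero.mp (this.eq_zero hN href hCN ha hco)

/-- The Lippmann–Schwinger operator `ε ↦ ε + Γ⁰ * ((CN - Cref) : ε)`. -/
noncomputable def lippmannSchwinger (Cref : Tensor ℝ) (CN : (Fin 3 → Fin N) → Tensor ℝ) :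
    ((Fin 3 → Fin N) → Mat ℂ) →ₗ[ℂ] ((Fin 3 → Fin N) → Mat ℂ) where
  toFun ε I := ε I + ∑ ξ ∈ freqFinset N, mode ξ (gridPt N I) •
    ddot (green Cref fun m => (ξ m : ℝ)).toComplex (dftMat (polarisation Cref CN ε) ξ)
  map_add' ε ε' := by
    funext I
    simp only [polarisation_add, dftMat_add, ddot_add, smul_add, Finset.sum_add_distrib,
      Pi.add_apply]
    abel
  map_smul' c ε := by
    funext I
    simp only [polarisation_smul, dftMat_smul, ddot_smul, Pi.smul_apply, RingHom.id_apply,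
      smul_add, Finset.smul_sum]
    congr 1
    exact Finset.sum_congr rfl fun ξ _ => smul_comm _ _ _

lemma dftMat_lippmannSchwinger (hN : 1 ≤ N) (ε : (Fin 3 → Fin N) → Mat ℂ) {ξ : Fin 3 → ℤ}
    (hξ : ξ ∈ freq N) :
    dftMat (lippmannSchwinger Cref CN ε) ξ = dftMat ε ξ +
      ddot (green Cref fun m => (ξ m : ℝ)).toComplex (dftMat (polarisation Cref CN ε) ξ) := by
  ext m n
  have h := dft_trig hN (freqFinset N) (fun ξ h => mem_freqFinset.mp h) (fun ξ =>
    ddot (green Cref fun m => (ξ m : ℝ)).toComplex (dftMat (polarisation Cref CN ε) ξ) m n) hξ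
  rw [if_pos (mem_freqFinset.mpr hξ)] at h
  rw [Matrix.add_apply, ← h, dftMat_apply, dftMat_apply, ← dft_add]
  congr 1
  funext I
  simp [lippmannSchwinger, trig, Matrix.sum_apply, mul_comm]

/-- Every term carries two factors of `ξ`, so the value assigned to the inverse of the singular
tensor at `ξ = 0` is immaterial. -/
lemma green_zero (Cref : Tensor ℝ) (F : Mat ℂ) :
    ddot (green Cref fun m => ((0 : Fin 3 → ℤ) m : ℝ)).toComplex F = 0 := by
  ext m n
  simp [ddot_apply, green, Tensor.toComplex_apply]

/-- The scheme is read off frequency by frequency; at zero the Green symbol vanishes, which leaves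
the mean value. Symmetry of `ε` comes for free, as `E` and all values of the Green operator are
symmetric. -/
lemma isMSSolution_of_lippmannSchwinger (hN : 1 ≤ N) {E : Mat ℝ} (hE : E.IsSymm)
    {ε : (Fin 3 → Fin N) → Mat ℂ} (h : lippmannSchwinger Cref CN ε = fun _ => E.toComplex) :
    IsMSSolution Cref CN E ε := by
  have hc : ∀ ξ ∈ freq N, dftMat (fun _ : Fin 3 → Fin N => E.toComplex) ξ =
      if ξ = 0 then E.toComplex else 0 := by
    intro ξ hξ
    ext m n
    have := dft_trig hN {0} (fun ξ h => by
      rw [Finset.mem_singleton.mp h]; exact zero_mem_freq hN) (fun _ => E.toComplex m n) hξ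
    simp only [trig, Finset.sum_singleton, mode_zero, mul_one, Finset.mem_singleton] at this
    rw [dftMat_apply, this]
    split_ifs <;> rfl
  refine ⟨fun I => ?_, ?_, fun ξ hξ hξ0 => ?_⟩
  · have h1 : ε I = E.toComplex - ∑ ξ ∈ freqFinset N, mode ξ (gridPt N I) •
        ddot (green Cref fun m => (ξ m : ℝ)).toComplex (dftMat (polarisation Cref CN ε) ξ) :=
      eq_sub_of_add_eq (congrFun h I)
    rw [h1]
    refine Matrix.IsSymm.sub ?_ ?_
    · ext m n
      simp [Mat.toComplex_apply, hE.apply m n]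
    · rw [Matrix.IsSymm, Matrix.transpose_sum]
      refine Finset.sum_congr rfl fun ξ _ => ?_
      refine Matrix.IsSymm.smul (ddot_isSymm (fun m n p q => ?_) _) _
      simp only [Tensor.toComplex_apply, green]
      congr 2
      ring
  · have h1 := dftMat_lippmannSchwinger (Cref := Cref) (CN := CN) hN ε (zero_mem_freq hN)
    rw [h, hc 0 (zero_mem_freq hN), if_pos rfl, green_zero, add_zero] at h1
    exact h1.symm
  · have h1 := dftMat_lippmannSchwinger (Cref := Cref) (CN := CN) hN ε hξ
    rw [h, hc ξ hξ, if_neg hξ0] at h1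
    exact eq_neg_of_add_eq_zero_left h1.symm

/-- The scheme has exactly one solution. -/
lemma existsUnique_isMSSolution (hN : 1 ≤ N) (href : IsReferenceMedium Cref)
    (hCN : ∀ I, IsStiffnessSymm (CN I)) {a : ℝ} (ha : 0 < a)
    (hco : ∀ I, ∀ F : Mat ℝ, F.IsSymm → a * frob F F ≤ frob F (ddot (CN I) F))
    {E : Mat ℝ} (hE : E.IsSymm) : ∃! ε, IsMSSolution Cref CN E ε := by
  have hinj : Function.Injective (lippmannSchwinger Cref CN) := by
    rw [injective_iff_map_eq_zero]
    intro ε hε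
    refine IsMSSolution.eq_zero hN href hCN ha hco
      (isMSSolution_of_lippmannSchwinger hN (Matrix.isSymm_zero) ?_)
    rw [hε]
    funext I
    ext m n
    simp [Mat.toComplex_apply]
  -- Grid fields form a finite-dimensional space, so uniqueness gives existence.
  obtain ⟨ε, hε⟩ := LinearMap.injective_iff_surjective.mp hinj fun _ => E.toComplex
  exact ⟨ε, isMSSolution_of_lippmannSchwinger hN hE hε, fun ε' h' =>
    h'.unique hN href hCN ha hco (isMSSolution_of_lippmannSchwinger hN hE hε)⟩

lemma Mat.toComplex_eq_map (E : Mat ℝ) : E.toComplex = E.map (algebraMap ℝ ℂ) := rfl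

/-- The effective tensor of the scheme is well defined. -/
lemma existsUnique_isMSEffectiveTensor (hN : 1 ≤ N) (href : IsReferenceMedium Cref)
    (hCN : ∀ I, IsStiffnessSymm (CN I)) {a : ℝ} (ha : 0 < a)
    (hco : ∀ I, ∀ F : Mat ℝ, F.IsSymm → a * frob F F ≤ frob F (ddot (CN I) F)) :
    ∃! T, IsMSEffectiveTensor Cref CN T := by
  -- Solving for `symPart E` extends the solution map to all matrices, where it is linear by
  -- uniqueness and `exists_tensor` applies.
  choose ε hε using fun E : Mat ℝ =>
    (existsUnique_isMSSolution hN href hCN ha hco (symPart_isSymm E)).exists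
  have hadd : ∀ E E', ε (E + E') = ε E + ε E' := fun E E' =>
    (hε (E + E')).unique hN href hCN ha hco (by
      convert (hε E).add (hε E') using 1
      ext m n
      simp [symPart]; ring)
  have hsmul : ∀ (c : ℝ) E, ε (c • E) = (c : ℂ) • ε E := fun c E =>
    (hε (c • E)).unique hN href hCN ha hco (by
      convert (hε E).smul c using 1
      ext m n
      simp [symPart]; ring)
  let R : Mat ℝ →ₗ[ℝ] Mat ℂ :=
    { toFun := fun E => ((N : ℂ) ^ 3)⁻¹ • ∑ I, ddot (CN I).toComplex (ε E I)
      map_add' := fun E E' => by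
        simp only [hadd, Pi.add_apply, ddot_add, Finset.sum_add_distrib, smul_add]
      map_smul' := fun c E => by
        simp only [hsmul, Pi.smul_apply, ddot_smul, ← Finset.smul_sum, RingHom.id_apply]
        rw [smul_comm, Complex.coe_smul] }
  obtain ⟨T, hT, hTR⟩ := exists_tensor R fun E => by
    refine Matrix.IsSymm.smul ?_ _
    rw [Matrix.IsSymm, Matrix.transpose_sum]
    exact Finset.sum_congr rfl fun I _ => stress_isSymm hCN _ I
  refine ⟨T, ⟨hT, fun E hE => ⟨ε E, ?_, hTR E hE⟩⟩, fun T' hT' => ?_⟩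
  · have := hε E
    rwa [symPart_of_isSymm hE] at this
  · refine tensor_ext hT'.1 hT fun E hE => ?_
    obtain ⟨ε', h1, h2⟩ := hT'.2 E hE
    have h3 := hε E
    rw [symPart_of_isSymm hE] at h3
    rw [hTR E hE, ← Mat.toComplex_eq_map, h2, h1.unique hN href hCN ha hco h3]
    rfl

end Scheme

/-! ### Lipschitz boundaries are null sets -/

open scoped Pointwise in
/-- The graph of a continuous function over the hyperplane orthogonal to a unit vector is null. -/
lemma volume_graph_eq_zero {ν : Space} (hν : ‖ν‖ = 1) {γ : Space → ℝ} (hγ : Continuous γ) :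
    volume {x : Space | γ (x - (inner ℝ ν x) • ν) = inner ℝ ν x} = 0 := by
  have hνν : inner ℝ ν ν = (1 : ℝ) := by rw [real_inner_self_eq_norm_sq, hν, one_pow]
  refine Measure.addHaar_eq_zero_of_disjoint_translates volume
    (fun n : ℕ => (1 / ((n : ℝ) + 1)) • ν) ?_ ?_ ?_
  · refine (isBounded_iff_forall_norm_le.mpr ⟨1, ?_⟩)
    rintro _ ⟨n, rfl⟩
    rw [norm_smul, hν, mul_one, Real.norm_of_nonneg (by positivity), div_le_one (by positivity)]
    linarith [(Nat.cast_nonneg n : (0 : ℝ) ≤ n)]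
  · intro i j hij
    rw [Function.onFun, Set.disjoint_left]
    intro y hy hy'
    -- A point of the `k`-th translate has height `1 / (k + 1)` over the graph, which determines
    -- `k`. So infinitely many translates by bounded vectors are disjoint, and the graph must be
    -- null.
    have key : ∀ k : ℕ, y ∈ (({(1 / ((k : ℝ) + 1)) • ν} : Set Space) +
        {x : Space | γ (x - (inner ℝ ν x) • ν) = inner ℝ ν x}) →
        inner ℝ ν y - γ (y - (inner ℝ ν y) • ν) = 1 / ((k : ℝ) + 1) := by
      intro k hk
      rw [Set.singleton_add] at hk
      obtain ⟨s, hs, rfl⟩ := hk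
      have hs' : γ (s - (inner ℝ ν s) • ν) = inner ℝ ν s := hs
      have e : inner ℝ ν ((1 / ((k : ℝ) + 1)) • ν + s) = 1 / ((k : ℝ) + 1) + inner ℝ ν s := by
        rw [inner_add_right, inner_smul_right, hνν, mul_one]
      have e2 : (1 / ((k : ℝ) + 1)) • ν + s - (1 / ((k : ℝ) + 1) + inner ℝ ν s) • ν =
          s - (inner ℝ ν s) • ν := by
        rw [add_smul]; abel
      simp only [e, e2, hs']
      ring
    have h := (key i hy).symm.trans (key j hy')
    have h2 : ((i : ℝ) + 1) = (j : ℝ) + 1 := by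
      rw [div_eq_div_iff (by positivity) (by positivity)] at h
      linarith
    exact hij (by exact_mod_cast (add_right_cancel h2))
  · refine (isClosed_eq ?_ ?_).measurableSet <;> fun_prop

/-- Locally the frontier lies on the graph: points above it belong to the open set `D`, and points
strictly below it have a neighbourhood missing `D`. -/
lemma IsLipschitzOpen.volume_frontier {D : Set Space} (hD : IsLipschitzOpen D) :
    volume (frontier D) = 0 := by
  refine measure_null_of_locally_null _ fun x₀ hx₀ => ?_
  obtain ⟨r, ν, K, γ, hr, hν, hγ, h⟩ := hD.2 x₀ hx₀
  refine ⟨frontier D ∩ Metric.ball x₀ r,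
    inter_mem_nhdsWithin _ (Metric.ball_mem_nhds x₀ hr), ?_⟩
  refine measure_mono_null ?_ (volume_graph_eq_zero hν hγ.continuous)
  rintro x ⟨hx, hxr⟩
  have hγc := hγ.continuous
  rw [hD.1.frontier_eq] at hx
  have h1 : inner ℝ ν x ≤ γ (x - (inner ℝ ν x) • ν) := not_lt.mp fun hlt => hx.2 ((h x hxr).mpr hlt)
  refine le_antisymm ?_ h1
  by_contra! hlt
  have hop : IsOpen (Metric.ball x₀ r ∩
      {y | inner ℝ ν y < γ (y - (inner ℝ ν y) • ν)}) :=
    Metric.isOpen_ball.inter (isOpen_lt (by fun_prop) (by fun_prop))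
  obtain ⟨y, hy, hyD⟩ := mem_closure_iff.mp hx.1 _ hop ⟨hxr, hlt⟩
  exact absurd ((h y hy.1).mp hyD) (not_lt.mpr (le_of_lt hy.2))

lemma isOpen_box (a b : Fin 3 → ℝ) : IsOpen {x : Space | ∀ m, a m < x m ∧ x m < b m} := by
  have : {x : Space | ∀ m, a m < x m ∧ x m < b m} =
      ⋂ m : Fin 3, {x : Space | a m < x m} ∩ {x : Space | x m < b m} := by
    ext x; simp
  rw [this]
  exact isOpen_iInter_of_finite fun m =>
    (isOpen_lt continuous_const (by fun_prop)).inter (isOpen_lt (by fun_prop) continuous_const)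

lemma isOpen_cell : IsOpen cell := isOpen_box 0 1

/-- The interfaces are null. Of the Lipschitz assumption, only this consequence and the openness of
the subdomains are used. -/
lemma AssumptionA.ae_mem {M : ℕ} {D : Fin (M + 1) → Set Space} {Λ : Fin (M + 1) → Tensor ℝ}
    {C : Space → Tensor ℝ} (hA : AssumptionA D Λ C) :
    ∀ᵐ x ∂cellMeasure, ∃ l, x ∈ D l := by
  rw [cellMeasure, ae_restrict_iff' isOpen_cell.measurableSet]
  have h0 : ∀ᵐ x : Space, ∀ l, x ∉ frontier (D l) := by
    rw [ae_all_iff]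
    intro l
    exact measure_eq_zero_iff_ae_notMem.mp (hA.lipschitz l).volume_frontier
  filter_upwards [h0] with x hx hxc
  obtain ⟨l, hl⟩ := Set.mem_iUnion.mp (hA.cover hxc)
  refine ⟨l, ?_⟩
  by_contra hn
  exact hx l ((hA.lipschitz l).1.frontier_eq ▸ ⟨hl, hn⟩)

/-! ### Riemann sums over voxels -/

lemma volume_box (a b : Fin 3 → ℝ) :
    volume {x : Space | ∀ m, a m < x m ∧ x m < b m} = ∏ m, ENNReal.ofReal (b m - a m) := by
  rw [← Real.volume_pi_Ioo, ← (PiLp.volume_preserving_ofLp (Fin 3)).measure_preimage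
    (MeasurableSet.univ_pi fun _ => measurableSet_Ioo).nullMeasurableSet]
  congr 1
  ext x
  simp [Set.mem_pi]

instance : IsProbabilityMeasure cellMeasure := ⟨by
  rw [cellMeasure, Measure.restrict_apply_univ]
  have := volume_box 0 1
  simpa [cell] using this⟩

lemma voxel_subset_cell {N : ℕ} (I : Fin 3 → Fin N) : voxel N I ⊆ cell := by
  intro x hx m
  have hN : (0 : ℝ) < N := by exact_mod_cast (I m).pos
  refine ⟨lt_of_le_of_lt (by positivity) (hx m).1, lt_of_lt_of_le (hx m).2 ?_⟩
  rw [div_le_one hN]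
  exact_mod_cast (I m).isLt

lemma measurableSet_voxel {N : ℕ} (I : Fin 3 → Fin N) : MeasurableSet (voxel N I) :=
  (isOpen_box _ _).measurableSet

lemma cellMeasure_voxel {N : ℕ} (hN : 1 ≤ N) (I : Fin 3 → Fin N) :
    cellMeasure (voxel N I) = ENNReal.ofReal (((N : ℝ) ^ 3)⁻¹) := by
  rw [cellMeasure, Measure.restrict_eq_self _ (voxel_subset_cell I), voxel, volume_box]
  have : ∀ m : Fin 3, (((I m : ℕ) : ℝ) + 1) / N - ((I m : ℕ) : ℝ) / N = (N : ℝ)⁻¹ := by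
    intro m
    ring
  simp only [this, Finset.prod_const, Finset.card_univ, Fintype.card_fin]
  rw [← ENNReal.ofReal_pow (by positivity), inv_pow]

lemma voxel_index_unique {N : ℕ} {I J : Fin 3 → Fin N} {x : Space} (hI : x ∈ voxel N I)
    (hJ : x ∈ voxel N J) : I = J := by
  have key : ∀ {I J : Fin 3 → Fin N}, x ∈ voxel N I → x ∈ voxel N J → ∀ m, I m ≤ J m := by
    intro I J hI hJ m
    have hN : (0 : ℝ) < N := by exact_mod_cast (I m).pos
    have h := (hI m).1.trans (hJ m).2
    rw [div_lt_div_iff_of_pos_right hN] at h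
    have h2 : (I m : ℕ) < (J m : ℕ) + 1 := by exact_mod_cast h
    exact Fin.le_def.mpr (by omega)
  exact funext fun m => le_antisymm (key hI hJ m) (key hJ hI m)

/-- The `N³` disjoint voxels of volume `N⁻³` already exhaust the unit mass of the cell. -/
lemma ae_mem_voxel {N : ℕ} (hN : 1 ≤ N) : ∀ᵐ x ∂cellMeasure, ∃ I, x ∈ voxel N I := by
  have hN' : (0 : ℝ) < N := by exact_mod_cast hN
  have h1 : cellMeasure (⋃ I, voxel N I) = 1 := by
    rw [measure_iUnion _ measurableSet_voxel, tsum_fintype]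
    · simp only [cellMeasure_voxel hN, Finset.sum_const, Finset.card_univ, Fintype.card_fun,
        Fintype.card_fin, nsmul_eq_mul]
      rw [← ENNReal.ofReal_natCast, ← ENNReal.ofReal_mul (by positivity)]
      push_cast
      rw [mul_inv_cancel₀ (by positivity), ENNReal.ofReal_one]
    · intro I J hIJ
      exact Set.disjoint_left.mpr fun x hI hJ => hIJ (voxel_index_unique hI hJ)
  have h2 := (prob_compl_eq_zero_iff (MeasurableSet.iUnion measurableSet_voxel)).mpr h1
  filter_upwards [measure_eq_zero_iff_ae_notMem.mp h2] with x hx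
  simpa using hx

/-- The step function with value `F I` in the voxel `I`. -/
noncomputable def step {N : ℕ} (F : (Fin 3 → Fin N) → ℝ) (x : Space) : ℝ :=
  ∑ I, (voxel N I).indicator (fun _ => F I) x

lemma step_of_mem {N : ℕ} (F : (Fin 3 → Fin N) → ℝ) {x : Space} {I : Fin 3 → Fin N}
    (hx : x ∈ voxel N I) : step F x = F I := by
  rw [step, Finset.sum_eq_single I]
  · rw [Set.indicator_of_mem hx]
  · intro J _ hJ
    exact Set.indicator_of_notMem (fun h => hJ (voxel_index_unique h hx)) _
  · simp

lemma measurable_step {N : ℕ} (F : (Fin 3 → Fin N) → ℝ) : Measurable (step F) :=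
  Finset.measurable_sum _ fun I _ => measurable_const.indicator (measurableSet_voxel I)

lemma integral_step {N : ℕ} (hN : 1 ≤ N) (F : (Fin 3 → Fin N) → ℝ) :
    ∫ x, step F x ∂cellMeasure = ((N : ℝ) ^ 3)⁻¹ * ∑ I, F I := by
  simp only [step]
  rw [integral_finsetSum _ fun I _ => (integrable_const _).indicator (measurableSet_voxel I),
    Finset.mul_sum]
  refine Finset.sum_congr rfl fun I _ => ?_
  rw [integral_indicator (measurableSet_voxel I), setIntegral_const, Measure.real,
    cellMeasure_voxel hN, ENNReal.toReal_ofReal (by positivity), smul_eq_mul]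

/-- Voxel sums converge to integrals. -/
lemma tendsto_voxel_sum {Φ : (N : ℕ) → (Fin 3 → Fin N) → ℝ} {φ : Space → ℝ} {B : ℝ}
    (hB : ∀ N, 1 ≤ N → ∀ I, |Φ N I| ≤ B)
    (hlim : ∀ᵐ x ∂cellMeasure, ∀ δ > 0, ∀ᶠ N in atTop, ∀ I, x ∈ voxel N I →
      |Φ N I - φ x| < δ) :
    Tendsto (fun N : ℕ => ((N : ℝ) ^ 3)⁻¹ * ∑ I, Φ N I) atTop (𝓝 (∫ x, φ x ∂cellMeasure)) := by
  have hcov : ∀ᵐ x ∂cellMeasure, ∀ N, 1 ≤ N → ∃ I, x ∈ voxel N I := by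
    rw [ae_all_iff]
    intro N
    by_cases hN : 1 ≤ N
    · filter_upwards [ae_mem_voxel hN] with x hx _ using hx
    · exact Eventually.of_forall fun x h => absurd h hN
  -- The voxel sums are integrals of step functions, so dominated convergence applies with the
  -- constant bound `B`.
  have h1 : Tendsto (fun N : ℕ => ∫ x, step (Φ N) x ∂cellMeasure) atTop
      (𝓝 (∫ x, φ x ∂cellMeasure)) := by
    refine tendsto_integral_filter_of_dominated_convergence (fun _ => B)
      (Eventually.of_forall fun N => (measurable_step _).aestronglyMeasurable) ?_
      (integrable_const _) ?_
    · filter_upwards [eventually_ge_atTop 1] with N hN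
      filter_upwards [hcov] with x hx
      obtain ⟨I, hI⟩ := hx N hN
      rw [step_of_mem _ hI]
      exact hB N hN I
    · filter_upwards [hcov, hlim] with x hx hl
      rw [Metric.tendsto_atTop']
      intro δ hδ
      obtain ⟨N₀, hN₀⟩ := eventually_atTop.mp (hl δ hδ)
      refine ⟨max N₀ 1, fun N hN => ?_⟩
      have hN1 : N₀ ≤ N := (le_max_left _ _).trans hN.le
      have hN2 : 1 ≤ N := (le_max_right _ _).trans hN.le
      obtain ⟨I, hI⟩ := hx N hN2
      rw [step_of_mem _ hI, Real.dist_eq]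
      exact hN₀ N hN1 I hI
  refine h1.congr' ?_
  filter_upwards [eventually_ge_atTop 1] with N hN using integral_step hN _

lemma dist_le_of_coord {x y : Space} {t : ℝ} (ht : 0 ≤ t) (h : ∀ m, |x m - y m| ≤ t) :
    dist x y ≤ 2 * t := by
  rw [EuclideanSpace.dist_eq]
  refine Real.sqrt_le_iff.mpr ⟨by positivity, ?_⟩
  have : ∀ m, dist (x m) (y m) ^ 2 ≤ t ^ 2 := fun m => by
    rw [Real.dist_eq]
    exact pow_le_pow_left₀ (abs_nonneg _) (h m) 2
  calc ∑ m, dist (x m) (y m) ^ 2 ≤ ∑ _m : Fin 3, t ^ 2 := Finset.sum_le_sum fun m _ => this m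
    _ ≤ (2 * t) ^ 2 := by simp; nlinarith [sq_nonneg t]

lemma dist_voxel {N : ℕ} {I : Fin 3 → Fin N} {x y : Space} (hx : x ∈ voxel N I)
    (hy : y ∈ voxel N I) : dist y x ≤ 2 * (1 / N) := by
  refine dist_le_of_coord (by positivity) fun m => ?_
  have h1 := hx m
  have h2 := hy m
  rw [add_div] at h1 h2
  rw [abs_le]
  constructor <;> linarith [h1.1, h1.2, h2.1, h2.2]

lemma dist_gridPt {N : ℕ} {I : Fin 3 → Fin N} {x : Space} (hx : x ∈ voxel N I) :
    dist (gridPt N I) x ≤ 2 * (1 / N) := by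
  refine dist_le_of_coord (by positivity) fun m => ?_
  have h1 := hx m
  rw [add_div] at h1
  have h2 : gridPt N I m = ((I m : ℕ) : ℝ) / N := rfl
  rw [h2, abs_le]
  constructor <;> linarith [h1.1, h1.2]

lemma AssumptionC.exists_eq {M : ℕ} {D : Fin (M + 1) → Set Space} {Λ : Fin (M + 1) → Tensor ℝ}
    {N : ℕ} {CN : (Fin 3 → Fin N) → Tensor ℝ} (hC : AssumptionC D Λ N CN) (I : Fin 3 → Fin N) :
    ∃ l, CN I = Λ l := by
  by_cases h : ∃ l, voxel N I ⊆ D l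
  · obtain ⟨l, hl⟩ := h
    exact ⟨l, hC.inside I l hl⟩
  · obtain ⟨l, -, hl⟩ := hC.mixed I (not_exists.mp h)
    exact ⟨l, hl⟩

@[fun_prop]
lemma continuous_nsq : Continuous nsq := by
  unfold nsq
  fun_prop

lemma continuous_ddot (T : Tensor ℂ) : Continuous (ddot T) := by
  refine continuous_matrix fun m n => ?_
  simp only [ddot_apply]
  fun_prop

/-- The squared norm of `CN : g - h` on the grid converges to that of `C : g - h` on the cell. -/
lemma tendsto_gridNsq {M : ℕ} {D : Fin (M + 1) → Set Space} {Λ : Fin (M + 1) → Tensor ℝ}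
    {C : Space → Tensor ℝ} {CN : (N : ℕ) → (Fin 3 → Fin N) → Tensor ℝ} (hA : AssumptionA D Λ C)
    (hC : ∀ N, 1 ≤ N → AssumptionC D Λ N (CN N)) {g h : Space → Mat ℂ} (hg : Continuous g)
    (hh : Continuous h) {B : ℝ} (hgB : ∀ x, nsq (g x) ≤ B) (hhB : ∀ x, nsq (h x) ≤ B) :
    Tendsto (fun N : ℕ => gridNsq fun I =>
      ddot (CN N I).toComplex (g (gridPt N I)) - h (gridPt N I)) atTop
      (𝓝 (∫ x, nsq (ddot (C x).toComplex (g x) - h x) ∂cellMeasure)) := by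
  have hneg : ∀ F : Mat ℂ, nsq (-F) = nsq F := fun F => by simp [nsq]
  refine tendsto_voxel_sum (B := 2 * ((∑ l, (Λ l).nsq) * B) + 2 * B) ?_ ?_
  · intro N hN I
    obtain ⟨l, hl⟩ := (hC N hN).exists_eq I
    simp only [abs_of_nonneg (nsq_nonneg _), sub_eq_add_neg]
    refine (nsq_add_le _ _).trans ?_
    rw [hneg, hl]
    have h1 : (Λ l).nsq ≤ ∑ l, (Λ l).nsq :=
      Finset.single_le_sum (fun l _ => (Λ l).nsq_nonneg) (Finset.mem_univ l)
    have h2 := nsq_ddot_le (Λ l) (g (gridPt N I))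
    have h3 : (Λ l).nsq * nsq (g (gridPt N I)) ≤ (∑ l, (Λ l).nsq) * B :=
      mul_le_mul h1 (hgB _) (nsq_nonneg _) ((Λ l).nsq_nonneg.trans h1)
    have h4 := hhB (gridPt N I)
    linarith
  -- Around a point of the open set `D l`, voxels of small diameter lie inside `D l` and carry the
  -- exact tensor. The arbitrary choice in mixed voxels is thus invisible almost everywhere in the
  -- limit.
  · filter_upwards [hA.ae_mem] with x hx δ hδ
    obtain ⟨l, hl⟩ := hx
    have hψ : Continuous fun y => nsq (ddot (Λ l).toComplex (g y) - h y) :=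
      continuous_nsq.comp (((continuous_ddot _).comp hg).sub hh)
    obtain ⟨η, hη, hη'⟩ := Metric.continuous_iff.mp hψ x δ hδ
    obtain ⟨ρ, hρ, hρ'⟩ := Metric.isOpen_iff.mp (hA.lipschitz l).1 x hl
    have hsmall : ∀ᶠ N : ℕ in atTop, 2 * (1 / (N : ℝ)) < min η ρ := by
      have : Tendsto (fun N : ℕ => 2 * (1 / (N : ℝ))) atTop (𝓝 (2 * 0)) :=
        tendsto_one_div_atTop_nhds_zero_nat.const_mul 2
      rw [mul_zero] at this
      exact this.eventually (gt_mem_nhds (lt_min hη hρ))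
    filter_upwards [hsmall, eventually_ge_atTop 1] with N hN hN1 I hxI
    have hin : voxel N I ⊆ D l := fun y hy =>
      hρ' ((dist_voxel hxI hy).trans_lt (hN.trans_le (min_le_right _ _)))
    rw [(hC N hN1).inside I l hin, hA.const l x hl]
    exact hη' _ ((dist_gridPt hxI).trans_lt (hN.trans_le (min_le_left _ _)))

/-! ### Calculus of Fourier modes and of periodic functions -/

/-- The linear phase `x ↦ 2 π i ξ · x`. -/
noncomputable def phase (ξ : Fin 3 → ℤ) : Space →L[ℝ] ℂ :=
  ∑ m, (2 * Real.pi * Complex.I * (ξ m : ℂ)) •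
    (Complex.ofRealCLM ∘L (EuclideanSpace.proj m : Space →L[ℝ] ℝ))

lemma phase_apply (ξ : Fin 3 → ℤ) (x : Space) :
    phase ξ x = 2 * Real.pi * Complex.I * ∑ m, (ξ m : ℂ) * (x m : ℂ) := by
  simp [phase, Finset.mul_sum, mul_assoc]

lemma phase_single (ξ : Fin 3 → ℤ) (m : Fin 3) :
    phase ξ (EuclideanSpace.single m 1) = 2 * Real.pi * Complex.I * (ξ m : ℂ) := by
  rw [phase_apply]
  congr 1
  rw [Finset.sum_eq_single m] <;> simp +contextual

lemma mode_eq_exp (ξ : Fin 3 → ℤ) : mode ξ = fun x => Complex.exp (phase ξ x) := by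
  funext x
  rw [phase_apply, mode]

lemma contDiff_mode (ξ : Fin 3 → ℤ) {n : WithTop ℕ∞} : ContDiff ℝ n (mode ξ) := by
  rw [mode_eq_exp]
  exact (phase ξ).contDiff.cexp

@[fun_prop]
lemma continuous_mode (ξ : Fin 3 → ℤ) : Continuous (mode ξ) := (contDiff_mode ξ (n := 0)).continuous

lemma hasFDerivAt_mode (ξ : Fin 3 → ℤ) (x : Space) :
    HasFDerivAt (mode ξ) (mode ξ x • phase ξ) x := by
  rw [mode_eq_exp]
  exact (phase ξ).hasFDerivAt.cexp

lemma mode_periodic (ξ : Fin 3 → ℤ) (x : Space) (m : Fin 3) :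
    mode ξ (x + EuclideanSpace.single m 1) = mode ξ x := by
  simp only [mode_eq_exp, map_add, Complex.exp_add, phase_single]
  rw [mul_comm (2 * Real.pi * Complex.I), Complex.exp_int_mul_two_pi_mul_I, mul_one]

lemma contDiff_trig (s : Finset (Fin 3 → ℤ)) (c : (Fin 3 → ℤ) → ℂ) {n : WithTop ℕ∞} :
    ContDiff ℝ n (trig s c) :=
  ContDiff.sum fun ξ _ => contDiff_const.mul (contDiff_mode ξ)

lemma continuous_trig (s : Finset (Fin 3 → ℤ)) (c : (Fin 3 → ℤ) → ℂ) : Continuous (trig s c) :=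
  (contDiff_trig s c (n := 0)).continuous

lemma trig_periodic (s : Finset (Fin 3 → ℤ)) (c : (Fin 3 → ℤ) → ℂ) (x : Space) (m : Fin 3) :
    trig s c (x + EuclideanSpace.single m 1) = trig s c x := by
  simp only [trig, mode_periodic]

lemma norm_trig_le (s : Finset (Fin 3 → ℤ)) (c : (Fin 3 → ℤ) → ℂ) (x : Space) :
    ‖trig s c x‖ ≤ ∑ ξ ∈ s, ‖c ξ‖ := by
  refine (norm_sum_le _ _).trans (le_of_eq ?_)
  simp [norm_mode]

lemma fderiv_trig (s : Finset (Fin 3 → ℤ)) (c : (Fin 3 → ℤ) → ℂ) (x : Space) (m : Fin 3) :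
    fderiv ℝ (trig s c) x (EuclideanSpace.single m 1) =
      trig s (fun ξ => 2 * Real.pi * Complex.I * (ξ m : ℂ) * c ξ) x := by
  have h : HasFDerivAt (trig s c) (∑ ξ ∈ s, c ξ • (mode ξ x • phase ξ)) x :=
    HasFDerivAt.fun_sum fun ξ _ => (hasFDerivAt_mode ξ x).const_mul (c ξ)
  rw [h.fderiv]
  simp only [sum_apply, smul_apply, phase_single, trig,
    smul_eq_mul]
  exact Finset.sum_congr rfl fun ξ _ => by ring

/-- The real part of a trigonometric polynomial is smooth and periodic. -/
lemma isSmoothPeriodic_re_trig (s : Finset (Fin 3 → ℤ)) (c : (Fin 3 → ℤ) → ℂ) :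
    IsSmoothPeriodic fun x => (trig s c x).re :=
  ⟨Complex.reCLM.contDiff.comp (contDiff_trig s c), fun x m => congrArg Complex.re (trig_periodic s c x m)⟩

lemma partialDeriv_re_trig (s : Finset (Fin 3 → ℤ)) (c : (Fin 3 → ℤ) → ℂ) (m : Fin 3)
    (x : Space) : partialDeriv m (fun x => (trig s c x).re) x =
      (trig s (fun ξ => 2 * Real.pi * Complex.I * (ξ m : ℂ) * c ξ) x).re := by
  have h := ((contDiff_trig s c (n := 1)).differentiable (by simp) x).hasFDerivAt
  have h2 := Complex.reCLM.hasFDerivAt.comp x h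
  rw [← fderiv_trig]
  exact congrArg (fun L : Space →L[ℝ] ℝ => L (EuclideanSpace.single m 1)) h2.fderiv

lemma norm_le_of_mem_cell {x : Space} (hx : x ∈ cell) : ‖x‖ ≤ 2 := by
  have := dist_le_of_coord (x := x) (y := 0) zero_le_one fun m => by
    have := hx m
    simp only [PiLp.zero_apply, sub_zero]
    rw [abs_le]
    constructor <;> linarith [this.1, this.2]
  simpa using this

/-- Continuous functions belong to every Lebesgue space on the cell. -/
lemma memLp_of_continuous {F : Type*} [NormedAddCommGroup F] [SecondCountableTopology F]
    {f : Space → F} (hf : Continuous f) {p : ℝ≥0∞} : MemLp f p cellMeasure := by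
  obtain ⟨B, hB⟩ := (isCompact_closedBall (0 : Space) 2).exists_bound_of_continuousOn
    hf.continuousOn
  refine MemLp.of_bound hf.aestronglyMeasurable B ?_
  rw [cellMeasure, ae_restrict_iff' isOpen_cell.measurableSet]
  refine Eventually.of_forall fun x hx => hB x ?_
  simpa using norm_le_of_mem_cell hx

lemma integrable_of_continuous {F : Type*} [NormedAddCommGroup F] [SecondCountableTopology F]
    {f : Space → F} (hf : Continuous f) : Integrable f cellMeasure :=
  memLp_one_iff_integrable.mp (memLp_of_continuous hf)

lemma integral_cell {F : Type*} [NormedAddCommGroup F] [NormedSpace ℝ F] (f : Space → F) :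
    ∫ x, f x ∂cellMeasure = ∫ x in Set.Icc (0 : Fin 3 → ℝ) 1, f (WithLp.toLp 2 x) := by
  have h1 := (PiLp.volume_preserving_toLp (Fin 3)).setIntegral_preimage_emb
    (MeasurableEquiv.toLp 2 (Fin 3 → ℝ)).measurableEmbedding f cell
  rw [cellMeasure, ← h1]
  refine setIntegral_congr_set ?_
  have h2 : (WithLp.toLp 2 : (Fin 3 → ℝ) → Space) ⁻¹' cell =
      Set.univ.pi fun i => Set.Ioo ((0 : Fin 3 → ℝ) i) ((1 : Fin 3 → ℝ) i) := by
    ext x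
    simp [cell, Set.mem_pi]
  rw [h2, volume_pi]
  exact Measure.univ_pi_Ioo_ae_eq_Icc

/-- The derivative of a periodic function has mean zero. -/
lemma integral_fderiv_periodic {ψ : Space → ℂ} (hψ : ContDiff ℝ 1 ψ)
    (hper : ∀ x m, ψ (x + EuclideanSpace.single m 1) = ψ x) (m : Fin 3) :
    ∫ x, fderiv ℝ ψ x (EuclideanSpace.single m 1) ∂cellMeasure = 0 := by
  rw [integral_cell]
  let L : (Fin 3 → ℝ) →L[ℝ] Space := (PiLp.continuousLinearEquiv 2 ℝ fun _ : Fin 3 => ℝ).symm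
  have hL : ∀ x, L x = WithLp.toLp 2 x := fun x => rfl
  have hLs : ∀ i, L (Pi.single i 1) = EuclideanSpace.single i 1 := fun i => rfl
  have hd : ∀ x, HasFDerivAt (fun x => ψ (L x)) ((fderiv ℝ ψ (L x)) ∘L L) x := fun x =>
    ((hψ.differentiable (by simp) (L x)).hasFDerivAt).comp x L.hasFDerivAt
  have hcont : Continuous fun x => ψ (L x) := hψ.continuous.comp L.continuous
  have hsum : ∀ x, ∑ i : Fin 3, (if i = m then (fderiv ℝ ψ (L x)) ∘L L else 0) (Pi.single i 1) =
      fderiv ℝ ψ (L x) (EuclideanSpace.single m 1) := by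
    intro x
    rw [Finset.sum_eq_single m]
    · rw [if_pos rfl, ContinuousLinearMap.comp_apply, hLs]
    · intro i _ hi
      simp [hi]
    · simp
  -- Divergence theorem for the field whose only nonzero component is `ψ` in direction `m`; the two
  -- opposite faces cancel by periodicity.
  have key := integral_divergence_of_hasFDerivAt_off_countable' (n := 2) (0 : Fin 3 → ℝ) 1
    zero_le_one (fun i x => if i = m then ψ (L x) else 0)
    (fun i x => if i = m then (fderiv ℝ ψ (L x)) ∘L L else 0) ∅ Set.countable_empty
    (fun i => by
      split_ifs
      · exact hcont.continuousOn
      · exact continuousOn_const)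
    (fun x _ i => by
      split_ifs
      · exact hd x
      · exact hasFDerivAt_const _ _)
    (by
      simp only [hsum]
      refine ContinuousOn.integrableOn_compact isCompact_Icc (Continuous.continuousOn ?_)
      exact ((hψ.continuous_fderiv (by simp)).comp L.continuous).clm_apply continuous_const)
  simp only [hsum] at key
  refine key.trans (Finset.sum_eq_zero fun i _ => ?_)
  split_ifs with hi
  · subst hi
    rw [sub_eq_zero]
    refine integral_congr_ae (Eventually.of_forall fun x => ?_)
    have : Fin.insertNth (α := fun _ => ℝ) i ((1 : Fin 3 → ℝ) i) x =
        Fin.insertNth (α := fun _ => ℝ) i ((0 : Fin 3 → ℝ) i) x + Pi.single i 1 := by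
      ext j
      rcases Fin.eq_self_or_eq_succAbove i j with rfl | ⟨k, rfl⟩ <;> simp
    simp only [this, map_add, hLs, hper]
  · simp

/-! ### Fourier coefficients on the cell -/

/-- The Fourier coefficient of a function on the cell. -/
noncomputable def fourierCell (f : Space → ℂ) (ξ : Fin 3 → ℤ) : ℂ :=
  ∫ x, mode (-ξ) x * f x ∂cellMeasure

lemma integrable_mode_mul (ξ : Fin 3 → ℤ) {f : Space → ℂ} (hf : Integrable f cellMeasure) :
    Integrable (fun x => mode ξ x * f x) cellMeasure :=
  hf.bdd_mul (continuous_mode ξ).aestronglyMeasurable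
    (Eventually.of_forall fun x => (norm_mode ξ x).le)

lemma fourierCell_add {f g : Space → ℂ} (hf : Integrable f cellMeasure)
    (hg : Integrable g cellMeasure) (ξ : Fin 3 → ℤ) :
    fourierCell (fun x => f x + g x) ξ = fourierCell f ξ + fourierCell g ξ := by
  simp only [fourierCell, mul_add]
  exact integral_add (integrable_mode_mul _ hf) (integrable_mode_mul _ hg)

lemma fourierCell_sub {f g : Space → ℂ} (hf : Integrable f cellMeasure)
    (hg : Integrable g cellMeasure) (ξ : Fin 3 → ℤ) :
    fourierCell (fun x => f x - g x) ξ = fourierCell f ξ - fourierCell g ξ := by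
  simp only [fourierCell, mul_sub]
  exact integral_sub (integrable_mode_mul _ hf) (integrable_mode_mul _ hg)

lemma fourierCell_const_mul (c : ℂ) (f : Space → ℂ) (ξ : Fin 3 → ℤ) :
    fourierCell (fun x => c * f x) ξ = c * fourierCell f ξ := by
  simp only [fourierCell, ← integral_const_mul]
  exact integral_congr_ae (Eventually.of_forall fun x => by ring)

lemma fourierCell_congr {f g : Space → ℂ} (h : f =ᵐ[cellMeasure] g) (ξ : Fin 3 → ℤ) :
    fourierCell f ξ = fourierCell g ξ :=
  integral_congr_ae (h.mono fun x hx => by simp only [hx])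

lemma fourierCell_zero (f : Space → ℂ) : fourierCell f 0 = ∫ x, f x ∂cellMeasure := by
  simp [fourierCell]

/-- A nonconstant mode is a nonzero multiple of its own derivative in a direction with `ξ m ≠ 0`,
and that derivative has mean zero. -/
lemma integral_mode (ξ : Fin 3 → ℤ) :
    ∫ x, mode ξ x ∂cellMeasure = if ξ = 0 then 1 else 0 := by
  split_ifs with h
  · simp [h]
  · obtain ⟨m, hm⟩ := Function.ne_iff.mp h
    have h1 := integral_fderiv_periodic (contDiff_mode ξ) (mode_periodic ξ) m
    have h2 : ∀ x, fderiv ℝ (mode ξ) x (EuclideanSpace.single m 1) =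
        2 * Real.pi * Complex.I * (ξ m : ℂ) * mode ξ x := by
      intro x
      rw [(hasFDerivAt_mode ξ x).fderiv, smul_apply, phase_single, smul_eq_mul,
        mul_comm]
    simp only [h2, integral_const_mul] at h1
    refine (mul_eq_zero.mp h1).resolve_left ?_
    exact mul_ne_zero Complex.two_pi_I_ne_zero (by exact_mod_cast hm)

lemma fourierCell_trig (s : Finset (Fin 3 → ℤ)) (c : (Fin 3 → ℤ) → ℂ) (η : Fin 3 → ℤ) :
    fourierCell (trig s c) η = if η ∈ s then c η else 0 := by
  have h1 : ∀ x, mode (-η) x * trig s c x = ∑ ξ ∈ s, c ξ * mode (ξ - η) x := by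
    intro x
    rw [trig, Finset.mul_sum]
    refine Finset.sum_congr rfl fun ξ _ => ?_
    rw [sub_eq_add_neg, mode_add]
    ring
  simp only [fourierCell, h1]
  rw [integral_finsetSum _ fun ξ _ => (integrable_of_continuous (continuous_mode _)).const_mul _]
  simp only [integral_const_mul, integral_mode, sub_eq_zero, mul_ite, mul_one, mul_zero]
  rw [Finset.sum_ite_eq']

/-! ### Parseval's identity, transferred from the torus -/

section Torus

noncomputable local instance : MeasureSpace UnitAddCircle := ⟨AddCircle.haarAddCircle⟩

/-- The representative in the cell of a point of the torus. -/
noncomputable def torusRep (y : UnitAddTorus (Fin 3)) : Space :=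
  WithLp.toLp 2 (UnitAddTorus.measurableEquivPiIoc (fun _ => (0 : ℝ)) y).1

/-- The representatives fill the half-open cube, which differs from the open cell by a null set. -/
lemma measurePreserving_torusRep :
    MeasurePreserving torusRep (volume : Measure (UnitAddTorus (Fin 3))) cellMeasure := by
  have hm : MeasurableSet {x : Fin 3 → ℝ | ∀ i, x i ∈ Set.Ioc (0 : ℝ) (0 + 1)} :=
    MeasurableSet.univ_pi' fun i => measurableSet_Ioc
  have h1 := UnitAddTorus.measurePreserving_equivPiIoc (fun _ : Fin 3 => (0 : ℝ))
  have h2 := measurePreserving_subtype_coe (μa := (volume : Measure (Fin 3 → ℝ))) hm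
  have h3 := (PiLp.volume_preserving_toLp (Fin 3)).restrict_preimage isOpen_cell.measurableSet
  have h4 : ((WithLp.toLp 2 : (Fin 3 → ℝ) → Space) ⁻¹' cell : Set (Fin 3 → ℝ)) =ᵐ[volume]
      {x : Fin 3 → ℝ | ∀ i, x i ∈ Set.Ioc (0 : ℝ) (0 + 1)} := by
    have e1 : (WithLp.toLp 2 : (Fin 3 → ℝ) → Space) ⁻¹' cell =
        Set.univ.pi fun _ => Set.Ioo (0 : ℝ) 1 := by
      ext x
      simp [cell, Set.mem_pi]
    have e2 : {x : Fin 3 → ℝ | ∀ i, x i ∈ Set.Ioc (0 : ℝ) (0 + 1)} =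
        Set.univ.pi fun _ => Set.Ioc (0 : ℝ) 1 := by
      ext x
      simp [Set.mem_pi]
    rw [e1, e2, volume_pi]
    exact (Measure.univ_pi_Ioo_ae_eq_Icc (f := fun _ => (0 : ℝ)) (g := fun _ => 1)).trans
      (Measure.univ_pi_Ioc_ae_eq_Icc (f := fun _ => (0 : ℝ)) (g := fun _ => 1)).symm
  rw [Measure.restrict_congr_set h4] at h3
  exact h3.comp (h2.comp h1)

lemma mode_torusRep (ξ : Fin 3 → ℤ) (y : UnitAddTorus (Fin 3)) :
    mode ξ (torusRep y) = UnitAddTorus.mFourier ξ y := by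
  have h : ∀ i, ((torusRep y i : ℝ) : UnitAddCircle) = y i := fun i =>
    congrFun ((UnitAddTorus.measurableEquivPiIoc fun _ : Fin 3 => (0 : ℝ)).symm_apply_apply y) i
  rw [mode_eq_prod]
  simp only [UnitAddTorus.mFourier, ContinuousMap.coe_mk]
  refine Finset.prod_congr rfl fun i _ => ?_
  rw [← h i, fourier_coe_apply]
  congr 1
  push_cast
  ring

lemma mFourierCoeff_comp_torusRep {f : Space → ℂ} (hf : MemLp f 2 cellMeasure) (ξ : Fin 3 → ℤ) :
    UnitAddTorus.mFourierCoeff (fun y => f (torusRep y)) ξ = fourierCell f ξ := by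
  have hm : AEStronglyMeasurable (fun x => mode (-ξ) x * f x) cellMeasure :=
    (continuous_mode _).aestronglyMeasurable.mul hf.1
  rw [fourierCell, ← measurePreserving_torusRep.map_eq] at *
  rw [integral_map measurePreserving_torusRep.measurable.aemeasurable hm]
  simp only [UnitAddTorus.mFourierCoeff, mode_torusRep, smul_eq_mul]

/-- Parseval's identity on the cell. -/
lemma hasSum_sq_fourierCell {f : Space → ℂ} (hf : MemLp f 2 cellMeasure) :
    HasSum (fun ξ => ‖fourierCell f ξ‖ ^ 2) (∫ x, ‖f x‖ ^ 2 ∂cellMeasure) := by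
  have hg := hf.comp_measurePreserving measurePreserving_torusRep
  have h1 := UnitAddTorus.hasSum_sq_mFourierCoeff (hg.toLp _)
  have h2 : ∀ ξ, UnitAddTorus.mFourierCoeff (hg.toLp _) ξ = fourierCell f ξ := by
    intro ξ
    rw [← mFourierCoeff_comp_torusRep hf]
    exact integral_congr_ae (hg.coeFn_toLp.mono fun y hy => by simp only [hy, Function.comp])
  have h3 : ∫ t, ‖(hg.toLp _ : _ → ℂ) t‖ ^ 2 = ∫ x, ‖f x‖ ^ 2 ∂cellMeasure := by
    have e := integral_map (μ := (volume : Measure (UnitAddTorus (Fin 3)))) (φ := torusRep)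
      measurePreserving_torusRep.measurable.aemeasurable (f := fun x => ‖f x‖ ^ 2)
      (by rw [measurePreserving_torusRep.map_eq]; exact hf.1.norm.pow 2)
    rw [measurePreserving_torusRep.map_eq] at e
    rw [e]
    exact integral_congr_ae (hg.coeFn_toLp.mono fun y hy => by simp only [hy, Function.comp])
  simpa only [h2, h3] using h1

end Torus

lemma integrable_of_memLp {f : Space → ℂ} (hf : MemLp f 2 cellMeasure) : Integrable f cellMeasure :=
  hf.integrable one_le_two

/-- The truncated Fourier series converges in the mean square. -/
lemma tendsto_fourier_truncation {f : Space → ℂ} (hf : MemLp f 2 cellMeasure) :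
    Tendsto (fun s => ∫ x, ‖f x - trig s (fourierCell f) x‖ ^ 2 ∂cellMeasure) atTop (𝓝 0) := by
  have h := hasSum_sq_fourierCell hf
  -- Parseval for the remainder, whose coefficients are those of `f` outside `s` and zero inside.
  have h1 : ∀ s, ∫ x, ‖f x - trig s (fourierCell f) x‖ ^ 2 ∂cellMeasure =
      ∫ x, ‖f x‖ ^ 2 ∂cellMeasure - ∑ ξ ∈ s, ‖fourierCell f ξ‖ ^ 2 := by
    intro s
    have hs : MemLp (trig s (fourierCell f)) 2 cellMeasure := memLp_of_continuous (continuous_trig _ _)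
    have e1 := hasSum_sq_fourierCell (hf.sub hs)
    have e2 : HasSum (fun ξ => if ξ ∈ s then ‖fourierCell f ξ‖ ^ 2 else 0)
        (∑ ξ ∈ s, ‖fourierCell f ξ‖ ^ 2) := by
      have : HasSum (fun ξ => if ξ ∈ s then ‖fourierCell f ξ‖ ^ 2 else 0)
          (∑ ξ ∈ s, if ξ ∈ s then ‖fourierCell f ξ‖ ^ 2 else 0) :=
        hasSum_sum_of_ne_finset_zero fun b hb => if_neg hb
      rwa [Finset.sum_congr rfl fun ξ hξ => if_pos hξ] at this
    refine e1.unique ((h.sub e2).congr_fun ?_)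
    intro ξ
    have e3 := fourierCell_sub (integrable_of_memLp hf) (integrable_of_memLp hs) ξ
    rw [fourierCell_trig] at e3
    have e4 : fourierCell (f - trig s (fourierCell f)) ξ = _ := e3
    rw [e4]
    split_ifs <;> simp
  simp only [h1]
  have := (tendsto_const_nhds (x := ∫ x, ‖f x‖ ^ 2 ∂cellMeasure)).sub h
  rwa [sub_self] at this

/-! ### The periodic Sobolev space in terms of Fourier coefficients -/

/-- The Fourier coefficient of a real function on the cell. -/
noncomputable def coeff (f : Space → ℝ) (ξ : Fin 3 → ℤ) : ℂ := fourierCell (fun x => (f x : ℂ)) ξ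

lemma memLp_ofReal {f : Space → ℝ} (hf : MemLp f 2 cellMeasure) :
    MemLp (fun x => (f x : ℂ)) 2 cellMeasure := hf.ofReal

lemma coeff_add {f g : Space → ℝ} (hf : MemLp f 2 cellMeasure) (hg : MemLp g 2 cellMeasure)
    (ξ : Fin 3 → ℤ) : coeff (fun x => f x + g x) ξ = coeff f ξ + coeff g ξ := by
  simp only [coeff, Complex.ofReal_add]
  exact fourierCell_add (integrable_of_memLp (memLp_ofReal hf))
    (integrable_of_memLp (memLp_ofReal hg)) ξ

lemma coeff_sub {f g : Space → ℝ} (hf : MemLp f 2 cellMeasure) (hg : MemLp g 2 cellMeasure)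
    (ξ : Fin 3 → ℤ) : coeff (fun x => f x - g x) ξ = coeff f ξ - coeff g ξ := by
  simp only [coeff, Complex.ofReal_sub]
  exact fourierCell_sub (integrable_of_memLp (memLp_ofReal hf))
    (integrable_of_memLp (memLp_ofReal hg)) ξ

lemma coeff_const_mul (c : ℝ) (f : Space → ℝ) (ξ : Fin 3 → ℤ) :
    coeff (fun x => c * f x) ξ = c * coeff f ξ := by
  simp only [coeff, Complex.ofReal_mul]
  exact fourierCell_const_mul _ _ ξ

lemma coeff_const (c : ℝ) (ξ : Fin 3 → ℤ) : coeff (fun _ => c) ξ = if ξ = 0 then (c : ℂ) else 0 := by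
  have := fourierCell_trig {0} (fun _ => (c : ℂ)) ξ
  have h : trig {0} (fun _ => (c : ℂ)) = fun _ => (c : ℂ) := by
    funext x
    simp [trig]
  rw [h] at this
  simpa [coeff] using this

lemma coeff_congr {f g : Space → ℝ} (h : f =ᵐ[cellMeasure] g) (ξ : Fin 3 → ℤ) :
    coeff f ξ = coeff g ξ :=
  fourierCell_congr (h.mono fun x hx => by simp only [hx]) ξ

lemma coeff_zero (f : Space → ℝ) : coeff f 0 = ((∫ x, f x ∂cellMeasure : ℝ) : ℂ) := by
  rw [coeff, fourierCell_zero]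
  exact integral_ofReal

lemma hasSum_sq_coeff {f : Space → ℝ} (hf : MemLp f 2 cellMeasure) :
    HasSum (fun ξ => ‖coeff f ξ‖ ^ 2) (∫ x, f x ^ 2 ∂cellMeasure) := by
  have := hasSum_sq_fourierCell (memLp_ofReal hf)
  simp only [Complex.norm_real, Real.norm_eq_abs, sq_abs] at this
  exact this

/-- Integration by parts for a smooth periodic function. -/
lemma coeff_partialDeriv {φ : Space → ℝ} (hφ : IsSmoothPeriodic φ) (m : Fin 3) (ξ : Fin 3 → ℤ) :
    coeff (partialDeriv m φ) ξ = 2 * Real.pi * Complex.I * (ξ m : ℂ) * coeff φ ξ := by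
  have hφ1 : ContDiff ℝ 1 φ := hφ.1.of_le (by exact_mod_cast le_top)
  have hψ : ContDiff ℝ 1 fun x => mode (-ξ) x * (φ x : ℂ) :=
    (contDiff_mode _).mul (Complex.ofRealCLM.contDiff.comp hφ1)
  have h1 := integral_fderiv_periodic hψ (fun x m => by rw [mode_periodic, hφ.2]) m
  have h2 : ∀ x, fderiv ℝ (fun x => mode (-ξ) x * (φ x : ℂ)) x (EuclideanSpace.single m 1) =
      mode (-ξ) x * (partialDeriv m φ x : ℂ) -
        2 * Real.pi * Complex.I * (ξ m : ℂ) * (mode (-ξ) x * (φ x : ℂ)) := by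
    intro x
    have hd := (hφ1.differentiable (by simp) x).hasFDerivAt
    have hd2 : HasFDerivAt (fun x => (φ x : ℂ)) (Complex.ofRealCLM ∘L fderiv ℝ φ x) x :=
      Complex.ofRealCLM.hasFDerivAt.comp x hd
    rw [((hasFDerivAt_mode (-ξ) x).fun_mul hd2).fderiv]
    simp only [add_apply, smul_apply, ContinuousLinearMap.comp_apply, phase_single, smul_eq_mul,
      Complex.ofRealCLM_apply, partialDeriv, Pi.neg_apply, Int.cast_neg]
    ring
  have hc1 : Continuous fun x => mode (-ξ) x * (partialDeriv m φ x : ℂ) := by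
    refine (continuous_mode _).mul (Complex.continuous_ofReal.comp ?_)
    exact (hφ1.continuous_fderiv (by simp)).clm_apply continuous_const
  have hc2 : Continuous fun x => mode (-ξ) x * (φ x : ℂ) :=
    (continuous_mode _).mul (Complex.continuous_ofReal.comp hφ.1.continuous)
  simp only [h2] at h1
  rw [integral_sub (integrable_of_continuous hc1) ((integrable_of_continuous hc2).const_mul _),
    integral_const_mul, sub_eq_zero] at h1
  exact h1

lemma memLp_smooth {φ : Space → ℝ} (hφ : IsSmoothPeriodic φ) : MemLp φ 2 cellMeasure :=
  memLp_of_continuous hφ.1.continuous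

lemma memLp_partialDeriv {φ : Space → ℝ} (hφ : IsSmoothPeriodic φ) (m : Fin 3) :
    MemLp (partialDeriv m φ) 2 cellMeasure :=
  memLp_of_continuous ((hφ.1.continuous_fderiv (by simp)).clm_apply continuous_const)

/-- Modes have modulus one and the cell has mass one, so the `L¹` and then the `L²` norm bounds the
coefficient. -/
lemma enorm_coeff_le {f : Space → ℝ} (hf : AEStronglyMeasurable f cellMeasure) (ξ : Fin 3 → ℤ) :
    ‖coeff f ξ‖ₑ ≤ eLpNorm f 2 cellMeasure := by
  calc ‖coeff f ξ‖ₑ ≤ ∫⁻ x, ‖mode (-ξ) x * (f x : ℂ)‖ₑ ∂cellMeasure :=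
        enorm_integral_le_lintegral_enorm _
    _ = eLpNorm f 1 cellMeasure := by
        rw [eLpNorm_one_eq_lintegral_enorm]
        refine lintegral_congr fun x => ?_
        rw [← ofReal_norm, ← ofReal_norm, norm_mul, norm_mode, one_mul, Complex.norm_real]
    _ ≤ _ := eLpNorm_le_eLpNorm_of_exponent_le one_le_two hf

lemma tendsto_coeff {φ : ℕ → Space → ℝ} {f : Space → ℝ} (hφ : ∀ k, MemLp (φ k) 2 cellMeasure)
    (hf : MemLp f 2 cellMeasure)
    (h : Tendsto (fun k => eLpNorm (fun x => φ k x - f x) 2 cellMeasure) atTop (𝓝 0))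
    (ξ : Fin 3 → ℤ) : Tendsto (fun k => coeff (φ k) ξ) atTop (𝓝 (coeff f ξ)) := by
  rw [tendsto_iff_edist_tendsto_0]
  refine tendsto_of_tendsto_of_tendsto_of_le_of_le tendsto_const_nhds h (fun _ => zero_le) ?_
  intro k
  simp only [edist_eq_enorm_sub]
  rw [← coeff_sub (hφ k) hf]
  exact enorm_coeff_le ((hφ k).sub hf).1 ξ

/-- The sets `s k` need not be symmetric about zero, so the truncations may be complex; as `f` is
real, passing to the real part does not increase the error. -/
lemma tendsto_eLpNorm_re_trig {f : Space → ℝ} (hf : MemLp f 2 cellMeasure)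
    {s : ℕ → Finset (Fin 3 → ℤ)} (hs : Tendsto s atTop atTop) :
    Tendsto (fun k => eLpNorm (fun x => (trig (s k) (coeff f) x).re - f x) 2 cellMeasure)
      atTop (𝓝 0) := by
  have h1 := (tendsto_fourier_truncation (memLp_ofReal hf)).comp hs
  have hm : ∀ k, MemLp (fun x => (f x : ℂ) - trig (s k) (coeff f) x) 2 cellMeasure := fun k =>
    (memLp_ofReal hf).sub (memLp_of_continuous (continuous_trig _ _))
  have h2 : Tendsto (fun k => eLpNorm (fun x => (f x : ℂ) - trig (s k) (coeff f) x) 2 cellMeasure)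
      atTop (𝓝 0) := by
    have e : ∀ k, eLpNorm (fun x => (f x : ℂ) - trig (s k) (coeff f) x) 2 cellMeasure =
        ENNReal.ofReal (Real.sqrt (∫ x, ‖(f x : ℂ) - trig (s k) (coeff f) x‖ ^ 2
          ∂cellMeasure)) := by
      intro k
      rw [(hm k).eLpNorm_eq_integral_rpow_norm (by simp) (by simp), Real.sqrt_eq_rpow]
      simp
    simp only [e]
    have h3 : Tendsto (fun k => Real.sqrt (∫ x, ‖(f x : ℂ) - trig (s k) (coeff f) x‖ ^ 2
          ∂cellMeasure)) atTop (𝓝 (Real.sqrt 0)) :=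
      (Real.continuous_sqrt.tendsto 0).comp h1
    rw [Real.sqrt_zero] at h3
    have := (ENNReal.continuous_ofReal.tendsto 0).comp h3
    rwa [ENNReal.ofReal_zero] at this
  refine tendsto_of_tendsto_of_tendsto_of_le_of_le tendsto_const_nhds h2 (fun _ => zero_le) ?_
  intro k
  refine eLpNorm_mono fun x => ?_
  rw [norm_sub_rev ((f x : ℂ))]
  have := Complex.abs_re_le_norm (trig (s k) (coeff f) x - (f x : ℂ))
  simpa using this

/-- The periodic Sobolev space consists of the square-integrable functions whose gradient, in terms
of Fourier coefficients, is square-integrable. -/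
lemma memH1Per_iff {f : Space → ℝ} {g : Fin 3 → Space → ℝ} :
    MemH1Per f g ↔ MemLp f 2 cellMeasure ∧ (∀ m, MemLp (g m) 2 cellMeasure) ∧
      ∀ ξ m, coeff (g m) ξ = 2 * Real.pi * Complex.I * (ξ m : ℂ) * coeff f ξ := by
  constructor
  · rintro ⟨hf, hg, φ, hφ, h1, h2⟩
    refine ⟨hf, hg, fun ξ m => ?_⟩
    -- The relation holds for the smooth approximants by parts, and both sides pass to the limit in
    -- `L²`.
    have t1 := tendsto_coeff (fun k => memLp_partialDeriv (hφ k) m) (hg m) (h2 m) ξ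
    have t2 := (tendsto_coeff (fun k => memLp_smooth (hφ k)) hf h1 ξ).const_mul
      (2 * Real.pi * Complex.I * (ξ m : ℂ))
    simp only [coeff_partialDeriv (hφ _)] at t1
    exact tendsto_nhds_unique t1 t2
  · rintro ⟨hf, hg, h⟩
    -- One sequence of truncations serves `f` and its partial derivatives: differentiating the
    -- truncation of `f` gives the truncation of `g m`.
    obtain ⟨s, hs⟩ := exists_seq_tendsto (atTop : Filter (Finset (Fin 3 → ℤ)))
    refine ⟨hf, hg, fun k x => (trig (s k) (coeff f) x).re,
      fun k => isSmoothPeriodic_re_trig _ _, tendsto_eLpNorm_re_trig hf hs, fun m => ?_⟩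
    have e := tendsto_eLpNorm_re_trig (hg m) hs
    have hc : coeff (g m) = fun ξ => 2 * Real.pi * Complex.I * (ξ m : ℂ) * coeff f ξ :=
      funext fun ξ => h ξ m
    simp only [partialDeriv_re_trig]
    rwa [hc] at e

lemma memH1Per_re_trig (s : Finset (Fin 3 → ℤ)) (c : (Fin 3 → ℤ) → ℂ) :
    MemH1Per (fun x => (trig s c x).re) fun m x =>
      (trig s (fun ξ => 2 * Real.pi * Complex.I * (ξ m : ℂ) * c ξ) x).re := by
  have h := isSmoothPeriodic_re_trig s c
  refine ⟨memLp_smooth h, fun m => ?_, fun _ => fun x => (trig s c x).re, fun _ => h, ?_,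
    fun m => ?_⟩
  · simpa only [← partialDeriv_re_trig] using memLp_partialDeriv h m
  · simp
  · simp [partialDeriv_re_trig]

/-! ### Inequalities of Poincaré and Korn -/

/-- The squared norm of the symmetrised product of `ξ` and `u` is `(|ξ|² |u|² + |ξ · u|²) / 2`,
which gives Korn with constant `2`. A nonzero integer frequency has `|ξ| ≥ 1`, which gives Poincaré;
as `(2π)² ≥ 1`, both together cost at most `4`. -/
lemma korn_pointwise (ξ : Fin 3 → ℤ) (u : Fin 3 → ℂ) (h0 : ξ = 0 → u = 0) :
    ∑ n, ‖u n‖ ^ 2 + ∑ m, ∑ n, ‖2 * Real.pi * Complex.I * (ξ m : ℂ) * u n‖ ^ 2 ≤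
      4 * ∑ m, ∑ n, ‖(2 * Real.pi * Complex.I * (ξ m : ℂ) * u n +
        2 * Real.pi * Complex.I * (ξ n : ℂ) * u m) / 2‖ ^ 2 := by
  by_cases hξ : ξ = 0
  · simp [h0 hξ, hξ]
  have hnorm : ‖(2 * Real.pi * Complex.I : ℂ)‖ = 2 * Real.pi := by
    simp [abs_of_pos Real.pi_pos]
  have e1 : ∀ m n, ‖2 * Real.pi * Complex.I * (ξ m : ℂ) * u n‖ ^ 2 =
      (2 * Real.pi) ^ 2 * ‖(ξ m : ℂ) * u n‖ ^ 2 := by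
    intro m n
    rw [mul_assoc (2 * Real.pi * Complex.I : ℂ), norm_mul, hnorm, mul_pow]
  have e2 : ∀ m n, ‖(2 * Real.pi * Complex.I * (ξ m : ℂ) * u n +
        2 * Real.pi * Complex.I * (ξ n : ℂ) * u m) / 2‖ ^ 2 =
      (2 * Real.pi) ^ 2 * ‖((ξ m : ℂ) * u n + (ξ n : ℂ) * u m) / 2‖ ^ 2 := by
    intro m n
    rw [← mul_pow, ← hnorm, ← norm_mul]
    congr 2
    ring
  simp only [e1, e2, ← Finset.mul_sum]
  have hk : ∑ m, ∑ n, ‖(ξ m : ℂ) * u n‖ ^ 2 ≤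
      2 * ∑ m, ∑ n, ‖((ξ m : ℂ) * u n + (ξ n : ℂ) * u m) / 2‖ ^ 2 := by
    simp only [Complex.sq_norm, Complex.normSq_apply, Complex.mul_re, Complex.mul_im,
      Complex.add_re, Complex.add_im, Complex.intCast_re, Complex.intCast_im, zero_mul, sub_zero,
      add_zero, Complex.div_ofNat_re, Complex.div_ofNat_im, Fin.sum_univ_three]
    -- The hints are the two parts of `|ξ · u|²`, the surplus in the identity above.
    nlinarith [sq_nonneg ((ξ 0 : ℝ) * (u 0).re + ξ 1 * (u 1).re + ξ 2 * (u 2).re),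
      sq_nonneg ((ξ 0 : ℝ) * (u 0).im + ξ 1 * (u 1).im + ξ 2 * (u 2).im)]
  have hp : ∑ n, ‖u n‖ ^ 2 ≤ ∑ m, ∑ n, ‖(ξ m : ℂ) * u n‖ ^ 2 := by
    obtain ⟨m, hm⟩ := Function.ne_iff.mp hξ
    refine le_trans ?_ (Finset.single_le_sum (f := fun m => ∑ n, ‖(ξ m : ℂ) * u n‖ ^ 2)
      (fun m _ => Finset.sum_nonneg fun _ _ => by positivity) (Finset.mem_univ m))
    refine Finset.sum_le_sum fun n _ => ?_
    rw [norm_mul, mul_pow]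
    have h1 : (1 : ℝ) ≤ ‖(ξ m : ℂ)‖ := by
      rw [Complex.norm_intCast]
      exact_mod_cast Int.one_le_abs hm
    nlinarith [sq_nonneg ‖u n‖, one_le_pow₀ h1 (n := 2)]
  have hpi : (1 : ℝ) ≤ (2 * Real.pi) ^ 2 := one_le_pow₀ (by linarith [Real.pi_gt_three])
  set X := ∑ m, ∑ n, ‖(ξ m : ℂ) * u n‖ ^ 2
  have hX : 0 ≤ X := Finset.sum_nonneg fun _ _ => Finset.sum_nonneg fun _ _ => by positivity
  nlinarith

/-- Korn's inequality, together with Poincaré's, for periodic fields of mean zero. -/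
lemma korn {u : Space → Fin 3 → ℝ} {G : Space → Mat ℝ} (h : MemH1PerVec u G)
    (h0 : ∀ n, ∫ x, u x n ∂cellMeasure = 0) :
    ∑ n, ∫ x, u x n ^ 2 ∂cellMeasure + ∑ m, ∑ n, ∫ x, G x m n ^ 2 ∂cellMeasure ≤
      4 * ∑ m, ∑ n, ∫ x, symPart (G x) m n ^ 2 ∂cellMeasure := by
  have h' := fun n => memH1Per_iff.mp (h n)
  have hu := fun n => (h' n).1
  have hG : ∀ m n, MemLp (fun x => G x m n) 2 cellMeasure := fun m n => (h' n).2.1 m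
  have hs : ∀ m n, (fun x => symPart (G x) m n) = fun x => 2⁻¹ * (G x m n + G x n m) := by
    intro m n
    funext x
    simp only [symPart, Matrix.of_apply]
    ring
  have hS : ∀ m n, MemLp (fun x => symPart (G x) m n) 2 cellMeasure := by
    intro m n
    rw [hs]
    exact ((hG m n).add (hG n m)).const_mul _
  have hc : ∀ m n ξ, coeff (fun x => symPart (G x) m n) ξ =
      (2 * Real.pi * Complex.I * (ξ m : ℂ) * coeff (fun x => u x n) ξ +
        2 * Real.pi * Complex.I * (ξ n : ℂ) * coeff (fun x => u x m) ξ) / 2 := by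
    intro m n ξ
    rw [hs, coeff_const_mul, coeff_add (hG m n) (hG n m), (h' n).2.2 ξ m, (h' m).2.2 ξ n]
    push_cast
    ring
  have s1 := hasSum_sum fun n (_ : n ∈ Finset.univ) => hasSum_sq_coeff (hu n)
  have s2 := hasSum_sum fun m (_ : m ∈ Finset.univ) =>
    hasSum_sum fun n (_ : n ∈ Finset.univ) => hasSum_sq_coeff (hG m n)
  have s3 := (hasSum_sum fun m (_ : m ∈ Finset.univ) =>
    hasSum_sum fun n (_ : n ∈ Finset.univ) => hasSum_sq_coeff (hS m n)).mul_left 4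
  refine hasSum_le (fun ξ => ?_) (s1.add s2) s3
  have := korn_pointwise ξ (fun n => coeff (fun x => u x n) ξ) (by
    rintro rfl
    funext n
    rw [coeff_zero, h0]
    simp)
  simp only [hc]
  have e : ∀ m n, coeff (fun x => G x m n) ξ =
      2 * Real.pi * Complex.I * (ξ m : ℂ) * coeff (fun x => u x n) ξ := fun m n => (h' n).2.2 ξ m
  simp only [e]
  exact this

/-! ### The cell problem -/

section Work

variable {M : ℕ} {D : Fin (M + 1) → Set Space} {Λ : Fin (M + 1) → Tensor ℝ}
  {C : Space → Tensor ℝ}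

/-- The integrand of the work of two matrix fields, as a sum over the subdomains and the entries. -/
lemma AssumptionA.frob_ddot_ae (hA : AssumptionA D Λ C) (F H : Space → Mat ℝ) :
    (fun x => frob (F x) (ddot (C x) (H x))) =ᵐ[cellMeasure] fun x =>
      ∑ k : Fin (M + 1) × Fin 3 × Fin 3 × Fin 3 × Fin 3,
        Λ k.1 k.2.1 k.2.2.1 k.2.2.2.1 k.2.2.2.2 *
          (D k.1).indicator (fun x => F x k.2.1 k.2.2.1 * H x k.2.2.2.1 k.2.2.2.2) x := by
  filter_upwards [hA.ae_mem] with x hx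
  obtain ⟨l, hl⟩ := hx
  simp only [Fintype.sum_prod_type]
  rw [Finset.sum_eq_single l]
  · simp only [Set.indicator_of_mem hl, hA.const l x hl, frob, ddot_apply, Finset.mul_sum]
    refine Finset.sum_congr rfl fun m _ => Finset.sum_congr rfl fun n _ =>
      Finset.sum_congr rfl fun p _ => Finset.sum_congr rfl fun q _ => by ring
  · intro l' _ hl'
    have : x ∉ D l' := fun h => Set.disjoint_left.mp (hA.disjoint l' l hl') h hl
    simp [Set.indicator_of_notMem this]
  · simp

lemma integrable_indicator_mul (hA : AssumptionA D Λ C) {f g : Space → ℝ}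
    (hf : MemLp f 2 cellMeasure) (hg : MemLp g 2 cellMeasure) (l : Fin (M + 1)) :
    Integrable ((D l).indicator fun x => f x * g x) cellMeasure :=
  (hf.integrable_mul hg).indicator (hA.lipschitz l).1.measurableSet

/-- `C` is not assumed measurable and is arbitrary off the subdomains; measurability comes from the
almost everywhere expansion over the `D l`. -/
lemma AssumptionA.integrable_frob_ddot (hA : AssumptionA D Λ C) {F H : Space → Mat ℝ}
    (hF : ∀ m n, MemLp (fun x => F x m n) 2 cellMeasure)
    (hH : ∀ m n, MemLp (fun x => H x m n) 2 cellMeasure) :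
    Integrable (fun x => frob (F x) (ddot (C x) (H x))) cellMeasure := by
  refine Integrable.congr ?_ (hA.frob_ddot_ae F H).symm
  exact integrable_finsetSum _ fun k _ =>
    (integrable_indicator_mul hA (hF _ _) (hH _ _) _).const_mul _

/-- A finite combination of `L²` pairings over the subdomains; `energyForm` and `loadForm` are
assembled from exactly these terms. -/
lemma AssumptionA.integral_frob_ddot (hA : AssumptionA D Λ C) {F H : Space → Mat ℝ}
    (hF : ∀ m n, MemLp (fun x => F x m n) 2 cellMeasure)
    (hH : ∀ m n, MemLp (fun x => H x m n) 2 cellMeasure) :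
    ∫ x, frob (F x) (ddot (C x) (H x)) ∂cellMeasure =
      ∑ k : Fin (M + 1) × Fin 3 × Fin 3 × Fin 3 × Fin 3,
        Λ k.1 k.2.1 k.2.2.1 k.2.2.2.1 k.2.2.2.2 *
          ∫ x in D k.1, F x k.2.1 k.2.2.1 * H x k.2.2.2.1 k.2.2.2.2 ∂cellMeasure := by
  rw [integral_congr_ae (hA.frob_ddot_ae F H), integral_finsetSum _ fun k _ =>
    (integrable_indicator_mul hA (hF _ _) (hH _ _) _).const_mul _]
  refine Finset.sum_congr rfl fun k _ => ?_
  rw [integral_const_mul, integral_indicator (hA.lipschitz _).1.measurableSet]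

lemma AssumptionA.memLp_ddot (hA : AssumptionA D Λ C) {F : Space → Mat ℝ}
    (hF : ∀ m n, MemLp (fun x => F x m n) 2 cellMeasure) (m n : Fin 3) :
    MemLp (fun x => ddot (C x) (F x) m n) 2 cellMeasure := by
  have h : (fun x => ∑ k : Fin (M + 1) × Fin 3 × Fin 3, Λ k.1 m n k.2.1 k.2.2 *
      (D k.1).indicator (fun x => F x k.2.1 k.2.2) x) =ᵐ[cellMeasure]
      fun x => ddot (C x) (F x) m n := by
    filter_upwards [hA.ae_mem] with x hx
    obtain ⟨l, hl⟩ := hx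
    simp only [Fintype.sum_prod_type]
    rw [Finset.sum_eq_single l]
    · simp only [Set.indicator_of_mem hl, hA.const l x hl, ddot_apply]
    · intro l' _ hl'
      have : x ∉ D l' := fun h => Set.disjoint_left.mp (hA.disjoint l' l hl') h hl
      simp [Set.indicator_of_notMem this]
    · simp
  refine MemLp.ae_eq h (memLp_finsetSum _ fun k _ => MemLp.const_mul ?_ _)
  exact (hF _ _).indicator (hA.lipschitz _).1.measurableSet

lemma memLp_symPart {G : Space → Mat ℝ} (hG : ∀ m n, MemLp (fun x => G x m n) 2 cellMeasure)
    (m n : Fin 3) : MemLp (fun x => symPart (G x) m n) 2 cellMeasure := by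
  have hs : (fun x => symPart (G x) m n) = fun x => 2⁻¹ * (G x m n + G x n m) := by
    funext x
    simp only [symPart, Matrix.of_apply]
    ring
  rw [hs]
  exact ((hG m n).add (hG n m)).const_mul _

lemma MemH1PerVec.memLp {u : Space → Fin 3 → ℝ} {G : Space → Mat ℝ} (h : MemH1PerVec u G)
    (m n : Fin 3) : MemLp (fun x => G x m n) 2 cellMeasure := (h n).2.1 m

lemma frob_self_eq (F : Mat ℝ) : frob F F = ∑ m, ∑ n, F m n ^ 2 := by
  simp only [frob, sq]

/-- The work of a symmetric field bounds its mean square. -/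
lemma AssumptionA.coercive (hA : AssumptionA D Λ C) {a : ℝ}
    (ha : ∀ F : Mat ℝ, F.IsSymm → ∀ l, a * frob F F ≤ frob F (ddot (Λ l) F))
    {S : Space → Mat ℝ} (hS : ∀ m n, MemLp (fun x => S x m n) 2 cellMeasure)
    (hsym : ∀ x, (S x).IsSymm) :
    a * ∑ m, ∑ n, ∫ x, S x m n ^ 2 ∂cellMeasure ≤
      ∫ x, frob (S x) (ddot (C x) (S x)) ∂cellMeasure := by
  have hi : ∀ m n, Integrable (fun x => S x m n ^ 2) cellMeasure := fun m n => (hS m n).integrable_sq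
  have h1 : a * ∑ m, ∑ n, ∫ x, S x m n ^ 2 ∂cellMeasure =
      ∫ x, a * frob (S x) (S x) ∂cellMeasure := by
    rw [integral_const_mul]
    simp only [frob_self_eq]
    rw [integral_finsetSum _ fun m _ => integrable_finsetSum _ fun n _ => hi m n]
    congr 1
    exact Finset.sum_congr rfl fun m _ => (integral_finsetSum _ fun n _ => hi m n).symm
  rw [h1]
  refine integral_mono_ae ?_ (hA.integrable_frob_ddot hS hS) ?_
  · simp only [frob_self_eq]
    exact (integrable_finsetSum _ fun m _ => integrable_finsetSum _ fun n _ => hi m n).const_mul _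
  · filter_upwards [hA.ae_mem] with x hx
    obtain ⟨l, hl⟩ := hx
    simp only [hA.const l x hl]
    exact ha (S x) (hsym x) l

lemma symPart_sub (F H : Mat ℝ) : symPart (F - H) = symPart F - symPart H := by
  ext m n
  simp only [symPart, Matrix.of_apply, Matrix.sub_apply]
  ring

lemma symPart_add (F H : Mat ℝ) : symPart (F + H) = symPart F + symPart H := by
  ext m n
  simp only [symPart, Matrix.of_apply, Matrix.add_apply]
  ring

lemma symPart_smul (c : ℝ) (F : Mat ℝ) : symPart (c • F) = c • symPart F := by
  ext m n
  simp only [symPart, Matrix.of_apply, Matrix.smul_apply, smul_eq_mul]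
  ring

lemma frob_sub_right (F H K : Mat ℝ) : frob F (H - K) = frob F H - frob F K := by
  simp only [frob, Matrix.sub_apply, mul_sub, Finset.sum_sub_distrib]

lemma frob_add_right (F H K : Mat ℝ) : frob F (H + K) = frob F H + frob F K := by
  simp only [frob, Matrix.add_apply, mul_add, Finset.sum_add_distrib]

lemma frob_smul_right (c : ℝ) (F H : Mat ℝ) : frob F (c • H) = c * frob F H := by
  simp only [frob, Matrix.smul_apply, smul_eq_mul, Finset.mul_sum]
  exact Finset.sum_congr rfl fun m _ => Finset.sum_congr rfl fun n _ => by ring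

lemma MemH1PerVec.sub {u u' : Space → Fin 3 → ℝ} {G G' : Space → Mat ℝ} (h : MemH1PerVec u G)
    (h' : MemH1PerVec u' G') : MemH1PerVec (u - u') (G - G') := by
  intro n
  obtain ⟨a1, a2, a3⟩ := memH1Per_iff.mp (h n)
  obtain ⟨b1, b2, b3⟩ := memH1Per_iff.mp (h' n)
  refine memH1Per_iff.mpr ⟨a1.sub b1, fun m => (a2 m).sub (b2 m), fun ξ m => ?_⟩
  have e1 := coeff_sub (a2 m) (b2 m) ξ
  have e2 := coeff_sub a1 b1 ξ
  simp only [Pi.sub_apply, Matrix.sub_apply]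
  rw [e1, e2, a3, b3]
  ring

lemma MemH1PerVec.add {u u' : Space → Fin 3 → ℝ} {G G' : Space → Mat ℝ} (h : MemH1PerVec u G)
    (h' : MemH1PerVec u' G') : MemH1PerVec (u + u') (G + G') := by
  intro n
  obtain ⟨a1, a2, a3⟩ := memH1Per_iff.mp (h n)
  obtain ⟨b1, b2, b3⟩ := memH1Per_iff.mp (h' n)
  refine memH1Per_iff.mpr ⟨a1.add b1, fun m => (a2 m).add (b2 m), fun ξ m => ?_⟩
  have e1 := coeff_add (a2 m) (b2 m) ξ
  have e2 := coeff_add a1 b1 ξ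
  simp only [Pi.add_apply, Matrix.add_apply]
  rw [e1, e2, a3, b3]
  ring

lemma MemH1PerVec.smul {u : Space → Fin 3 → ℝ} {G : Space → Mat ℝ} (h : MemH1PerVec u G)
    (c : ℝ) : MemH1PerVec (c • u) (c • G) := by
  intro n
  obtain ⟨a1, a2, a3⟩ := memH1Per_iff.mp (h n)
  refine memH1Per_iff.mpr ⟨a1.const_mul c, fun m => (a2 m).const_mul c, fun ξ m => ?_⟩
  have e1 := coeff_const_mul c (fun x => G x m n) ξ
  have e2 := coeff_const_mul c (fun x => u x n) ξ
  simp only [Pi.smul_apply, Matrix.smul_apply, smul_eq_mul]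
  rw [e1, e2, a3]
  ring

lemma memLp_const_mat (E : Mat ℝ) (m n : Fin 3) :
    MemLp (fun _ : Space => E m n) 2 cellMeasure := memLp_const _

lemma IsCellSolution.add (hA : AssumptionA D Λ C) {E E' : Mat ℝ} {u u' : Space → Fin 3 → ℝ}
    {G G' : Space → Mat ℝ} (h : IsCellSolution C E u G) (h' : IsCellSolution C E' u' G') :
    IsCellSolution C (E + E') (u + u') (G + G') where
  mem := h.mem.add h'.mem
  mean_zero n := by
    have := integral_add ((h.mem n).1.integrable one_le_two) ((h'.mem n).1.integrable one_le_two)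
    rw [h.mean_zero, h'.mean_zero, add_zero] at this
    exact this
  weak_form v H hv := by
    have hH := memLp_symPart hv.memLp
    simp only [Pi.add_apply, symPart_add, ddot_add, frob_add_right]
    rw [integral_add (hA.integrable_frob_ddot hH (memLp_symPart h.mem.memLp))
      (hA.integrable_frob_ddot hH (memLp_symPart h'.mem.memLp)),
      integral_add (hA.integrable_frob_ddot hH (memLp_const_mat E))
      (hA.integrable_frob_ddot hH (memLp_const_mat E')), h.weak_form v H hv, h'.weak_form v H hv]
    ring

lemma IsCellSolution.smul {E : Mat ℝ} {u : Space → Fin 3 → ℝ}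
    {G : Space → Mat ℝ} (h : IsCellSolution C E u G) (c : ℝ) :
    IsCellSolution C (c • E) (c • u) (c • G) where
  mem := h.mem.smul c
  mean_zero n := by
    have := integral_const_mul (μ := cellMeasure) c fun x => u x n
    rw [h.mean_zero, mul_zero] at this
    exact this
  weak_form v H hv := by
    simp only [Pi.smul_apply, symPart_smul, ddot_smul, frob_smul_right, integral_const_mul]
    rw [h.weak_form v H hv]
    ring

/-- The solution of the cell problem is unique up to null sets. -/
lemma IsCellSolution.unique (hA : AssumptionA D Λ C) (hB : AssumptionB Λ) {E : Mat ℝ}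
    {u u' : Space → Fin 3 → ℝ} {G G' : Space → Mat ℝ} (h : IsCellSolution C E u G)
    (h' : IsCellSolution C E u' G') : u =ᵐ[cellMeasure] u' ∧ G =ᵐ[cellMeasure] G' := by
  obtain ⟨a, b, ha, -, hab⟩ := hB.coercive
  have hd := h.mem.sub h'.mem
  have hw : ∀ v H, MemH1PerVec v H →
      ∫ x, frob (symPart (H x)) (ddot (C x) (symPart ((G - G') x))) ∂cellMeasure = 0 := by
    intro v H hv
    have hH := memLp_symPart hv.memLp
    simp only [Pi.sub_apply, symPart_sub, ddot_sub, frob_sub_right]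
    rw [integral_sub (hA.integrable_frob_ddot hH (memLp_symPart h.mem.memLp))
      (hA.integrable_frob_ddot hH (memLp_symPart h'.mem.memLp)), h.weak_form v H hv,
      h'.weak_form v H hv, sub_self]
  have h0 : ∀ n, ∫ x, (u - u') x n ∂cellMeasure = 0 := by
    intro n
    have := integral_sub ((h.mem n).1.integrable one_le_two) ((h'.mem n).1.integrable one_le_two)
    rw [h.mean_zero, h'.mean_zero, sub_zero] at this
    exact this
  -- Testing with the difference itself: its strain vanishes by coercivity, hence so do the field
  -- and its gradient by `korn`.
  have h1 := hA.coercive (fun F hF l => (hab F hF l).1) (memLp_symPart hd.memLp)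
    fun x => symPart_isSymm _
  rw [hw _ _ hd] at h1
  have h2 := korn hd h0
  have hU : ∀ n, 0 ≤ ∫ x, (u - u') x n ^ 2 ∂cellMeasure := fun n =>
    integral_nonneg fun x => sq_nonneg _
  have hGn : ∀ m n, 0 ≤ ∫ x, (G - G') x m n ^ 2 ∂cellMeasure := fun m n =>
    integral_nonneg fun x => sq_nonneg _
  have hs1 := Finset.sum_nonneg fun n (_ : n ∈ Finset.univ) => hU n
  have hs2 := Finset.sum_nonneg fun m (_ : m ∈ Finset.univ) =>
    Finset.sum_nonneg fun n (_ : n ∈ Finset.univ) => hGn m n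
  have h3 : ∑ m, ∑ n, ∫ x, symPart ((G - G') x) m n ^ 2 ∂cellMeasure ≤ 0 := by
    by_contra hc
    exact absurd h1 (not_le.mpr (mul_pos ha (not_le.mp hc)))
  have z1 := (Finset.sum_eq_zero_iff_of_nonneg fun n _ => hU n).mp
    (le_antisymm (by linarith) hs1)
  have z2 := (Finset.sum_eq_zero_iff_of_nonneg fun m _ => Finset.sum_nonneg fun n _ => hGn m n).mp
    (le_antisymm (by linarith) hs2)
  have key : ∀ {f : Space → ℝ}, MemLp f 2 cellMeasure → ∫ x, f x ^ 2 ∂cellMeasure = 0 →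
      ∀ᵐ x ∂cellMeasure, f x = 0 := by
    intro f hf hz
    rw [integral_eq_zero_iff_of_nonneg (fun x => sq_nonneg _) hf.integrable_sq] at hz
    exact hz.mono fun x hx => by simpa using hx
  constructor
  · have : ∀ᵐ x ∂cellMeasure, ∀ n, (u - u') x n = 0 := by
      rw [ae_all_iff]
      exact fun n => key (hd n).1 (z1 n (Finset.mem_univ n))
    filter_upwards [this] with x hx
    exact funext fun n => sub_eq_zero.mp (hx n)
  · have : ∀ᵐ x ∂cellMeasure, ∀ m n, (G - G') x m n = 0 := by
      simp only [ae_all_iff]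
      intro m n
      refine key (hd.memLp m n) ?_
      exact (Finset.sum_eq_zero_iff_of_nonneg fun n _ => hGn m n).mp (z2 m (Finset.mem_univ m)) n
        (Finset.mem_univ n)
    filter_upwards [this] with x hx
    ext m n
    exact sub_eq_zero.mp (hx m n)

end Work

/-! ### Existence for the cell problem -/

/-- The Hilbert space of pairs of a vector field and a matrix field on the cell. -/
abbrev FieldSpace := PiLp 2 fun _ : Fin 3 ⊕ Fin 3 × Fin 3 => Lp ℝ 2 cellMeasure

/-- The vector field of an element of `FieldSpace`. -/
noncomputable def FieldSpace.vec (w : FieldSpace) (x : Space) (n : Fin 3) : ℝ := w (Sum.inl n) x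

/-- The matrix field of an element of `FieldSpace`. -/
noncomputable def FieldSpace.mat (w : FieldSpace) (x : Space) : Mat ℝ :=
  Matrix.of fun m n => w (Sum.inr (m, n)) x

/-- The Fourier coefficient as a continuous linear functional. -/
noncomputable def coeffCLM (ξ : Fin 3 → ℤ) : Lp ℝ 2 cellMeasure →L[ℝ] ℂ :=
  LinearMap.mkContinuous
    { toFun := fun f => coeff f ξ
      map_add' := fun f g => by
        rw [coeff_congr (Lp.coeFn_add f g)]
        exact coeff_add (Lp.memLp f) (Lp.memLp g) ξ
      map_smul' := fun c f => by
        rw [coeff_congr (Lp.coeFn_smul c f)]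
        exact (coeff_const_mul c f ξ).trans (Complex.real_smul).symm } 1 fun f => by
    have h := enorm_coeff_le (Lp.aestronglyMeasurable f) ξ
    rw [← Lp.enorm_def, ← ofReal_norm, ← ofReal_norm,
      ENNReal.ofReal_le_ofReal_iff (norm_nonneg _)] at h
    rw [one_mul]
    exact h

lemma coeffCLM_apply (ξ : Fin 3 → ℤ) (f : Lp ℝ 2 cellMeasure) : coeffCLM ξ f = coeff f ξ := rfl

/-- The periodic Sobolev fields of mean zero, paired with their gradients. -/
noncomputable def periodicFields : Submodule ℝ FieldSpace where
  carrier := {w | (∀ n, coeffCLM 0 (w (Sum.inl n)) = 0) ∧ ∀ ξ m n,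
    coeffCLM ξ (w (Sum.inr (m, n))) =
      2 * Real.pi * Complex.I * (ξ m : ℂ) * coeffCLM ξ (w (Sum.inl n))}
  add_mem' := by
    rintro w w' ⟨h1, h2⟩ ⟨h1', h2'⟩
    refine ⟨fun n => ?_, fun ξ m n => ?_⟩
    · rw [PiLp.add_apply, map_add, h1, h1', add_zero]
    · rw [PiLp.add_apply, PiLp.add_apply, map_add, map_add, h2, h2', mul_add]
  zero_mem' := by
    refine ⟨fun n => ?_, fun ξ m n => ?_⟩
    · rw [PiLp.zero_apply, map_zero]
    · rw [PiLp.zero_apply, PiLp.zero_apply, map_zero, mul_zero]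
  smul_mem' := by
    rintro c w ⟨h1, h2⟩
    refine ⟨fun n => ?_, fun ξ m n => ?_⟩
    · rw [PiLp.smul_apply, map_smul, h1, smul_zero]
    · rw [PiLp.smul_apply, PiLp.smul_apply, map_smul, map_smul, h2, mul_smul_comm]

/-- The defining conditions are equations between continuous functionals. Closedness supplies the
completeness needed for Lax–Milgram. -/
lemma isClosed_periodicFields : IsClosed (periodicFields : Set FieldSpace) := by
  have : (periodicFields : Set FieldSpace) =
      (⋂ n, {w : FieldSpace | coeffCLM 0 (w (Sum.inl n)) = 0}) ∩ ⋂ ξ, ⋂ m, ⋂ n,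
        {w : FieldSpace | coeffCLM ξ (w (Sum.inr (m, n))) =
          2 * Real.pi * Complex.I * (ξ m : ℂ) * coeffCLM ξ (w (Sum.inl n))} := by
    ext w
    simp [periodicFields]
  rw [this]
  have hp : ∀ i, Continuous fun w : FieldSpace => w i := fun i =>
    (PiLp.proj 2 (𝕜 := ℝ) (fun _ => Lp ℝ 2 cellMeasure) i).continuous
  refine (isClosed_iInter fun n => isClosed_eq ?_ continuous_const).inter
    (isClosed_iInter fun ξ => isClosed_iInter fun m => isClosed_iInter fun n => isClosed_eq ?_ ?_)
  · exact (coeffCLM 0).continuous.comp (hp _)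
  · exact (coeffCLM ξ).continuous.comp (hp _)
  · exact continuous_const.mul ((coeffCLM ξ).continuous.comp (hp _))

instance : CompleteSpace periodicFields := isClosed_periodicFields.completeSpace_coe

lemma mem_periodicFields {w : FieldSpace} : w ∈ periodicFields ↔
    MemH1PerVec w.vec w.mat ∧ ∀ n, ∫ x, w.vec x n ∂cellMeasure = 0 := by
  constructor
  · rintro ⟨h1, h2⟩
    refine ⟨fun n => memH1Per_iff.mpr ⟨Lp.memLp _, fun m => Lp.memLp _, fun ξ m => h2 ξ m n⟩,
      fun n => ?_⟩
    have := h1 n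
    rw [coeffCLM_apply, coeff_zero] at this
    exact_mod_cast this
  · rintro ⟨h1, h2⟩
    refine ⟨fun n => ?_, fun ξ m n => (memH1Per_iff.mp (h1 n)).2.2 ξ m⟩
    rw [coeffCLM_apply, coeff_zero]
    exact_mod_cast h2 n

/-- Identifies the left side of `korn` with the squared norm of the Hilbert space. -/
lemma norm_sq_fieldSpace (w : FieldSpace) : ‖w‖ ^ 2 =
    ∑ n, ∫ x, w.vec x n ^ 2 ∂cellMeasure + ∑ m, ∑ n, ∫ x, w.mat x m n ^ 2 ∂cellMeasure := by
  have h : ∀ f : Lp ℝ 2 cellMeasure, ‖f‖ ^ 2 = ∫ x, f x ^ 2 ∂cellMeasure := by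
    intro f
    rw [← real_inner_self_eq_norm_sq, L2.inner_def]
    exact integral_congr_ae (Eventually.of_forall fun x => by simp [sq])
  rw [PiLp.norm_sq_eq_of_L2, Fintype.sum_sum_type, Fintype.sum_prod_type]
  simp only [h]
  rfl

/-- An entry of the strain of an element of `FieldSpace`. -/
noncomputable def strainCLM (m n : Fin 3) : periodicFields →L[ℝ] Lp ℝ 2 cellMeasure :=
  ((2⁻¹ : ℝ) • (PiLp.proj 2 (𝕜 := ℝ) (fun _ => Lp ℝ 2 cellMeasure) (Sum.inr (m, n)) +
    PiLp.proj 2 (𝕜 := ℝ) (fun _ => Lp ℝ 2 cellMeasure) (Sum.inr (n, m)))) ∘L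
    periodicFields.subtypeL

lemma strainCLM_ae (w : periodicFields) (m n : Fin 3) :
    strainCLM m n w =ᵐ[cellMeasure] fun x => symPart ((w : FieldSpace).mat x) m n := by
  have h : strainCLM m n w = (2⁻¹ : ℝ) • ((w : FieldSpace) (Sum.inr (m, n)) +
    (w : FieldSpace) (Sum.inr (n, m))) := rfl
  rw [h]
  filter_upwards [Lp.coeFn_smul (2⁻¹ : ℝ) ((w : FieldSpace) (Sum.inr (m, n)) +
    (w : FieldSpace) (Sum.inr (n, m))), Lp.coeFn_add ((w : FieldSpace) (Sum.inr (m, n)))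
    ((w : FieldSpace) (Sum.inr (n, m)))] with x h1 h2
  rw [h1, Pi.smul_apply, h2]
  simp only [symPart, FieldSpace.mat, Matrix.of_apply, Pi.add_apply, smul_eq_mul]
  ring

/-- The pairing `∫ f g` over a subset of the cell. -/
noncomputable def pairing (s : Set Space) :
    Lp ℝ 2 cellMeasure →L[ℝ] Lp ℝ 2 cellMeasure →L[ℝ] ℝ :=
  (isBoundedBilinearMap_inner (𝕜 := ℝ)
    (E := Lp ℝ 2 (cellMeasure.restrict s))).toContinuousLinearMap.bilinearComp
    (LpToLpRestrictCLM Space ℝ ℝ cellMeasure 2 s) (LpToLpRestrictCLM Space ℝ ℝ cellMeasure 2 s)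

lemma pairing_apply (s : Set Space) {f g : Lp ℝ 2 cellMeasure} {f' g' : Space → ℝ}
    (hf : f =ᵐ[cellMeasure] f') (hg : g =ᵐ[cellMeasure] g') :
    pairing s f g = ∫ x in s, f' x * g' x ∂cellMeasure := by
  have h : pairing s f g = inner ℝ (LpToLpRestrictCLM Space ℝ ℝ cellMeasure 2 s f)
      (LpToLpRestrictCLM Space ℝ ℝ cellMeasure 2 s g) := rfl
  rw [h, L2.inner_def]
  refine integral_congr_ae ?_
  filter_upwards [LpToLpRestrictCLM_coeFn ℝ s f, LpToLpRestrictCLM_coeFn ℝ s g,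
    ae_restrict_of_ae hf, ae_restrict_of_ae hg] with x h1 h2 h3 h4
  rw [h1, h2, h3, h4]
  simp [mul_comm]

section Existence

variable {M : ℕ} {D : Fin (M + 1) → Set Space} {Λ : Fin (M + 1) → Tensor ℝ}
  {C : Space → Tensor ℝ}

/-- The energy form of the cell problem; the second argument is the test field. -/
noncomputable def energyForm (D : Fin (M + 1) → Set Space) (Λ : Fin (M + 1) → Tensor ℝ) :
    periodicFields →L[ℝ] periodicFields →L[ℝ] ℝ :=
  ∑ k : Fin (M + 1) × Fin 3 × Fin 3 × Fin 3 × Fin 3,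
    Λ k.1 k.2.1 k.2.2.1 k.2.2.2.1 k.2.2.2.2 •
      (pairing (D k.1)).bilinearComp (strainCLM k.2.2.2.1 k.2.2.2.2) (strainCLM k.2.1 k.2.2.1)

/-- The load of the cell problem for the macroscopic strain `E`. -/
noncomputable def loadForm (D : Fin (M + 1) → Set Space) (Λ : Fin (M + 1) → Tensor ℝ) (E : Mat ℝ) :
    periodicFields →L[ℝ] ℝ :=
  -∑ k : Fin (M + 1) × Fin 3 × Fin 3 × Fin 3 × Fin 3,
    Λ k.1 k.2.1 k.2.2.1 k.2.2.2.1 k.2.2.2.2 •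
      (pairing (D k.1) ((memLp_const_mat E k.2.2.2.1 k.2.2.2.2).toLp _) ∘L
        strainCLM k.2.1 k.2.2.1)

lemma memLp_strain (w : periodicFields) (m n : Fin 3) :
    MemLp (fun x => symPart ((w : FieldSpace).mat x) m n) 2 cellMeasure :=
  memLp_symPart (mem_periodicFields.mp w.2).1.memLp m n

lemma energyForm_apply (hA : AssumptionA D Λ C) (w v : periodicFields) :
    energyForm D Λ w v = ∫ x, frob (symPart ((v : FieldSpace).mat x))
      (ddot (C x) (symPart ((w : FieldSpace).mat x))) ∂cellMeasure := by
  rw [hA.integral_frob_ddot (memLp_strain v) (memLp_strain w)]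
  simp only [energyForm, sum_apply, smul_apply, ContinuousLinearMap.bilinearComp_apply,
    smul_eq_mul]
  refine Finset.sum_congr rfl fun k _ => ?_
  rw [pairing_apply _ (strainCLM_ae w _ _) (strainCLM_ae v _ _)]
  simp only [mul_comm]

lemma loadForm_apply (hA : AssumptionA D Λ C) (E : Mat ℝ) (v : periodicFields) :
    loadForm D Λ E v = -∫ x, frob (symPart ((v : FieldSpace).mat x)) (ddot (C x) E)
      ∂cellMeasure := by
  rw [hA.integral_frob_ddot (memLp_strain v) (memLp_const_mat E)]
  simp only [loadForm, neg_apply, sum_apply, smul_apply, ContinuousLinearMap.comp_apply,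
    smul_eq_mul]
  congr 1
  refine Finset.sum_congr rfl fun k _ => ?_
  rw [pairing_apply _ (MemLp.coeFn_toLp _) (strainCLM_ae v _ _)]
  simp only [mul_comm]

/-- The constant `a / 4` combines pointwise coercivity with the factor `4` of `korn`. -/
lemma isCoercive_energyForm (hA : AssumptionA D Λ C) (hB : AssumptionB Λ) :
    IsCoercive (energyForm D Λ) := by
  obtain ⟨a, b, ha, -, hab⟩ := hB.coercive
  refine ⟨a / 4, by positivity, fun w => ?_⟩
  rw [energyForm_apply hA]
  have hw := mem_periodicFields.mp w.2
  have h1 := hA.coercive (fun F hF l => (hab F hF l).1) (memLp_strain w)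
    fun x => symPart_isSymm _
  have h2 := korn hw.1 hw.2
  rw [← norm_sq_fieldSpace] at h2
  refine le_trans ?_ h1
  have h3 : ‖w‖ = ‖(w : FieldSpace)‖ := rfl
  rw [h3]
  nlinarith [mul_le_mul_of_nonneg_left h2 ha.le]

/-- Every field of the periodic Sobolev space differs by a constant from an element of
`periodicFields`. -/
lemma exists_periodicFields {v : Space → Fin 3 → ℝ} {H : Space → Mat ℝ} (hv : MemH1PerVec v H) :
    ∃ w : periodicFields, (w : FieldSpace).mat =ᵐ[cellMeasure] H := by
  have h := fun n => memH1Per_iff.mp (hv n)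
  have hc : ∀ n, MemLp (fun x => v x n - ∫ y, v y n ∂cellMeasure) 2 cellMeasure := fun n =>
    (h n).1.sub (memLp_const _)
  let w : FieldSpace := WithLp.toLp 2 fun i => match i with
    | Sum.inl n => (hc n).toLp _
    | Sum.inr (m, n) => (hv.memLp m n).toLp _
  have h1 : ∀ n ξ, coeffCLM ξ (w (Sum.inl n)) = coeff (fun x => v x n) ξ -
      if ξ = 0 then ((∫ y, v y n ∂cellMeasure : ℝ) : ℂ) else 0 := by
    intro n ξ
    rw [coeffCLM_apply, coeff_congr (hc n).coeFn_toLp, coeff_sub (h n).1 (memLp_const _),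
      coeff_const]
  have h2 : ∀ m n ξ, coeffCLM ξ (w (Sum.inr (m, n))) = coeff (fun x => H x m n) ξ := by
    intro m n ξ
    rw [coeffCLM_apply, coeff_congr (hv.memLp m n).coeFn_toLp]
  refine ⟨⟨w, fun n => ?_, fun ξ m n => ?_⟩, ?_⟩
  · rw [h1, if_pos rfl, coeff_zero, sub_self]
  · rw [h1, h2]
    have e : coeff (fun x => H x m n) ξ = _ := (h n).2.2 ξ m
    rw [e]
    split_ifs with h0
    · simp [h0]
    · rw [sub_zero]
  · have : ∀ᵐ x ∂cellMeasure, ∀ m n, w.mat x m n = H x m n := by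
      simp only [ae_all_iff]
      exact fun m n => (hv.memLp m n).coeFn_toLp
    filter_upwards [this] with x hx
    ext m n
    exact hx m n

/-- The cell problem has a solution. -/
lemma exists_isCellSolution (hA : AssumptionA D Λ C) (hB : AssumptionB Λ) (E : Mat ℝ) :
    ∃ u G, IsCellSolution C E u G := by
  have hco := isCoercive_energyForm hA hB
  -- Lax–Milgram: the Riesz representative of the load is pulled back through the isomorphism of the
  -- coercive form.
  set w : periodicFields := hco.continuousLinearEquivOfBilin.symm
    ((InnerProductSpace.toDual ℝ periodicFields).symm (loadForm D Λ E)) with hw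
  have hsol : ∀ v : periodicFields, energyForm D Λ w v = loadForm D Λ E v := by
    intro v
    rw [← hco.continuousLinearEquivOfBilin_apply, hw, ContinuousLinearEquiv.apply_symm_apply,
      InnerProductSpace.toDual_symm_apply]
  have hmem := mem_periodicFields.mp w.2
  refine ⟨(w : FieldSpace).vec, (w : FieldSpace).mat, hmem.1, hmem.2, fun v H hv => ?_⟩
  -- The test field need not have mean zero, but only its gradient enters, so its mean may be
  -- removed.
  obtain ⟨z, hz⟩ := exists_periodicFields hv
  have h := hsol z
  rw [energyForm_apply hA, loadForm_apply hA] at h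
  have e : ∀ F : Space → Mat ℝ, ∫ x, frob (symPart ((z : FieldSpace).mat x)) (F x) ∂cellMeasure =
      ∫ x, frob (symPart (H x)) (F x) ∂cellMeasure := fun F =>
    integral_congr_ae (hz.mono fun x hx => by simp only [hx])
  exact (e _).symm.trans (h.trans (congrArg Neg.neg (e _)))

/-- The effective tensor is well defined. -/
lemma existsUnique_isEffectiveTensor (hA : AssumptionA D Λ C) (hB : AssumptionB Λ) :
    ∃! T, IsEffectiveTensor C T := by
  choose u G hG using fun E : Mat ℝ => exists_isCellSolution hA hB (symPart E)
  let S : Mat ℝ → Space → Mat ℝ := fun E x => ddot (C x) (symPart (G E x) + symPart E)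
  have hS : ∀ E m n, Integrable (fun x => S E x m n) cellMeasure := fun E m n =>
    (hA.memLp_ddot (F := fun x => symPart (G E x) + symPart E) (fun p q =>
      (memLp_symPart (hG E).mem.memLp p q).add (memLp_const_mat _ p q)) m n).integrable one_le_two
  -- Solutions are unique only up to null sets, so the chosen stresses depend linearly on `E` almost
  -- everywhere; this is enough for their integrals.
  have hadd : ∀ E E', S (E + E') =ᵐ[cellMeasure] S E + S E' := by
    intro E E'
    have h := (hG (E + E')).unique hA hB (by
      rw [symPart_add]; exact (hG E).add hA (hG E'))
    filter_upwards [h.2] with x hx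
    simp only [S, hx, Pi.add_apply, symPart_add, ddot_add]
    abel
  have hsmul : ∀ (c : ℝ) E, S (c • E) =ᵐ[cellMeasure] c • S E := by
    intro c E
    have h := (hG (c • E)).unique hA hB (by rw [symPart_smul]; exact (hG E).smul c)
    filter_upwards [h.2] with x hx
    simp only [S, hx, Pi.smul_apply, symPart_smul, ddot_smul, ← smul_add]
  let R : Mat ℝ →ₗ[ℝ] Mat ℝ :=
    { toFun := fun E => Matrix.of fun m n => ∫ x, S E x m n ∂cellMeasure
      map_add' := fun E E' => by
        ext m n
        simp only [Matrix.of_apply, Matrix.add_apply]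
        rw [← integral_add (hS E m n) (hS E' m n)]
        exact integral_congr_ae ((hadd E E').mono fun x hx => by simp only [hx]; rfl)
      map_smul' := fun c E => by
        ext m n
        simp only [Matrix.of_apply, Matrix.smul_apply, RingHom.id_apply, smul_eq_mul]
        rw [← integral_const_mul]
        exact integral_congr_ae ((hsmul c E).mono fun x hx => by simp only [hx]; rfl) }
  obtain ⟨T, hT, hTR⟩ := exists_tensor R fun E => by
    ext m n
    refine integral_congr_ae ?_
    filter_upwards [hA.ae_mem] with x hx
    obtain ⟨l, hl⟩ := hx
    simp only [S]
    rw [hA.const l x hl]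
    exact (ddot_isSymm (fun m n p q => (hB.symm l m n p q).1) _).apply m n
  have hmap : ∀ E : Mat ℝ, E.map (algebraMap ℝ ℝ) = E := fun E => by ext; simp
  refine ⟨T, ⟨hT, fun E hE => ⟨u E, G E, ?_, fun m n => ?_⟩⟩, fun T' hT' => ?_⟩
  · have := hG E
    rwa [symPart_of_isSymm hE] at this
  · have := hTR E hE
    rw [hmap] at this
    rw [this]
    simp only [R, S, LinearMap.coe_mk, AddHom.coe_mk, Matrix.of_apply, symPart_of_isSymm hE]
  · refine tensor_ext hT'.1 hT fun E hE => ?_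
    obtain ⟨u', G', h1, h2⟩ := hT'.2 E hE
    have h3 := hG E
    rw [symPart_of_isSymm hE] at h3
    rw [hTR E hE, hmap]
    ext m n
    rw [h2]
    refine integral_congr_ae ((h1.unique hA hB h3).2.mono fun x hx => ?_)
    simp only [hx, S, symPart_of_isSymm hE]

end Existence

/-! ### Convergence of the scheme -/

section Convergence

variable {M : ℕ} {D : Fin (M + 1) → Set Space} {Λ : Fin (M + 1) → Tensor ℝ}
  {C : Space → Tensor ℝ}

lemma frob_symPart_left (F : Mat ℝ) {S : Mat ℝ} (hS : S.IsSymm) :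
    frob (symPart F) S = frob F S := by
  have h : frob (symPart F) S = (∑ m, ∑ n, F m n * S m n + ∑ m, ∑ n, F n m * S m n) / 2 := by
    simp only [frob, symPart, Matrix.of_apply, ← Finset.sum_add_distrib, Finset.sum_div]
    exact Finset.sum_congr rfl fun m _ => Finset.sum_congr rfl fun n _ => by ring
  have h2 : ∑ m, ∑ n, F n m * S m n = ∑ m, ∑ n, F m n * S m n := by
    rw [Finset.sum_comm]
    exact Finset.sum_congr rfl fun m _ => Finset.sum_congr rfl fun n _ => by rw [hS.apply]
  rw [h, h2, frob]
  ring

lemma IsCellSolution.memLp_strain {E : Mat ℝ} {u : Space → Fin 3 → ℝ} {G : Space → Mat ℝ}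
    (h : IsCellSolution C E u G) (m n : Fin 3) :
    MemLp (fun x => (symPart (G x) + E) m n) 2 cellMeasure :=
  (memLp_symPart h.mem.memLp m n).add (memLp_const_mat E m n)

lemma IsCellSolution.memLp_stress (hA : AssumptionA D Λ C) {E : Mat ℝ} {u : Space → Fin 3 → ℝ}
    {G : Space → Mat ℝ} (h : IsCellSolution C E u G) (m n : Fin 3) :
    MemLp (fun x => ddot (C x) (symPart (G x) + E) m n) 2 cellMeasure :=
  hA.memLp_ddot h.memLp_strain m n

lemma stress_isSymm_ae (hA : AssumptionA D Λ C) (hB : AssumptionB Λ) (F : Space → Mat ℝ) :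
    ∀ᵐ x ∂cellMeasure, (ddot (C x) (F x)).IsSymm := by
  filter_upwards [hA.ae_mem] with x hx
  obtain ⟨l, hl⟩ := hx
  rw [hA.const l x hl]
  exact ddot_isSymm (fun m n p q => (hB.symm l m n p q).1) _

/-- The Fourier coefficients of the stress are divergence free. -/
lemma IsCellSolution.stress_equilibrium (hA : AssumptionA D Λ C) (hB : AssumptionB Λ) {E : Mat ℝ}
    {u : Space → Fin 3 → ℝ} {G : Space → Mat ℝ} (h : IsCellSolution C E u G) (ξ : Fin 3 → ℤ)
    (n : Fin 3) :
    ∑ m, (ξ m : ℂ) * coeff (fun x => ddot (C x) (symPart (G x) + E) m n) ξ = 0 := by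
  set σ : Space → Mat ℝ := fun x => ddot (C x) (symPart (G x) + E) with hσ
  have hσL : ∀ m n, MemLp (fun x => σ x m n) 2 cellMeasure := h.memLp_stress hA
  set Y : Fin 3 → ℂ := fun n => ∑ m, (2 * Real.pi * Complex.I * ((-ξ) m : ℂ)) *
    coeff (fun x => σ x m n) ξ with hY
  -- Test fields are real parts of `b` times the mode `-ξ`, the mode against which the coefficient
  -- at `ξ` is computed. The weak form therefore yields only a real part, but for every complex `b`.
  have key : ∀ b : Fin 3 → ℂ, (∑ n, b n * Y n).re = 0 := by
    intro b
    set k : Fin 3 → Fin 3 → ℂ := fun m n => 2 * Real.pi * Complex.I * ((-ξ) m : ℂ) * b n with hk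
    have hv : MemH1PerVec (fun x n => (trig {-ξ} (fun _ => b n) x).re)
        (fun x => Matrix.of fun m n => (k m n * mode (-ξ) x).re) := by
      intro n
      have := memH1Per_re_trig {-ξ} fun _ => b n
      simp only [trig, Finset.sum_singleton] at this ⊢
      exact this
    have hw := h.weak_form _ _ hv
    have hH := memLp_symPart hv.memLp
    rw [eq_neg_iff_add_eq_zero, ← integral_add
      (hA.integrable_frob_ddot hH (memLp_symPart h.mem.memLp))
      (hA.integrable_frob_ddot hH (memLp_const_mat E))] at hw
    simp only [← frob_add_right, ← ddot_add] at hw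
    have e1 : ∫ x, frob (Matrix.of fun m n => (k m n * mode (-ξ) x).re) (σ x) ∂cellMeasure = 0 := by
      rw [← hw]
      refine integral_congr_ae ?_
      filter_upwards [stress_isSymm_ae hA hB fun x => symPart (G x) + E] with x hx
      exact (frob_symPart_left _ hx).symm
    have hint : ∀ m n, Integrable (fun x => k m n * (mode (-ξ) x * (σ x m n : ℂ))) cellMeasure :=
      fun m n => (integrable_mode_mul _ (integrable_of_memLp (memLp_ofReal (hσL m n)))).const_mul _
    have e2 : ∀ x, frob (Matrix.of fun m n => (k m n * mode (-ξ) x).re) (σ x) =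
        (∑ m, ∑ n, k m n * (mode (-ξ) x * (σ x m n : ℂ))).re := by
      intro x
      simp only [frob, Complex.re_sum, Matrix.of_apply]
      refine Finset.sum_congr rfl fun m _ => Finset.sum_congr rfl fun n _ => ?_
      rw [← mul_assoc, Complex.re_mul_ofReal]
    have e3 : (∫ x, ∑ m, ∑ n, k m n * (mode (-ξ) x * (σ x m n : ℂ)) ∂cellMeasure) =
        ∑ n, b n * Y n := by
      rw [integral_finsetSum _ fun m _ => integrable_finsetSum _ fun n _ => hint m n]
      simp only [integral_finsetSum _ fun n _ => hint _ n, integral_const_mul, hY, Finset.mul_sum]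
      rw [Finset.sum_comm]
      refine Finset.sum_congr rfl fun n _ => Finset.sum_congr rfl fun m _ => ?_
      simp only [hk, coeff, fourierCell]
      ring
    have e4 := Complex.reCLM.integral_comp_comm
      (integrable_finsetSum Finset.univ fun m _ => integrable_finsetSum Finset.univ fun n _ =>
        hint m n)
    simp only [e2] at e1
    rw [← e3]
    exact e4.symm.trans e1
  have hYn : Y n = 0 := by
    -- With this `b` the real part is `|Y n|²`.
    have := key (Pi.single n (star (Y n)))
    rw [Finset.sum_eq_single n (fun i _ hi => by simp [hi]) (by simp), Pi.single_eq_same,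
      Complex.star_def, mul_comm, Complex.mul_conj, Complex.ofReal_re] at this
    exact Complex.normSq_eq_zero.mp this
  have h2 : Y n = -(2 * Real.pi * Complex.I) *
      ∑ m, (ξ m : ℂ) * coeff (fun x => σ x m n) ξ := by
    simp only [hY, Finset.mul_sum, Pi.neg_apply, Int.cast_neg]
    exact Finset.sum_congr rfl fun m _ => by ring
  rw [hYn] at h2
  exact (mul_eq_zero.mp h2.symm).resolve_left (neg_ne_zero.mpr Complex.two_pi_I_ne_zero)

/-- The Fourier coefficients of the strain. -/
lemma IsCellSolution.coeff_strain {E : Mat ℝ} {u : Space → Fin 3 → ℝ} {G : Space → Mat ℝ}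
    (h : IsCellSolution C E u G) (ξ : Fin 3 → ℤ) (m n : Fin 3) :
    coeff (fun x => (symPart (G x) + E) m n) ξ =
      symTens (fun m => (ξ m : ℂ))
        (fun n => 2 * Real.pi * Complex.I * coeff (fun x => u x n) ξ) m n +
      if ξ = 0 then (E m n : ℂ) else 0 := by
  have h' := fun n => memH1Per_iff.mp (h.mem n)
  have hs : (fun x => symPart (G x) m n) = fun x => 2⁻¹ * (G x m n + G x n m) := by
    funext x
    simp only [symPart, Matrix.of_apply]
    ring
  have e := coeff_add (memLp_symPart h.mem.memLp m n) (memLp_const_mat E m n) ξ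
  simp only [Matrix.add_apply]
  rw [e, coeff_const, hs, coeff_const_mul, coeff_add (h.mem.memLp m n) (h.mem.memLp n m)]
  have e1 : coeff (fun x => G x m n) ξ = _ := (h' n).2.2 ξ m
  have e2 : coeff (fun x => G x n m) ξ = _ := (h' m).2.2 ξ n
  rw [e1, e2]
  congr 1
  simp only [symTens, Matrix.of_apply]
  push_cast
  ring

/-- The truncated Fourier series of a real matrix field. -/
noncomputable def trunc (s : Finset (Fin 3 → ℤ)) (F : Space → Mat ℝ) (x : Space) : Mat ℂ :=
  Matrix.of fun m n => trig s (coeff fun x => F x m n) x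

lemma continuous_trunc (s : Finset (Fin 3 → ℤ)) (F : Space → Mat ℝ) : Continuous (trunc s F) :=
  continuous_matrix fun _ _ => continuous_trig _ _

lemma nsq_trunc_bounded (s : Finset (Fin 3 → ℤ)) (F : Space → Mat ℝ) :
    ∃ B, ∀ x, nsq (trunc s F x) ≤ B := by
  refine ⟨∑ m, ∑ n, (∑ ξ ∈ s, ‖coeff (fun x => F x m n) ξ‖) ^ 2, fun x => ?_⟩
  refine Finset.sum_le_sum fun m _ => Finset.sum_le_sum fun n _ => ?_
  exact pow_le_pow_left₀ (norm_nonneg _) (norm_trig_le s _ x) 2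

/-- Fourier coefficients ignore null sets, so symmetry almost everywhere becomes symmetry at every
point, in particular on the grid. -/
lemma trunc_isSymm (s : Finset (Fin 3 → ℤ)) {F : Space → Mat ℝ}
    (hF : ∀ᵐ x ∂cellMeasure, (F x).IsSymm) (x : Space) : (trunc s F x).IsSymm := by
  ext m n
  simp only [trunc, Matrix.transpose_apply, Matrix.of_apply]
  congr 1
  funext ξ
  exact coeff_congr (hF.mono fun x hx => hx.apply m n) ξ

/-- Without aliasing, the discrete coefficients of the samples are the exact ones. This is how
compatibility and equilibrium pass from the cell to the grid. -/
lemma dftMat_trunc {N : ℕ} (hN : 1 ≤ N) {s : Finset (Fin 3 → ℤ)} (hs : ∀ ξ ∈ s, ξ ∈ freq N)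
    (F : Space → Mat ℝ) {ξ : Fin 3 → ℤ} (hξ : ξ ∈ freq N) (m n : Fin 3) :
    dftMat (fun I : Fin 3 → Fin N => trunc s F (gridPt N I)) ξ m n =
      if ξ ∈ s then coeff (fun x => F x m n) ξ else 0 :=
  dft_trig hN s hs _ hξ

lemma tendsto_integral_nsq_trunc {F : Space → Mat ℝ}
    (hF : ∀ m n, MemLp (fun x => F x m n) 2 cellMeasure) :
    Tendsto (fun s => ∫ x, nsq ((F x).toComplex - trunc s F x) ∂cellMeasure) atTop (𝓝 0) := by
  have h1 : ∀ m n, Tendsto (fun s => ∫ x, ‖(F x m n : ℂ) - trig s (coeff fun x => F x m n) x‖ ^ 2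
      ∂cellMeasure) atTop (𝓝 0) := fun m n => tendsto_fourier_truncation (memLp_ofReal (hF m n))
  have h2 := tendsto_finsetSum (Finset.univ : Finset (Fin 3)) fun m _ =>
    tendsto_finsetSum (Finset.univ : Finset (Fin 3)) fun n _ => h1 m n
  simp only [Finset.sum_const_zero] at h2
  refine h2.congr fun s => ?_
  have hi : ∀ m n, Integrable (fun x => ‖(F x m n : ℂ) - trig s (coeff fun x => F x m n) x‖ ^ 2)
      cellMeasure := fun m n =>
    ((memLp_ofReal (hF m n)).sub (memLp_of_continuous (continuous_trig _ _))).integrable_norm_pow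
      two_ne_zero
  simp only [nsq]
  rw [← Finset.sum_congr rfl fun m _ => integral_finsetSum _ fun n _ => hi m n,
    ← integral_finsetSum _ fun m _ => integrable_finsetSum _ fun n _ => hi m n]
  rfl

lemma integrable_nsq_trunc (s : Finset (Fin 3 → ℤ)) {F : Space → Mat ℝ}
    (hF : ∀ m n, MemLp (fun x => F x m n) 2 cellMeasure) :
    Integrable (fun x => nsq ((F x).toComplex - trunc s F x)) cellMeasure :=
  integrable_finsetSum _ fun m _ => integrable_finsetSum _ fun n _ =>
    ((memLp_ofReal (hF m n)).sub (memLp_of_continuous (continuous_trig _ _))).integrable_norm_pow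
      two_ne_zero

/-- The residual of the truncated fields tends to zero. -/
lemma tendsto_residual (hA : AssumptionA D Λ C) {F : Space → Mat ℝ}
    (hF : ∀ m n, MemLp (fun x => F x m n) 2 cellMeasure) :
    Tendsto (fun s => ∫ x, nsq (ddot (C x).toComplex (trunc s F x) -
      trunc s (fun x => ddot (C x) (F x)) x) ∂cellMeasure) atTop (𝓝 0) := by
  set K := ∑ l, (Λ l).nsq with hK
  have hS := hA.memLp_ddot hF
  have h1 := ((tendsto_integral_nsq_trunc hF).const_mul (2 * K)).add
    ((tendsto_integral_nsq_trunc (F := fun x => ddot (C x) (F x)) hS).const_mul 2)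
  simp only [mul_zero, add_zero] at h1
  refine tendsto_of_tendsto_of_tendsto_of_le_of_le tendsto_const_nhds h1
    (fun s => integral_nonneg fun x => nsq_nonneg _) fun s => ?_
  have i1 := (integrable_nsq_trunc s hF).const_mul (2 * K)
  have i2 := (integrable_nsq_trunc s (F := fun x => ddot (C x) (F x)) hS).const_mul 2
  simp only [← integral_const_mul]
  rw [← integral_add i1 i2]
  refine integral_mono_of_nonneg (Eventually.of_forall fun x => nsq_nonneg _) (i1.add i2) ?_
  filter_upwards [hA.ae_mem] with x hx
  obtain ⟨l, hl⟩ := hx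
  have hneg : ∀ F : Mat ℂ, nsq (-F) = nsq F := fun F => by simp [nsq]
  -- The untruncated fields cancel exactly, so the residual consists of the truncation errors of
  -- strain and stress.
  have e : ddot (C x).toComplex (trunc s F x) - trunc s (fun x => ddot (C x) (F x)) x =
      ddot (C x).toComplex (-((F x).toComplex - trunc s F x)) +
        ((ddot (C x) (F x)).toComplex - trunc s (fun x => ddot (C x) (F x)) x) := by
    rw [neg_sub, ddot_sub, ddot_toComplex]
    abel
  have h2 := nsq_ddot_le (C x) (-((F x).toComplex - trunc s F x))
  rw [hneg] at h2
  have h3 : (C x).nsq ≤ K := by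
    rw [hA.const l x hl]
    exact Finset.single_le_sum (fun l _ => (Λ l).nsq_nonneg) (Finset.mem_univ l)
  have h4 := mul_le_mul_of_nonneg_right h3 (nsq_nonneg ((F x).toComplex - trunc s F x))
  simp only [e]
  refine (nsq_add_le _ _).trans ?_
  linarith

lemma norm_sq_mean_le {N : ℕ} (hN : 1 ≤ N) (f : (Fin 3 → Fin N) → ℂ) :
    ‖((N : ℂ) ^ 3)⁻¹ * ∑ I, f I‖ ^ 2 ≤ ((N : ℝ) ^ 3)⁻¹ * ∑ I, ‖f I‖ ^ 2 := by
  have hN' : (0 : ℝ) < (N : ℝ) ^ 3 := by positivity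
  have h1 : ‖∑ I, f I‖ ^ 2 ≤ (N : ℝ) ^ 3 * ∑ I, ‖f I‖ ^ 2 := by
    refine (pow_le_pow_left₀ (norm_nonneg _) (norm_sum_le _ _) 2).trans ?_
    have := sq_sum_le_card_mul_sum_sq (s := Finset.univ) (f := fun I => ‖f I‖)
    simpa using this
  rw [norm_mul, mul_pow, norm_inv, norm_pow, Complex.norm_natCast]
  calc (((N : ℝ) ^ 3)⁻¹) ^ 2 * ‖∑ I, f I‖ ^ 2
      ≤ (((N : ℝ) ^ 3)⁻¹) ^ 2 * ((N : ℝ) ^ 3 * ∑ I, ‖f I‖ ^ 2) := by gcongr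
    _ = _ := by field_simp

/-- The error of the mean stress is bounded by the residual of the truncated fields. -/
lemma stress_error_le {N : ℕ} {Cref : Tensor ℝ} {CN : (Fin 3 → Fin N) → Tensor ℝ} {E : Mat ℝ}
    {u : Space → Fin 3 → ℝ} {G : Space → Mat ℝ} {ε : (Fin 3 → Fin N) → Mat ℂ} {a K : ℝ}
    (hA : AssumptionA D Λ C) (hB : AssumptionB Λ) (href : IsReferenceMedium Cref) (hN : 1 ≤ N)
    (ha : 0 < a) (hco : ∀ I, ∀ F : Mat ℝ, F.IsSymm → a * frob F F ≤ frob F (ddot (CN I) F))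
    (hCN : ∀ I, IsStiffnessSymm (CN I)) (hK : ∀ I, (CN I).nsq ≤ K)
    (h : IsCellSolution C E u G) (hE : E.IsSymm) (hε : IsMSSolution Cref CN E ε)
    {s : Finset (Fin 3 → ℤ)} (hs0 : 0 ∈ s) (hs : ∀ ξ ∈ s, ξ ∈ freq N) (m n : Fin 3) :
    ‖((N : ℂ) ^ 3)⁻¹ * ∑ I, ddot (CN I).toComplex (ε I) m n -
        ((∫ x, ddot (C x) (symPart (G x) + E) m n ∂cellMeasure : ℝ) : ℂ)‖ ^ 2 ≤
      (2 * K / a ^ 2 + 2) * gridNsq fun I => ddot (CN I).toComplex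
          (trunc s (fun x => symPart (G x) + E) (gridPt N I)) -
        trunc s (fun x => ddot (C x) (symPart (G x) + E)) (gridPt N I) := by
  set e : (Fin 3 → Fin N) → Mat ℂ := fun I => trunc s (fun x => symPart (G x) + E) (gridPt N I)
    with he
  set S : (Fin 3 → Fin N) → Mat ℂ := fun I =>
    trunc s (fun x => ddot (C x) (symPart (G x) + E)) (gridPt N I) with hS
  have hK0 : 0 ≤ K := ((CN fun _ => ⟨0, hN⟩).nsq_nonneg).trans (hK _)
  obtain ⟨hc, heq⟩ := hε.compatible_equilibrated href hCN
  have hes : ∀ I, (e I).IsSymm := fun I => trunc_isSymm s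
    (Eventually.of_forall fun x => (symPart_isSymm _).add hE) _
  have hSs : ∀ I, (S I).IsSymm := fun I => trunc_isSymm s (stress_isSymm_ae hA hB _) _
  have hec : IsCompatible e := by
    intro ξ hξ hξ0
    by_cases hξs : ξ ∈ s
    · refine ⟨fun n => 2 * Real.pi * Complex.I * coeff (fun x => u x n) ξ, ?_⟩
      ext m n
      rw [dftMat_trunc hN hs _ hξ, if_pos hξs, h.coeff_strain, if_neg hξ0, add_zero]
    · refine ⟨0, ?_⟩
      ext m n
      rw [dftMat_trunc hN hs _ hξ, if_neg hξs]
      simp [symTens]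
  have he0 : dftMat e 0 = E.toComplex := by
    ext m n
    rw [dftMat_trunc hN hs _ (zero_mem_freq hN), if_pos hs0, h.coeff_strain, if_pos rfl]
    simp [symTens, Mat.toComplex_apply]
  have hSe : IsEquilibrated S := by
    intro ξ hξ hξ0 n
    by_cases hξs : ξ ∈ s
    · simp only [hS, dftMat_trunc hN hs _ hξ, if_pos hξs]
      exact h.stress_equilibrium hA hB ξ n
    · simp only [hS, dftMat_trunc hN hs _ hξ, if_neg hξs, mul_zero, Finset.sum_const_zero]
  set d : (Fin 3 → Fin N) → Mat ℂ := ε - e with hd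
  set r : (Fin 3 → Fin N) → Mat ℂ := fun I => ddot (CN I).toComplex (e I) - S I with hr
  -- The right side is a difference of equilibrated fields, so `d` and `r` fit the energy estimate.
  have hdr : ∀ I, ddot (CN I).toComplex (d I) + r I = ddot (CN I).toComplex (ε I) - S I := by
    intro I
    simp only [hd, hr, Pi.sub_apply, ddot_sub]
    abel
  have hest := energy_estimate hN ha hco (d := d) (r := r) (hc.sub hec)
    (by rw [hd, dftMat_sub, hε.zero_freq, he0, sub_self]) (fun I => (hε.symm I).sub (hes I))
    (by simp only [hdr]; exact heq.sub hSe)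
    (fun I => by rw [hdr]; exact (stress_isSymm hCN ε I).sub (hSs I))
  -- Because `0 ∈ s`, truncation and sampling preserve the mean stress exactly.
  have hmean : ((∫ x, ddot (C x) (symPart (G x) + E) m n ∂cellMeasure : ℝ) : ℂ) =
      ((N : ℂ) ^ 3)⁻¹ * ∑ I, S I m n := by
    rw [← coeff_zero, ← dft_zero_freq]
    have := dftMat_trunc hN hs (fun x => ddot (C x) (symPart (G x) + E)) (zero_mem_freq hN) m n
    rw [if_pos hs0] at this
    exact this.symm
  rw [hmean, ← mul_sub, ← Finset.sum_sub_distrib]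
  refine (norm_sq_mean_le hN _).trans ?_
  have hN3 : 0 ≤ ((N : ℝ) ^ 3)⁻¹ := by positivity
  -- The stress error is `CN : d + r`. Bounding `d` by `r / a` in the mean square then produces the
  -- constant `2 * K / a ^ 2 + 2`.
  have h1 : ∀ I, ‖ddot (CN I).toComplex (ε I) m n - S I m n‖ ^ 2 ≤
      2 * K * nsq (d I) + 2 * nsq (r I) := by
    intro I
    refine (norm_sq_le_nsq (ddot (CN I).toComplex (ε I) - S I) m n).trans ?_
    rw [← hdr]
    refine (nsq_add_le _ _).trans ?_
    have := nsq_ddot_le (CN I) (d I)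
    have := mul_le_mul_of_nonneg_right (hK I) (nsq_nonneg (d I))
    linarith
  have h2 : ((N : ℝ) ^ 3)⁻¹ * ∑ I, ‖ddot (CN I).toComplex (ε I) m n - S I m n‖ ^ 2 ≤
      2 * K * gridNsq d + 2 * gridNsq r := by
    refine (mul_le_mul_of_nonneg_left (Finset.sum_le_sum fun I _ => h1 I) hN3).trans (le_of_eq ?_)
    simp only [gridNsq, Finset.sum_add_distrib, ← Finset.mul_sum]
    ring
  refine h2.trans ?_
  have h3 : gridNsq d ≤ gridNsq r / a ^ 2 := by
    rw [le_div_iff₀ (by positivity)]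
    linarith
  have h4 := mul_le_mul_of_nonneg_left h3 (by positivity : 0 ≤ 2 * K)
  calc 2 * K * gridNsq d + 2 * gridNsq r ≤ 2 * K * (gridNsq r / a ^ 2) + 2 * gridNsq r := by
        linarith
    _ = _ := by ring

/-- The mean stresses of the scheme converge to the mean stress of the cell problem. -/
lemma tendsto_mean_stress {CN : (N : ℕ) → (Fin 3 → Fin N) → Tensor ℝ} {Cref : Tensor ℝ}
    (hA : AssumptionA D Λ C) (hB : AssumptionB Λ)
    (hC : ∀ N, 1 ≤ N → AssumptionC D Λ N (CN N)) (href : IsReferenceMedium Cref)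
    {Ceff : Tensor ℝ} {CeffN : ℕ → Tensor ℂ} (hCeff : IsEffectiveTensor C Ceff)
    (hCeffN : ∀ N, 1 ≤ N → IsMSEffectiveTensor Cref (CN N) (CeffN N)) {E : Mat ℝ}
    (hE : E.IsSymm) (m n : Fin 3) :
    Tendsto (fun N => ddot (CeffN N) E.toComplex m n) atTop (𝓝 ((ddot Ceff E m n : ℝ) : ℂ)) := by
  obtain ⟨u, G, h, hT⟩ := hCeff.2 E hE
  obtain ⟨a, b, ha, -, hab⟩ := hB.coercive
  set K := ∑ l, (Λ l).nsq with hK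
  have hK0 : 0 ≤ K := Finset.sum_nonneg fun l _ => (Λ l).nsq_nonneg
  set K' := 2 * K / a ^ 2 + 2 with hK'
  have hK'0 : 0 < K' := by positivity
  rw [Metric.tendsto_nhds]
  intro ρ hρ
  have hδ : 0 < ρ ^ 2 / K' := by positivity
  -- The truncation is fixed before `N`, with its residual on the cell below `ρ ^ 2 / K'`; the grid
  -- residual then falls below the same threshold for large `N`.
  obtain ⟨s, hs0, hsδ⟩ := ((eventually_ge_atTop {0}).and
    ((tendsto_residual hA h.memLp_strain).eventually (gt_mem_nhds hδ))).exists
  obtain ⟨B₁, hB₁⟩ := nsq_trunc_bounded s fun x => symPart (G x) + E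
  obtain ⟨B₂, hB₂⟩ := nsq_trunc_bounded s fun x => ddot (C x) (symPart (G x) + E)
  have hlim := tendsto_gridNsq hA hC (continuous_trunc s fun x => symPart (G x) + E)
    (continuous_trunc s fun x => ddot (C x) (symPart (G x) + E))
    (fun x => (hB₁ x).trans (le_max_left B₁ B₂)) (fun x => (hB₂ x).trans (le_max_right B₁ B₂))
  filter_upwards [hlim.eventually (gt_mem_nhds hsδ), eventually_ge_atTop 1,
    eventually_subset_freq s] with N hN hN1 hsN
  obtain ⟨ε, hε, hTN⟩ := (hCeffN N hN1).2 E hE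
  have hex := (hC N hN1).exists_eq
  have herr := stress_error_le (K := K) hA hB href hN1 ha
    (fun I F hF => by
      obtain ⟨l, hl⟩ := hex I
      rw [hl]
      exact (hab F hF l).1)
    (fun I => by
      obtain ⟨l, hl⟩ := hex I
      rw [hl]
      exact hB.symm l)
    (fun I => by
      obtain ⟨l, hl⟩ := hex I
      rw [hl]
      exact Finset.single_le_sum (fun l _ => (Λ l).nsq_nonneg) (Finset.mem_univ l))
    h hE hε (hs0 (Finset.mem_singleton_self 0)) hsN m n
  rw [hTN, hT, dist_eq_norm]
  have hlt := herr.trans_lt (mul_lt_mul_of_pos_left hN hK'0)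
  rw [mul_div_cancel₀ _ hK'0.ne'] at hlt
  refine lt_of_pow_lt_pow_left₀ 2 hρ.le ?_
  simpa [Matrix.sum_apply] using hlt

end Convergence

end MS

theorem mainTheorem2 (M : ℕ) (D : Fin (M + 1) → Set MS.Space) (Λ : Fin (M + 1) → MS.Tensor ℝ)
    (C : MS.Space → MS.Tensor ℝ) (CN : (N : ℕ) → (Fin 3 → Fin N) → MS.Tensor ℝ)
    (Cref : MS.Tensor ℝ) (hA : MS.AssumptionA D Λ C) (hB : MS.AssumptionB Λ)
    (hC : ∀ N, 1 ≤ N → MS.AssumptionC D Λ N (CN N)) (href : MS.IsReferenceMedium Cref) :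
    -- the cell problem has a solution, unique up to null sets
    (∀ E : MS.Mat ℝ, E.IsSymm → (∃ u G, MS.IsCellSolution C E u G) ∧
      ∀ u G u' G', MS.IsCellSolution C E u G → MS.IsCellSolution C E u' G' →
        u =ᵐ[MS.cellMeasure] u' ∧ G =ᵐ[MS.cellMeasure] G') ∧
    -- the scheme has exactly one solution at each resolution
    (∀ N, 1 ≤ N → ∀ E : MS.Mat ℝ, E.IsSymm → ∃! ε, MS.IsMSSolution Cref (CN N) E ε) ∧
    -- both effective tensors are well defined
    (∃! Ceff, MS.IsEffectiveTensor C Ceff) ∧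
    (∀ N, 1 ≤ N → ∃! CeffN, MS.IsMSEffectiveTensor Cref (CN N) CeffN) ∧
    -- convergence as the resolution tends to infinity
    ∀ (Ceff : MS.Tensor ℝ) (CeffN : ℕ → MS.Tensor ℂ), MS.IsEffectiveTensor C Ceff →
      (∀ N, 1 ≤ N → MS.IsMSEffectiveTensor Cref (CN N) (CeffN N)) →
        Tendsto CeffN atTop (𝓝 Ceff.toComplex) := by
  obtain ⟨a, b, ha, -, hab⟩ := hB.coercive
  have hsymm : ∀ N, 1 ≤ N → ∀ I, MS.IsStiffnessSymm (CN N I) := by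
    intro N hN I
    obtain ⟨l, hl⟩ := (hC N hN).exists_eq I
    rw [hl]
    exact hB.symm l
  have hco : ∀ N, 1 ≤ N → ∀ I, ∀ F : MS.Mat ℝ, F.IsSymm →
      a * MS.frob F F ≤ MS.frob F (MS.ddot (CN N I) F) := by
    intro N hN I F hF
    obtain ⟨l, hl⟩ := (hC N hN).exists_eq I
    rw [hl]
    exact (hab F hF l).1
  refine ⟨fun E _ => ⟨MS.exists_isCellSolution hA hB E, fun u G u' G' h h' => h.unique hA hB h'⟩,
    fun N hN E hE => MS.existsUnique_isMSSolution hN href (hsymm N hN) ha (hco N hN) hE,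
    MS.existsUnique_isEffectiveTensor hA hB,
    fun N hN => MS.existsUnique_isMSEffectiveTensor hN href (hsymm N hN) ha (hco N hN),
    fun Ceff CeffN hCeff hCeffN => ?_⟩
  -- Convergence is entrywise, and each entry is a mean stress for the macroscopic strain `symBasis
  -- p q`.
  simp only [tendsto_pi_nhds]
  intro m n p q
  have h := MS.tendsto_mean_stress hA hB hC href hCeff hCeffN (MS.symBasis_isSymm p q) m n
  have e : Ceff.toComplex m n p q = ((MS.ddot Ceff (MS.symBasis p q) m n : ℝ) : ℂ) := by
    have := MS.entry_eq_ddot hCeff.1 m n p q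
    rw [MS.Tensor.toComplex_apply, this]
    congr 2
  rw [e]
  refine h.congr' ?_
  filter_upwards [eventually_ge_atTop 1] with N hN
  exact (MS.entry_eq_ddot (hCeffN N hN).1 m n p q).symm
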